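/- Lemma 4.1. Let $d,k\in\mathbb N$ and $R>0$, and consider one of the two models, under the assumption $$k\ge \tfrac d2>2\ \text{ for wave maps},\qquad k\ge \tfrac{d-1}2>\tfrac52\ \text{ for Yang-Mills}.$$ Setting. Let $\mathbb B^d_R=\{x\in\mathbb R^d: |x|<R\}$, and let $C^\infty_{\rm rad}(\overline{\mathbb B^d_R})$ be the space of real-valued, smooth, radially symmetric functions on $\mathbb B^d_R$ all of whose partial derivatives are bounded. For $j\in\mathbb N_0$ let $H^j_{\rm rad}(\mathbb B^d_R)$ be its completion with respect to $\|f\|_{H^j(\mathbb B^d_R)}=\big(\sum_{0\le|\alpha|\le j}\|\partial^\alpha f\|^2_{L^2(\mathbb B^d_R)}\big)^{1/2}$, and let $\mathfrak H^k_{\rm rad}(\mathbb B^d_R)=H^k_{\rm rad}(\mathbb B^d_R)\times H^{k-1}_{\rm rad}(\mathbb B^d_R)$ with the norm $\|(f_1,f_2)\|_{\mathfrak H^k(\mathbb B^d_R)}=\big(\|f_1\|^2_{H^k(\mathbb B^d_R)}+\|f_2\|_{H^{k-1}(\mathbb B^d_R)}^2\big)^{1/2}$. For $x\in\mathbb R^d$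 and $z\in\mathbb R$ let $$F(x,z)=\begin{cases}-\frac{d-3}2\,\frac{\sin(2|x|z)-2|x|z}{|x|^3}&\text{for wave maps},\\ (d-4)\,(3z^2-|x|^2z^3)&\text{for Yang-Mills},\end{cases}\qquad F'(x,z)=\partial_zF(x,z),$$ $$\psi^*(t,x)=\begin{cases}\frac4{|x|}\arctan\Big(\frac{|x|}{\sqrt{d-4}\,t+\sqrt{(d-4)t^2+|x|^2}}\Big)&\text{for wave maps},\\ \frac1{\alpha_{d-2}t^2+\beta_{d-2}|x|^2}&\text{for Yang-Mills},\end{cases}$$ where $$\alpha_n=\frac{3(n-2)(n-4)+(n+2)\sqrt{3(n-2)(n-4)}}{12(n-1)},\qquad \beta_n=\frac{3(n-2)-\sqrt{3(n-2)(n-4)}}{4(n-1)},$$ and where the wave maps expressions are continuously extended to $x=0$ (for $\psi^*$: with $t>0$). Let $h:\mathbb R^d\to\mathbb R$ be smooth and radially symmetric with $h(0)<0$ and, for all $\xi\in\mathbb R^d$, $|(\partial h)(\xi)|<1$ and $(\partial^2h)(\xi)$ positive semidefinite. Put $c(\xi)=\xi^i\partial_ih(\xi)-h(\xi)$ and $w(\xi)=1-|(\partial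 h)(\xi)|^2$, and, with $\psi^*_h(\xi)=\psi^*(-h(\xi),\xi)$, $$N(f)(\xi)=F\big(\xi,\psi^*_h(\xi)+f(\xi)\big)-F'\big(\xi,\psi^*_h(\xi)\big)f(\xi)-F\big(\xi,\psi^*_h(\xi)\big),\qquad \mathbf N(\mathbf f)=\begin{bmatrix}0\\ \frac cw N(f_1)\end{bmatrix}.$$ Claim. $\mathbf N$ maps $C^\infty_{\rm rad}(\overline{\mathbb B^d_R})^2$ into itself, and it has a unique extension to a map $\mathbf N:\mathfrak H^k_{\rm rad}(\mathbb B^d_R)\to\mathfrak H^k_{\rm rad}(\mathbb B^d_R)$ with the following property: for every $M>0$ there is a constant $C>0$ (depending only on $M$, the model, $d$, $k$, $R$ and $h$) such that $$\|\mathbf N(\mathbf f)-\mathbf N(\mathbf g)\|_{\mathfrak H^k(\mathbb B^d_R)}\le C\,\big(\|\mathbf f\|_{\mathfrak H^k(\mathbb B^d_R)}+\|\mathbf g\|_{\mathfrak H^k(\mathbb B^d_R)}\big)\,\|\mathbf f-\mathbf g\|_{\mathfrak H^k(\mathbb B^d_R)}$$ for all $\mathbf f,\mathbf g\in\mathfrak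 H^k_{\rm rad}(\mathbb B^d_R)$ with $\|\mathbf f\|_{\mathfrak H^k(\mathbb B^d_R)},\|\mathbf g\|_{\mathfrak H^k(\mathbb B^d_R)}\le M$. -/

import Mathlib

open MeasureTheory
open scoped ContDiff

namespace BlowupStability

/-! ## Smooth radial functions on the ball and their Sobolev norms -/

/-- The `d`-dimensional Euclidean space. -/
abbrev E (d : ℕ) : Type := EuclideanSpace ℝ (Fin d)

/-- The open ball of radius `R` about the origin. -/
def Ball (d : ℕ) (R : ℝ) : Set (E d) := Metric.ball 0 R

/-- The partial derivative `∂ᵢ f`. -/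
noncomputable def partialDeriv {d : ℕ} (i : Fin d) (f : E d → ℝ) : E d → ℝ :=
  fun x => fderiv ℝ f x (EuclideanSpace.single i 1)

/-- The partial derivative `∂^α f = ∂₀^(α 0) ∂₁^(α 1) ⋯ f` for a multi-index `α`. -/
noncomputable def multiDeriv {d : ℕ} (α : Fin d → ℕ) (f : E d → ℝ) : E d → ℝ :=
  (List.finRange d).foldr (fun i g => (partialDeriv i)^[α i] g) f

theorem multiDeriv_induction {d : ℕ} (P : (E d → ℝ) → Prop)
    (hP : ∀ i g, P g → P (partialDeriv i g)) (α : Fin d → ℕ) (f : E d → ℝ) (hf : P f) :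
    P (multiDeriv α f) := by
  have key : ∀ (i : Fin d) (n : ℕ) (g : E d → ℝ), P g → P ((partialDeriv i)^[n] g) := by
    intro i n
    induction n with
    | zero => intro g hg; simpa using hg
    | succ n ih =>
      intro g hg
      rw [Function.iterate_succ_apply]
      exact ih _ (hP i g hg)
  unfold multiDeriv
  induction List.finRange d with
  | nil => simpa using hf
  | cons i l ih => exact key i _ _ ih

theorem contDiffOn_partialDeriv {d : ℕ} {R : ℝ} (i : Fin d) {f : E d → ℝ}
    (hf : ContDiffOn ℝ ∞ f (Ball d R)) : ContDiffOn ℝ ∞ (partialDeriv i f) (Ball d R) := by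
  have h1 : ContDiffOn ℝ ∞ (fderiv ℝ f) (Ball d R) :=
    hf.fderiv_of_isOpen Metric.isOpen_ball (by simp)
  exact h1.clm_apply contDiffOn_const

theorem contDiffOn_multiDeriv {d : ℕ} {R : ℝ} (α : Fin d → ℕ) {f : E d → ℝ}
    (hf : ContDiffOn ℝ ∞ f (Ball d R)) : ContDiffOn ℝ ∞ (multiDeriv α f) (Ball d R) :=
  multiDeriv_induction (fun g => ContDiffOn ℝ ∞ g (Ball d R))
    (fun i _ hg => contDiffOn_partialDeriv i hg) α f hf

theorem differentiableAt_of_contDiffOn {d : ℕ} {R : ℝ} {f : E d → ℝ}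
    (hf : ContDiffOn ℝ ∞ f (Ball d R)) {x : E d} (hx : x ∈ Ball d R) :
    DifferentiableAt ℝ f x :=
  (hf.differentiableOn (by simp)).differentiableAt (Metric.isOpen_ball.mem_nhds hx)

theorem multiDeriv_lincomb {d : ℕ} {R : ℝ} (α : Fin d → ℕ) (a b : ℝ) {f g : E d → ℝ}
    (hf : ContDiffOn ℝ ∞ f (Ball d R)) (hg : ContDiffOn ℝ ∞ g (Ball d R)) :
    Set.EqOn (multiDeriv α (a • f + b • g)) (a • multiDeriv α f + b • multiDeriv α g)
      (Ball d R) := by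
  let Q : (E d → ℝ) → (E d → ℝ) → (E d → ℝ) → Prop := fun u v w =>
    ContDiffOn ℝ ∞ v (Ball d R) ∧ ContDiffOn ℝ ∞ w (Ball d R) ∧
      Set.EqOn u (a • v + b • w) (Ball d R)
  have step : ∀ i u v w, Q u v w →
      Q (partialDeriv i u) (partialDeriv i v) (partialDeriv i w) := by
    rintro i u v w ⟨hv, hw, hu⟩
    refine ⟨contDiffOn_partialDeriv i hv, contDiffOn_partialDeriv i hw, fun x hx => ?_⟩
    have h1 : fderiv ℝ u x = fderiv ℝ (a • v + b • w) x :=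
      (hu.eventuallyEq_of_mem (Metric.isOpen_ball.mem_nhds hx)).fderiv_eq
    have hv' := differentiableAt_of_contDiffOn hv hx
    have hw' := differentiableAt_of_contDiffOn hw hx
    have h2 : fderiv ℝ (a • v + b • w) x = a • fderiv ℝ v x + b • fderiv ℝ w x :=
      ((hv'.hasFDerivAt.const_smul a).add (hw'.hasFDerivAt.const_smul b)).fderiv
    simp [partialDeriv, h1, h2]
  have iter : ∀ (i : Fin d) (n : ℕ) u v w, Q u v w →
      Q ((partialDeriv i)^[n] u) ((partialDeriv i)^[n] v) ((partialDeriv i)^[n] w) := by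
    intro i n
    induction n with
    | zero => intro u v w h; simpa using h
    | succ n ih =>
      intro u v w h
      simp only [Function.iterate_succ_apply]
      exact ih _ _ _ (step i u v w h)
  have main : Q (multiDeriv α (a • f + b • g)) (multiDeriv α f) (multiDeriv α g) := by
    unfold multiDeriv
    induction List.finRange d with
    | nil => exact ⟨hf, hg, fun x _ => rfl⟩
    | cons i l ih => exact iter i _ _ _ _ ih
  exact main.2.2

/-- The space of smooth radially symmetric functions on the open ball of radius `R` all of whose
partial derivatives are bounded. A function on the ball is represented by its
extension by zero to the whole space, so that every function has exactly one representative. -/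
def SmoothRad (d : ℕ) (R : ℝ) : Submodule ℝ (E d → ℝ) where
  carrier := {f | (∀ x, x ∉ Ball d R → f x = 0) ∧
    ContDiffOn ℝ ∞ f (Ball d R) ∧
    (∀ α : Fin d → ℕ, ∃ B : ℝ, ∀ x ∈ Ball d R, |multiDeriv α f x| ≤ B) ∧
    ∀ x y : E d, ‖x‖ = ‖y‖ → f x = f y}
  zero_mem' := by
    refine ⟨fun _ _ => rfl, contDiffOn_const, fun α => ⟨0, fun x hx => ?_⟩, fun _ _ _ => rfl⟩
    have h := multiDeriv_lincomb (R := R) α 0 0 (f := fun _ : E d => (0 : ℝ))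
      (g := fun _ => 0) contDiffOn_const contDiffOn_const hx
    have h0 : (0 : ℝ) • (fun _ : E d => (0 : ℝ)) + (0 : ℝ) • (fun _ : E d => (0 : ℝ)) = 0 := by
      ext; simp
    rw [h0] at h
    simp [h]
  add_mem' := by
    rintro f g ⟨f1, f2, f3, f4⟩ ⟨g1, g2, g3, g4⟩
    refine ⟨fun x hx => by simp [f1 x hx, g1 x hx], f2.add g2, fun α => ?_,
      fun x y h => by simp [f4 x y h, g4 x y h]⟩
    obtain ⟨A, hA⟩ := f3 α
    obtain ⟨B, hB⟩ := g3 α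
    refine ⟨A + B, fun x hx => ?_⟩
    have h := multiDeriv_lincomb α 1 1 f2 g2 hx
    simp only [one_smul] at h
    rw [h]
    exact (abs_add_le _ _).trans (add_le_add (hA x hx) (hB x hx))
  smul_mem' := by
    rintro a f ⟨f1, f2, f3, f4⟩
    refine ⟨fun x hx => by simp [f1 x hx], f2.const_smul a, fun α => ?_,
      fun x y h => by simp [f4 x y h]⟩
    obtain ⟨A, hA⟩ := f3 α
    refine ⟨|a| * A, fun x hx => ?_⟩
    have h := multiDeriv_lincomb α a 0 f2 f2 hx
    simp only [zero_smul, add_zero] at h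
    rw [h, Pi.smul_apply, smul_eq_mul, abs_mul]
    exact mul_le_mul_of_nonneg_left (hA x hx) (abs_nonneg a)

theorem memLp_multiDeriv {d : ℕ} {R : ℝ} (f : SmoothRad d R) (α : Fin d → ℕ) :
    MemLp (multiDeriv α (f : E d → ℝ)) 2 (volume.restrict (Ball d R)) := by
  obtain ⟨B, hB⟩ := f.2.2.2.1 α
  have hfin : IsFiniteMeasure (volume.restrict (Ball d R)) :=
    ⟨by simpa [Ball] using measure_ball_lt_top⟩
  refine MemLp.of_bound
    ((contDiffOn_multiDeriv α f.2.2.1).continuousOn.aestronglyMeasurable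
      Metric.isOpen_ball.measurableSet) B ?_
  exact (ae_restrict_iff' Metric.isOpen_ball.measurableSet).2 (Filter.Eventually.of_forall hB)

/-- The multi-indices `α` in dimension `d` with `|α| ≤ k`. -/
abbrev MultiIndex (d k : ℕ) : Type := {α : Fin d → Fin (k + 1) // ∑ i, (α i : ℕ) ≤ k}

/-- The multi-index as a function with values in `ℕ`. -/
def MultiIndex.toFun {d k : ℕ} (α : MultiIndex d k) : Fin d → ℕ := fun i => (α.1 i : ℕ)

/-- The map `f ↦ (∂^α f)_{|α| ≤ k}` into the `ℓ²`-sum of copies of `L²` of the ball. -/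
noncomputable def jet (d k : ℕ) (R : ℝ) :
    SmoothRad d R →ₗ[ℝ]
      PiLp 2 (fun _ : MultiIndex d k => Lp ℝ 2 (volume.restrict (Ball d R))) where
  toFun f := WithLp.toLp 2 fun α => (memLp_multiDeriv f α.toFun).toLp _
  map_add' f g := by
    ext1 α
    change _ = (memLp_multiDeriv f α.toFun).toLp _ + (memLp_multiDeriv g α.toFun).toLp _
    rw [← MemLp.toLp_add]
    refine MemLp.toLp_congr (memLp_multiDeriv (f + g) α.toFun) _
      ((ae_restrict_iff' Metric.isOpen_ball.measurableSet).2
        (Filter.Eventually.of_forall fun x hx => ?_))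
    have h := multiDeriv_lincomb α.toFun 1 1 f.2.2.1 g.2.2.1 hx
    simp only [one_smul] at h
    exact h
  map_smul' a f := by
    ext1 α
    change _ = a • (memLp_multiDeriv f α.toFun).toLp _
    rw [← MemLp.toLp_const_smul]
    refine MemLp.toLp_congr (memLp_multiDeriv (a • f) α.toFun) _
      ((ae_restrict_iff' Metric.isOpen_ball.measurableSet).2
        (Filter.Eventually.of_forall fun x hx => ?_))
    have h := multiDeriv_lincomb α.toFun a 0 f.2.2.1 f.2.2.1 hx
    simp only [zero_smul, add_zero] at h
    exact h

/-- The space `SmoothRad d R`, endowed with the Sobolev norm of order `k`. -/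
def SobolevSmoothRad (d _k : ℕ) (R : ℝ) : Type := SmoothRad d R

noncomputable instance (d k : ℕ) (R : ℝ) : AddCommGroup (SobolevSmoothRad d k R) :=
  inferInstanceAs (AddCommGroup (SmoothRad d R))

noncomputable instance (d k : ℕ) (R : ℝ) : Module ℝ (SobolevSmoothRad d k R) :=
  inferInstanceAs (Module ℝ (SmoothRad d R))

/-- The map `jet`, on the space that carries the Sobolev norm. -/
noncomputable def sobolevJet (d k : ℕ) (R : ℝ) :
    SobolevSmoothRad d k R →ₗ[ℝ]
      PiLp 2 (fun _ : MultiIndex d k => Lp ℝ 2 (volume.restrict (Ball d R))) :=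
  jet d k R

/-- The Sobolev norm of order `k`, which is `(∑_{|α| ≤ k} ‖∂^α f‖²_{L²})^{1/2}`
(see `norm_sobolevSmoothRad`). -/
noncomputable instance (d k : ℕ) (R : ℝ) : SeminormedAddCommGroup (SobolevSmoothRad d k R) :=
  SeminormedAddCommGroup.induced _ _ (sobolevJet d k R)

noncomputable instance (d k : ℕ) (R : ℝ) : NormedSpace ℝ (SobolevSmoothRad d k R) :=
  NormedSpace.induced _ _ _ (sobolevJet d k R)

/-- A smooth radial function as an element of the space with the Sobolev norm of order `k`. -/
def toSobolev {d : ℕ} {R : ℝ} (k : ℕ) (f : SmoothRad d R) : SobolevSmoothRad d k R := f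

theorem norm_sobolevSmoothRad {d : ℕ} {R : ℝ} (k : ℕ) (f : SmoothRad d R) :
    ‖toSobolev k f‖ =
      √(∑ α : MultiIndex d k, ∫ x in Ball d R, multiDeriv α.toFun (f : E d → ℝ) x ^ 2) := by
  change ‖jet d k R f‖ = _
  rw [PiLp.norm_eq_of_L2]
  congr 1
  refine Finset.sum_congr rfl fun α _ => ?_
  rw [← real_inner_self_eq_norm_sq, L2.inner_def]
  refine integral_congr_ae ?_
  filter_upwards [(memLp_multiDeriv f α.toFun).coeFn_toLp] with x hx
  change inner ℝ (((memLp_multiDeriv f α.toFun).toLp _ : E d → ℝ) x)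
    (((memLp_multiDeriv f α.toFun).toLp _ : E d → ℝ) x) = _
  rw [hx, real_inner_self_eq_norm_sq, Real.norm_eq_abs, sq_abs]

/-- The radial Sobolev space `H^k_rad` of the ball: the completion of the smooth radial
functions with respect to the Sobolev norm of order `k`. -/
abbrev HRad (d k : ℕ) (R : ℝ) : Type := UniformSpace.Completion (SobolevSmoothRad d k R)

/-- The product Hilbert space `H^k_rad × H^(k-1)_rad`, with the norm
`‖(f₁, f₂)‖ = (‖f₁‖² + ‖f₂‖²)^{1/2}`. -/
abbrev HPair (d k : ℕ) (R : ℝ) : Type := WithLp 2 (HRad d k R × HRad d (k - 1) R)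

/-- The inclusion of pairs of smooth radial functions into `H^k_rad × H^(k-1)_rad`. -/
noncomputable def incl {d : ℕ} {R : ℝ} (k : ℕ) (f₁ f₂ : SmoothRad d R) : HPair d k R :=
  WithLp.toLp 2 ((toSobolev k f₁ : HRad d k R), (toSobolev (k - 1) f₂ : HRad d (k - 1) R))

/-! ## The nonlinearity -/

/-- The two equations: corotational wave maps and equivariant Yang-Mills. -/
inductive Model : Type
  | waveMaps
  | yangMills

/-- The nonlinearity `F (x, z)` of the radial semilinear wave equation in dimension `d`.
For wave maps, the value at `x = 0` is the limit as `x → 0`. -/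
noncomputable def nonlinF (m : Model) {d : ℕ} (x : E d) (z : ℝ) : ℝ :=
  match m with
  | .waveMaps =>
      if x = 0 then 2 / 3 * ((d : ℝ) - 3) * z ^ 3
      else -(((d : ℝ) - 3) / 2) * ((Real.sin (2 * ‖x‖ * z) - 2 * ‖x‖ * z) / ‖x‖ ^ 3)
  | .yangMills => ((d : ℝ) - 4) * (3 * z ^ 2 - ‖x‖ ^ 2 * z ^ 3)

/-- The derivative `F' (x, z) = ∂_z F (x, z)`. -/
noncomputable def nonlinF' (m : Model) {d : ℕ} (x : E d) (z : ℝ) : ℝ :=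
  deriv (fun y => nonlinF m x y) z

/-- The coefficient `α_n` of the Yang-Mills blowup profile. -/
noncomputable def ymAlpha (n : ℝ) : ℝ :=
  1 / 12 * ((3 * (n - 2) * (n - 4) + (n + 2) * √(3 * (n - 2) * (n - 4))) / (n - 1))

/-- The coefficient `β_n` of the Yang-Mills blowup profile. -/
noncomputable def ymBeta (n : ℝ) : ℝ :=
  1 / 4 * ((3 * (n - 2) - √(3 * (n - 2) * (n - 4))) / (n - 1))

/-- The self-similar blowup profile `ψ* (t, x)` in dimension `d = n + 2`. For wave maps, the value
at `x = 0` is the limit as `x → 0`, for `t > 0`. -/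
noncomputable def profile (m : Model) {d : ℕ} (t : ℝ) (x : E d) : ℝ :=
  match m with
  | .waveMaps =>
      if x = 0 then 2 / (√((d : ℝ) - 4) * t)
      else 4 / ‖x‖ *
        Real.arctan (‖x‖ / (√((d : ℝ) - 4) * t + √(((d : ℝ) - 4) * t ^ 2 + ‖x‖ ^ 2)))
  | .yangMills => 1 / (ymAlpha ((d : ℝ) - 2) * t ^ 2 + ymBeta ((d : ℝ) - 2) * ‖x‖ ^ 2)

/-- The admissible height functions `h` of similarity coordinates. -/
structure IsHeight {d : ℕ} (h : E d → ℝ) : Prop where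
  smooth : ContDiff ℝ ∞ h
  radial : ∀ x y : E d, ‖x‖ = ‖y‖ → h x = h y
  neg_zero : h 0 < 0
  gradient_lt : ∀ x, ‖gradient h x‖ < 1
  hessian_nonneg : ∀ x v : E d, 0 ≤ fderiv ℝ (fderiv ℝ h) x v v

/-- The coefficient `c(ξ) = ξⁱ ∂ᵢh(ξ) - h(ξ)`. -/
noncomputable def coeffC {d : ℕ} (h : E d → ℝ) (ξ : E d) : ℝ :=
  inner ℝ ξ (gradient h ξ) - h ξ

/-- The coefficient `w(ξ) = 1 - ∂ⁱh(ξ) ∂ᵢh(ξ)`. -/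
noncomputable def coeffW {d : ℕ} (h : E d → ℝ) (ξ : E d) : ℝ := 1 - ‖gradient h ξ‖ ^ 2

/-- The nonlinear remainder `N(f)(ξ)` at the blowup profile. -/
noncomputable def remainder (m : Model) {d : ℕ} (h f : E d → ℝ) (ξ : E d) : ℝ :=
  nonlinF m ξ (profile m (-h ξ) ξ + f ξ) - nonlinF' m ξ (profile m (-h ξ) ξ) * f ξ
    - nonlinF m ξ (profile m (-h ξ) ξ)

open Classical in
/-- The second component `(c / w) N(f)` of the nonlinearity, as a function on the ball of
radius `R` (extended by zero). -/
noncomputable def secondComponent (m : Model) {d : ℕ} (h : E d → ℝ) (R : ℝ) (f : E d → ℝ) :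
    E d → ℝ :=
  fun ξ => if ξ ∈ Ball d R then coeffC h ξ / coeffW h ξ * remainder m h f ξ else 0

end BlowupStability

namespace BlowupStability

/-! ## Functions on the ball with bounded derivatives -/

/-! The remainder vanishes to second order at `f = 0`, so `N(f) - N(g)` should carry a factor `f -
g` and a second factor that is small with `f` and `g`. For Yang-Mills this is polynomial algebra
(`remainder_yangMills_sub`). For wave maps the addition theorems for sine and cosine give it exactly
(`waveMaps_difference_identity`). In both cases the difference is a sum of products of three
functions of `H^k_rad` and one coefficient, which is either smooth or a smooth function of vector
fields `z(x) x` with `z` in `H^k_rad`.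

Everything rests on the resulting estimate from `H^k × H^k × H^k` to `H^(k-1)`,
`exists_norm_toSobolev_mul_le`. Put `κ = k - d/2`; the hypotheses give `κ ≥ -1/2`, so `H^k` need not
embed into `L^∞`. Radial symmetry replaces the embedding: the norm of `D^j f` depends on `|x|` only,
and one-dimensional inequalities along a ray apply. Hardy's inequality, iterated, bounds `|x|^(-s)
D^a f` in `L²` if `s ≤ k - a` and `s < d/2` (`exists_rayInt_le`). The fundamental theorem of
calculus then gives `|D^j f(x)| ≤ C ‖f‖ |x|^(-s)` for `j < k`, `s > 0` and `s ≥ j - κ`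
(`exists_norm_iteratedFDeriv_le`).

After the Leibniz rule, the factor with the most derivatives is measured in weighted `L²` and the
others pointwise. The exponents fit (`sobWt_add_le`) because the target has one derivative less: for
`κ = -1/2` each of the two pointwise factors may lose `1/2`. The coefficient is harmless since `z =
O(|x|^(-1))` makes `z(x) x` bounded, and its derivatives obey weighted bounds of their own
(`exists_weightBdd_comp`).

The estimate on smooth functions is Lipschitz on bounded sets, which suffices to extend the map to
the completion (`QuadLipschitz.exists_extension`); density of smooth pairs gives uniqueness. -/

theorem isOpen_Ball (d : ℕ) (R : ℝ) : IsOpen (Ball d R) := Metric.isOpen_ball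

theorem mem_Ball {d : ℕ} {R : ℝ} {x : E d} : x ∈ Ball d R ↔ ‖x‖ < R := by
  simp [Ball]

theorem ball_mem_nhds {d : ℕ} {R : ℝ} {x : E d} (hx : x ∈ Ball d R) : Ball d R ∈ nhds x :=
  (isOpen_Ball d R).mem_nhds hx

/-- Functions that are smooth on the ball with all iterated derivatives bounded. -/
def BddSmooth {d : ℕ} (R : ℝ) {V : Type*} [NormedAddCommGroup V] [NormedSpace ℝ V]
    (f : E d → V) : Prop :=
  ContDiffOn ℝ ∞ f (Ball d R) ∧
    ∀ j : ℕ, ∃ B : ℝ, ∀ x ∈ Ball d R, ‖iteratedFDeriv ℝ j f x‖ ≤ B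

section BddSmooth

variable {d : ℕ} {R : ℝ} {V : Type*} [NormedAddCommGroup V] [NormedSpace ℝ V]

theorem eventuallyEq_of_eqOn_Ball {W : Type*} {f g : E d → W} (h : Set.EqOn f g (Ball d R)) {x : E d}
    (hx : x ∈ Ball d R) : f =ᶠ[nhds x] g :=
  h.eventuallyEq_of_mem (ball_mem_nhds hx)

theorem iteratedFDeriv_congr_Ball {f g : E d → V} (h : Set.EqOn f g (Ball d R)) (j : ℕ) :
    Set.EqOn (iteratedFDeriv ℝ j f) (iteratedFDeriv ℝ j g) (Ball d R) := fun _ hx =>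
  ((eventuallyEq_of_eqOn_Ball h hx).iteratedFDeriv ℝ j).eq_of_nhds

theorem BddSmooth.congr {f g : E d → V} (hf : BddSmooth R f) (h : Set.EqOn g f (Ball d R)) :
    BddSmooth R g := by
  refine ⟨hf.1.congr h, fun j => ?_⟩
  obtain ⟨B, hB⟩ := hf.2 j
  exact ⟨B, fun x hx => by rw [iteratedFDeriv_congr_Ball h j hx]; exact hB x hx⟩

theorem BddSmooth.exists_bound {f : E d → V} (hf : BddSmooth R f) (n : ℕ) :
    ∃ B : ℝ, 0 ≤ B ∧ ∀ j ≤ n, ∀ x ∈ Ball d R, ‖iteratedFDeriv ℝ j f x‖ ≤ B := by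
  choose B hB using hf.2
  refine ⟨∑ j ∈ Finset.range (n + 1), |B j|, Finset.sum_nonneg fun _ _ => abs_nonneg _,
    fun j hj x hx => ((hB j x hx).trans (le_abs_self _)).trans ?_⟩
  exact Finset.single_le_sum (f := fun j => |B j|) (fun _ _ => abs_nonneg _)
    (Finset.mem_range.2 (Nat.lt_succ_of_le hj))

theorem bddSmooth_of_contDiff {f : E d → V} (hf : ContDiff ℝ ∞ f) : BddSmooth R f := by
  refine ⟨hf.contDiffOn, fun j => ?_⟩
  have hc : Continuous (iteratedFDeriv ℝ j f) :=
    hf.continuous_iteratedFDeriv (by exact_mod_cast le_top)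
  obtain ⟨B, hB⟩ := (isCompact_closedBall (0 : E d) R).exists_bound_of_continuousOn hc.continuousOn
  exact ⟨B, fun x hx => hB x (Metric.ball_subset_closedBall hx)⟩

theorem norm_iteratedFDeriv_smul_le_of_Ball {f : E d → ℝ} {g : E d → V}
    (hf : ContDiffOn ℝ ∞ f (Ball d R)) (hg : ContDiffOn ℝ ∞ g (Ball d R)) {x : E d}
    (hx : x ∈ Ball d R) (n : ℕ) :
    ‖iteratedFDeriv ℝ n (fun y => f y • g y) x‖ ≤
      ∑ i ∈ Finset.range (n + 1), (n.choose i : ℝ) * ‖iteratedFDeriv ℝ i f x‖ *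
        ‖iteratedFDeriv ℝ (n - i) g x‖ := by
  have ho := isOpen_Ball d R
  have h := norm_iteratedFDerivWithin_smul_le hf hg ho.uniqueDiffOn hx (n := n)
    (by exact_mod_cast le_top)
  simp only [iteratedFDerivWithin_of_isOpen _ ho hx] at h
  exact h

theorem norm_iteratedFDeriv_mul_le_of_Ball {f g : E d → ℝ}
    (hf : ContDiffOn ℝ ∞ f (Ball d R)) (hg : ContDiffOn ℝ ∞ g (Ball d R)) {x : E d}
    (hx : x ∈ Ball d R) (n : ℕ) :
    ‖iteratedFDeriv ℝ n (fun y => f y * g y) x‖ ≤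
      ∑ i ∈ Finset.range (n + 1), (n.choose i : ℝ) * ‖iteratedFDeriv ℝ i f x‖ *
        ‖iteratedFDeriv ℝ (n - i) g x‖ := by
  simpa only [smul_eq_mul] using norm_iteratedFDeriv_smul_le_of_Ball hf hg hx n

theorem norm_iteratedFDeriv_comp_le_of_Ball {W : Type*} [NormedAddCommGroup W] [NormedSpace ℝ W]
    {g : V → W} {f : E d → V} (hg : ContDiff ℝ ∞ g)
    (hf : ContDiffOn ℝ ∞ f (Ball d R)) {x : E d} (hx : x ∈ Ball d R) {n : ℕ} {C D : ℝ}
    (hC : ∀ i ≤ n, ‖iteratedFDeriv ℝ i g (f x)‖ ≤ C)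
    (hD : ∀ i, 1 ≤ i → i ≤ n → ‖iteratedFDeriv ℝ i f x‖ ≤ D ^ i) :
    ‖iteratedFDeriv ℝ n (fun y => g (f y)) x‖ ≤ n.factorial * C * D ^ n := by
  have ho := isOpen_Ball d R
  have h := norm_iteratedFDerivWithin_comp_le (n := n) (t := Set.univ) hg.contDiffOn hf
    (by exact_mod_cast le_top) uniqueDiffOn_univ ho.uniqueDiffOn (fun _ _ => Set.mem_univ _) hx
    (C := C) (D := D) (by simpa only [iteratedFDerivWithin_univ] using hC)
    (by simpa only [iteratedFDerivWithin_of_isOpen _ ho hx] using hD)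
  rw [iteratedFDerivWithin_of_isOpen _ ho hx] at h
  exact h

theorem BddSmooth.smul {f : E d → ℝ} {g : E d → V} (hf : BddSmooth R f) (hg : BddSmooth R g) :
    BddSmooth R (fun x => f x • g x) := by
  refine ⟨hf.1.smul hg.1, fun j => ?_⟩
  obtain ⟨A, hA0, hA⟩ := hf.exists_bound j
  obtain ⟨B, hB0, hB⟩ := hg.exists_bound j
  refine ⟨∑ i ∈ Finset.range (j + 1), (j.choose i : ℝ) * A * B, fun x hx =>
    (norm_iteratedFDeriv_smul_le_of_Ball hf.1 hg.1 hx j).trans (Finset.sum_le_sum fun i hi => ?_)⟩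
  have h1 := hA i (Nat.lt_succ_iff.1 (Finset.mem_range.1 hi)) x hx
  have h2 := hB (j - i) (Nat.sub_le _ _) x hx
  gcongr

theorem BddSmooth.mul {f g : E d → ℝ} (hf : BddSmooth R f) (hg : BddSmooth R g) :
    BddSmooth R (fun x => f x * g x) := hf.smul hg

/-- The outer function needs no global bounds: the inner one takes values in a compact ball, on
which all derivatives of `g` are bounded. -/
theorem BddSmooth.comp {W : Type*} [NormedAddCommGroup W] [NormedSpace ℝ W]
    [FiniteDimensional ℝ V] {g : V → W} {f : E d → V} (hg : ContDiff ℝ ∞ g)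
    (hf : BddSmooth R f) : BddSmooth R (fun x => g (f x)) := by
  refine ⟨hg.comp_contDiffOn hf.1, fun j => ?_⟩
  obtain ⟨A, hA0, hA⟩ := hf.exists_bound j
  have hp : ProperSpace V := FiniteDimensional.proper ℝ V
  have hc : ∀ i : ℕ, ∃ B : ℝ, ∀ y ∈ Metric.closedBall (0 : V) A, ‖iteratedFDeriv ℝ i g y‖ ≤ B :=
    fun i => (isCompact_closedBall (0 : V) A).exists_bound_of_continuousOn
      (hg.continuous_iteratedFDeriv (by exact_mod_cast le_top)).continuousOn
  choose B hB using hc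
  -- The chain rule bound wants the `i`-th derivative of `f` below `D ^ i`; taking `D = max A 1`
  -- turns the uniform bound `A` into this form for `i ≥ 1`.
  refine ⟨j.factorial * (∑ i ∈ Finset.range (j + 1), |B i|) * (max A 1) ^ j, fun x hx => ?_⟩
  refine norm_iteratedFDeriv_comp_le_of_Ball hg hf.1 hx (fun i hi => ?_) (fun i h1 hi => ?_)
  · have hfx : f x ∈ Metric.closedBall (0 : V) A := by
      have := hA 0 (Nat.zero_le _) x hx
      simpa using this
    refine ((hB i _ hfx).trans (le_abs_self _)).trans
      (Finset.single_le_sum (f := fun j => |B j|) (fun _ _ => abs_nonneg _)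
        (Finset.mem_range.2 (Nat.lt_succ_of_le hi)))
  · exact ((hA i hi x hx).trans (le_max_left A 1)).trans
      (le_self_pow₀ (le_max_right A 1) (by omega))

end BddSmooth

/-! ## Partial derivatives and iterated derivatives -/

section Partial

variable {d : ℕ} {R : ℝ}

/-- The successive partial derivatives of `f` along a list of coordinate directions. -/
noncomputable def listDeriv (l : List (Fin d)) (f : E d → ℝ) : E d → ℝ :=
  l.foldr partialDeriv f

theorem contDiffOn_listDeriv (l : List (Fin d)) {f : E d → ℝ}
    (hf : ContDiffOn ℝ ∞ f (Ball d R)) : ContDiffOn ℝ ∞ (listDeriv l f) (Ball d R) := by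
  induction l with
  | nil => exact hf
  | cons i l ih => exact contDiffOn_partialDeriv i ih

theorem multiDeriv_eq_listDeriv (α : Fin d → ℕ) (f : E d → ℝ) :
    multiDeriv α f = listDeriv ((List.finRange d).flatMap fun i => List.replicate (α i) i) f := by
  have hrep : ∀ (i : Fin d) (n : ℕ) (g : E d → ℝ),
      (partialDeriv i)^[n] g = listDeriv (List.replicate n i) g := by
    intro i n
    induction n with
    | zero => intro g; rfl
    | succ n ih =>
      intro g
      rw [Function.iterate_succ_apply', ih, List.replicate_succ]
      rfl
  unfold multiDeriv
  induction List.finRange d with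
  | nil => rfl
  | cons i l ih =>
    rw [List.foldr_cons, ih, hrep, List.flatMap_cons]
    simp only [listDeriv, List.foldr_append]

theorem partialDeriv_congr {f g : E d → ℝ} (h : Set.EqOn f g (Ball d R)) (i : Fin d) :
    Set.EqOn (partialDeriv i f) (partialDeriv i g) (Ball d R) := fun x hx => by
  simp only [partialDeriv, (eventuallyEq_of_eqOn_Ball h hx).fderiv_eq]

theorem partialDeriv_comm {f : E d → ℝ} (hf : ContDiffOn ℝ ∞ f (Ball d R)) (i j : Fin d) :
    Set.EqOn (partialDeriv i (partialDeriv j f)) (partialDeriv j (partialDeriv i f))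
      (Ball d R) := by
  intro x hx
  have hfx : ContDiffAt ℝ ∞ f x := hf.contDiffAt (ball_mem_nhds hx)
  have hs : IsSymmSndFDerivAt ℝ f x := hfx.isSymmSndFDerivAt (by simpa using (by exact_mod_cast le_top : ((2 : ℕ∞) : ℕ∞ω) ≤ ∞))
  have hd : DifferentiableAt ℝ (fderiv ℝ f) x :=
    (hfx.fderiv_right (m := ∞) (by simp)).differentiableAt (by simp)
  have h2 : ∀ v w : E d, fderiv ℝ (fun y => fderiv ℝ f y v) x w =
      fderiv ℝ (fderiv ℝ f) x w v := by
    intro v w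
    rw [fderiv_clm_apply hd (differentiableAt_const v)]
    simp
  exact (h2 _ _).trans ((hs _ _).trans (h2 _ _).symm)

theorem listDeriv_perm {l l' : List (Fin d)} (h : l.Perm l') {f : E d → ℝ}
    (hf : ContDiffOn ℝ ∞ f (Ball d R)) :
    Set.EqOn (listDeriv l f) (listDeriv l' f) (Ball d R) := by
  induction h with
  | nil => exact fun _ _ => rfl
  | cons i _ ih => exact partialDeriv_congr ih i
  | swap i j l => exact partialDeriv_comm (contDiffOn_listDeriv l hf) j i
  | trans _ _ h1 h2 => exact h1.trans h2

theorem differentiableAt_iteratedFDeriv {V : Type*} [NormedAddCommGroup V] [NormedSpace ℝ V]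
    {f : E d → V} (hf : ContDiffOn ℝ ∞ f (Ball d R)) (j : ℕ) {x : E d} (hx : x ∈ Ball d R) :
    DifferentiableAt ℝ (iteratedFDeriv ℝ j f) x :=
  (hf.contDiffAt (ball_mem_nhds hx)).differentiableAt_iteratedFDeriv (by exact_mod_cast ENat.natCast_lt_top j)

theorem iteratedFDeriv_single_eq_listDeriv {f : E d → ℝ} (hf : ContDiffOn ℝ ∞ f (Ball d R))
    {j : ℕ} (I : Fin j → Fin d) {x : E d} (hx : x ∈ Ball d R) :
    iteratedFDeriv ℝ j f x (fun i => EuclideanSpace.single (I i) 1) =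
      listDeriv (List.ofFn I) f x := by
  induction j generalizing x with
  | zero => simp [listDeriv]
  | succ j ih =>
    rw [(differentiableAt_iteratedFDeriv hf j hx).iteratedFDeriv_succ_apply_left', List.ofFn_succ]
    have h : Set.EqOn (fun y => iteratedFDeriv ℝ j f y
        (Fin.tail fun i => EuclideanSpace.single (I i) 1))
        (listDeriv (List.ofFn fun i => I i.succ) f) (Ball d R) :=
      fun y hy => ih (fun i => I i.succ) hy
    rw [(eventuallyEq_of_eqOn_Ball h hx).fderiv_eq]
    rfl

theorem abs_multiDeriv_le {f : E d → ℝ} (hf : ContDiffOn ℝ ∞ f (Ball d R)) (α : Fin d → ℕ)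
    {x : E d} (hx : x ∈ Ball d R) :
    |multiDeriv α f x| ≤ ‖iteratedFDeriv ℝ (∑ i, α i) f x‖ := by
  rw [multiDeriv_eq_listDeriv]
  set l := (List.finRange d).flatMap fun i => List.replicate (α i) i with hl
  have hlen : l.length = ∑ i, α i := by
    rw [hl, List.length_flatMap]
    simp only [List.length_replicate]
    rw [← List.ofFn_eq_map, List.sum_ofFn]
  rw [← hlen]
  have h := iteratedFDeriv_single_eq_listDeriv hf (fun i => l.get i) hx
  rw [List.ofFn_get] at h
  rw [← h, ← Real.norm_eq_abs]
  refine (ContinuousMultilinearMap.le_opNorm _ _).trans ?_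
  simp

/-- Expand each argument in the standard basis; every coordinate is at most the norm of its vector.
-/
theorem norm_continuousMultilinearMap_le_sum {j : ℕ}
    (T : ContinuousMultilinearMap ℝ (fun _ : Fin j => E d) ℝ) :
    ‖T‖ ≤ ∑ I : Fin j → Fin d, |T fun i => EuclideanSpace.single (I i) 1| := by
  refine T.opNorm_le_bound (Finset.sum_nonneg fun _ _ => abs_nonneg _) fun m => ?_
  have hm : m = fun i => ∑ p : Fin d, (m i) p • EuclideanSpace.single p (1 : ℝ) := by
    funext i
    have := (EuclideanSpace.basisFun (Fin d) ℝ).sum_repr (m i)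
    simpa using this.symm
  have hT : T m = ∑ I : Fin j → Fin d, (∏ i, (m i) (I i)) *
      T fun i => EuclideanSpace.single (I i) 1 := by
    conv_lhs => rw [hm]
    rw [T.map_sum]
    refine Finset.sum_congr rfl fun I _ => ?_
    rw [T.map_smul_univ, smul_eq_mul]
  rw [hT, Finset.sum_mul]
  refine (norm_sum_le _ _).trans (Finset.sum_le_sum fun I _ => ?_)
  rw [norm_mul, mul_comm, Real.norm_eq_abs (T _), norm_prod]
  refine mul_le_mul_of_nonneg_left ?_ (abs_nonneg _)
  exact Finset.prod_le_prod (fun _ _ => norm_nonneg _) fun i _ => PiLp.norm_apply_le (m i) (I i)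

/-- The multi-index that counts the occurrences in a tuple of coordinate directions. -/
def countIndex {j : ℕ} (I : Fin j → Fin d) : Fin d → ℕ := fun p => (List.ofFn I).count p

theorem sum_countIndex {j : ℕ} (I : Fin j → Fin d) : ∑ p, countIndex I p = j := by
  have := Multiset.sum_count_eq_card (s := Finset.univ) (m := (List.ofFn I : Multiset (Fin d)))
    (fun _ _ => Finset.mem_univ _)
  simpa [countIndex] using this

/-- Partial derivatives of a smooth function commute, so only the number of occurrences of each
direction matters. -/
theorem iteratedFDeriv_single_eq_multiDeriv {f : E d → ℝ} (hf : ContDiffOn ℝ ∞ f (Ball d R))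
    {j : ℕ} (I : Fin j → Fin d) {x : E d} (hx : x ∈ Ball d R) :
    iteratedFDeriv ℝ j f x (fun i => EuclideanSpace.single (I i) 1) =
      multiDeriv (countIndex I) f x := by
  rw [iteratedFDeriv_single_eq_listDeriv hf I hx, multiDeriv_eq_listDeriv]
  refine listDeriv_perm (List.perm_iff_count.2 fun p => ?_) hf hx
  rw [List.count_flatMap]
  simp only [Function.comp_def, List.count_replicate]
  rw [← List.ofFn_eq_map, List.sum_ofFn]
  simp [countIndex]

theorem norm_iteratedFDeriv_le_sum_multiDeriv {f : E d → ℝ} (hf : ContDiffOn ℝ ∞ f (Ball d R))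
    (j : ℕ) {x : E d} (hx : x ∈ Ball d R) :
    ‖iteratedFDeriv ℝ j f x‖ ≤ ∑ I : Fin j → Fin d, |multiDeriv (countIndex I) f x| := by
  refine (norm_continuousMultilinearMap_le_sum _).trans (le_of_eq ?_)
  exact Finset.sum_congr rfl fun I _ => by rw [iteratedFDeriv_single_eq_multiDeriv hf I hx]

/-- Lets the argument work with derivatives as multilinear maps, whose operator norms are invariant
under rotations, instead of with multi-indices. -/
theorem mem_SmoothRad_iff {f : E d → ℝ} :
    f ∈ SmoothRad d R ↔ (∀ x, x ∉ Ball d R → f x = 0) ∧ BddSmooth R f ∧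
      ∀ x y : E d, ‖x‖ = ‖y‖ → f x = f y := by
  constructor
  · rintro ⟨h0, h1, h2, h3⟩
    refine ⟨h0, ⟨h1, fun j => ?_⟩, h3⟩
    choose B hB using h2
    exact ⟨∑ I : Fin j → Fin d, B (countIndex I), fun x hx =>
      (norm_iteratedFDeriv_le_sum_multiDeriv h1 j hx).trans
        (Finset.sum_le_sum fun I _ => hB _ x hx)⟩
  · rintro ⟨h0, h1, h3⟩
    refine ⟨h0, h1.1, fun α => ?_, h3⟩
    obtain ⟨B, hB⟩ := h1.2 (∑ i, α i)
    exact ⟨B, fun x hx => (abs_multiDeriv_le h1.1 α hx).trans (hB x hx)⟩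

theorem SmoothRad.bddSmooth (f : SmoothRad d R) : BddSmooth R (f : E d → ℝ) :=
  (mem_SmoothRad_iff.1 f.2).2.1

theorem SmoothRad.radial (f : SmoothRad d R) {x y : E d} (h : ‖x‖ = ‖y‖) :
    (f : E d → ℝ) x = (f : E d → ℝ) y := f.2.2.2.2 x y h

open Classical in
theorem BddSmooth.indicator_mem_SmoothRad {f : E d → ℝ} (hf : BddSmooth R f)
    (hr : ∀ x y : E d, ‖x‖ = ‖y‖ → f x = f y) :
    (fun x => if x ∈ Ball d R then f x else 0) ∈ SmoothRad d R := by
  refine mem_SmoothRad_iff.2 ⟨fun x hx => if_neg hx, hf.congr fun x hx => if_pos hx,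
    fun x y h => ?_⟩
  simp only [mem_Ball, h, hr x y h]

/-! ## Sobolev norms and iterated derivatives -/

theorem continuousOn_iteratedFDeriv {V : Type*} [NormedAddCommGroup V] [NormedSpace ℝ V]
    {f : E d → V} (hf : ContDiffOn ℝ ∞ f (Ball d R)) (j : ℕ) :
    ContinuousOn (iteratedFDeriv ℝ j f) (Ball d R) := fun _ hx =>
  (differentiableAt_iteratedFDeriv hf j hx).continuousAt.continuousWithinAt

theorem integrableOn_sq_iteratedFDeriv (f : SmoothRad d R) (j : ℕ) :
    IntegrableOn (fun x => ‖iteratedFDeriv ℝ j (f : E d → ℝ) x‖ ^ 2) (Ball d R) := by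
  obtain ⟨B, hB⟩ := (SmoothRad.bddSmooth f).2 j
  have hfin : IsFiniteMeasure (volume.restrict (Ball d R)) :=
    ⟨by simpa [Ball] using measure_ball_lt_top⟩
  refine Integrable.of_bound
    (((continuousOn_iteratedFDeriv (SmoothRad.bddSmooth f).1 j).norm.pow 2).aestronglyMeasurable
      (isOpen_Ball d R).measurableSet) (B ^ 2) ?_
  refine (ae_restrict_iff' (isOpen_Ball d R).measurableSet).2 (Filter.Eventually.of_forall
    fun x hx => ?_)
  rw [Real.norm_eq_abs, abs_of_nonneg (sq_nonneg _)]
  exact pow_le_pow_left₀ (norm_nonneg _) (hB x hx) 2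

theorem integral_sq_multiDeriv_le (k : ℕ) (f : SmoothRad d R) (α : Fin d → ℕ)
    (hα : ∑ i, α i ≤ k) :
    ∫ x in Ball d R, multiDeriv α (f : E d → ℝ) x ^ 2 ≤ ‖toSobolev k f‖ ^ 2 := by
  rw [norm_sobolevSmoothRad, Real.sq_sqrt (Finset.sum_nonneg fun _ _ =>
    integral_nonneg fun _ => sq_nonneg _)]
  have hlt : ∀ i, α i < k + 1 := fun i => Nat.lt_succ_of_le
    ((Finset.single_le_sum (fun _ _ => Nat.zero_le _) (Finset.mem_univ i)).trans hα)
  let β : MultiIndex d k := ⟨fun i => ⟨α i, hlt i⟩, hα⟩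
  exact Finset.single_le_sum (f := fun α : MultiIndex d k =>
    ∫ x in Ball d R, multiDeriv α.toFun (f : E d → ℝ) x ^ 2)
    (fun _ _ => integral_nonneg fun _ => sq_nonneg _) (Finset.mem_univ β)

/-- Together with `sq_norm_toSobolev_le` this makes the multi-index norm equivalent to the one built
from the operator norms of the derivatives. -/
theorem integral_sq_iteratedFDeriv_le (k j : ℕ) (hj : j ≤ k) (f : SmoothRad d R) :
    ∫ x in Ball d R, ‖iteratedFDeriv ℝ j (f : E d → ℝ) x‖ ^ 2 ≤
      (Fintype.card (Fin j → Fin d) : ℝ) ^ 2 * ‖toSobolev k f‖ ^ 2 := by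
  have hint : ∀ α : Fin d → ℕ,
      IntegrableOn (fun x => multiDeriv α (f : E d → ℝ) x ^ 2) (Ball d R) := fun α =>
    (memLp_multiDeriv f α).integrable_sq
  calc ∫ x in Ball d R, ‖iteratedFDeriv ℝ j (f : E d → ℝ) x‖ ^ 2
      ≤ ∫ x in Ball d R, (Fintype.card (Fin j → Fin d) : ℝ) * ∑ I : Fin j → Fin d,
          multiDeriv (countIndex I) (f : E d → ℝ) x ^ 2 := by
        refine setIntegral_mono_on (integrableOn_sq_iteratedFDeriv f j)
          ((integrable_finsetSum _ fun I _ => hint _).const_mul _)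
          (isOpen_Ball d R).measurableSet fun x hx => ?_
        refine (pow_le_pow_left₀ (norm_nonneg _)
          (norm_iteratedFDeriv_le_sum_multiDeriv (SmoothRad.bddSmooth f).1 j hx) 2).trans ?_
        have h := sq_sum_le_card_mul_sum_sq (s := (Finset.univ : Finset (Fin j → Fin d)))
          (f := fun I => |multiDeriv (countIndex I) (f : E d → ℝ) x|)
        simpa only [sq_abs, Finset.card_univ] using h
    _ = (Fintype.card (Fin j → Fin d) : ℝ) * ∑ I : Fin j → Fin d,
          ∫ x in Ball d R, multiDeriv (countIndex I) (f : E d → ℝ) x ^ 2 := by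
        rw [integral_const_mul, integral_finsetSum _ fun I _ => hint _]
    _ ≤ (Fintype.card (Fin j → Fin d) : ℝ) * ∑ I : Fin j → Fin d, ‖toSobolev k f‖ ^ 2 := by
        gcongr with I
        exact integral_sq_multiDeriv_le k f _ ((sum_countIndex I).le.trans hj)
    _ = _ := by
        rw [Finset.sum_const, nsmul_eq_mul, Finset.card_univ]; ring

theorem sq_norm_toSobolev_le (k : ℕ) (f : SmoothRad d R) {A : ℝ}
    (hA : ∀ j ≤ k, ∫ x in Ball d R, ‖iteratedFDeriv ℝ j (f : E d → ℝ) x‖ ^ 2 ≤ A) :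
    ‖toSobolev k f‖ ^ 2 ≤ Fintype.card (MultiIndex d k) * A := by
  rw [norm_sobolevSmoothRad, Real.sq_sqrt (Finset.sum_nonneg fun _ _ =>
    integral_nonneg fun _ => sq_nonneg _)]
  refine (Finset.sum_le_card_nsmul _ _ A fun α _ => ?_).trans (by rw [nsmul_eq_mul, Finset.card_univ])
  refine (setIntegral_mono_on (memLp_multiDeriv f α.toFun).integrable_sq
    (integrableOn_sq_iteratedFDeriv f _) (isOpen_Ball d R).measurableSet fun x hx => ?_).trans
    (hA (∑ i, α.toFun i) α.2)
  rw [← sq_abs]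
  exact pow_le_pow_left₀ (abs_nonneg _) (abs_multiDeriv_le (SmoothRad.bddSmooth f).1 _ hx) 2

end Partial

end BlowupStability

namespace BlowupStability

/-! ## One-dimensional weighted inequalities -/

section OneDim

open Set Filter Topology

theorem integrableOn_rpow_mul {R p B : ℝ} (hR : 0 < R) (hp : -1 < p) {v : ℝ → ℝ}
    (hv : ContinuousOn v (Ioo 0 R)) (hB : ∀ r ∈ Ioo 0 R, |v r| ≤ B) :
    IntegrableOn (fun r => r ^ p * v r) (Ioo 0 R) := by
  have h1 : IntegrableOn (fun r : ℝ => r ^ p) (Ioo 0 R) :=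
    (intervalIntegral.integrableOn_Ioo_rpow_iff hR).2 hp
  exact Integrable.mul_bdd (c := B) h1 (hv.aestronglyMeasurable measurableSet_Ioo)
    ((ae_restrict_iff' measurableSet_Ioo).2 (Eventually.of_forall hB))

/-- A differentiable function on `(0, R)` that is bounded together with its continuous derivative. -/
structure BddC1 (R : ℝ) (u u' : ℝ → ℝ) : Prop where
  hasDerivAt : ∀ r ∈ Ioo 0 R, HasDerivAt u (u' r) r
  continuousOn : ContinuousOn u' (Ioo 0 R)
  bdd : ∃ B, ∀ r ∈ Ioo 0 R, |u r| ≤ B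
  bdd_deriv : ∃ B, ∀ r ∈ Ioo 0 R, |u' r| ≤ B

namespace BddC1

variable {R : ℝ} {u u' : ℝ → ℝ}

theorem continuousOn_left (h : BddC1 R u u') : ContinuousOn u (Ioo 0 R) := fun r hr =>
  (h.hasDerivAt r hr).continuousAt.continuousWithinAt

theorem integrableOn_sq (h : BddC1 R u u') (hR : 0 < R) {p : ℝ} (hp : -1 < p) :
    IntegrableOn (fun r => r ^ p * u r ^ 2) (Ioo 0 R) := by
  obtain ⟨B, hB⟩ := h.bdd
  exact integrableOn_rpow_mul (B := B ^ 2) hR hp (h.continuousOn_left.pow 2) fun r hr => by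
    rw [abs_pow]; exact pow_le_pow_left₀ (abs_nonneg _) (hB r hr) 2

theorem integrableOn_deriv_sq (h : BddC1 R u u') (hR : 0 < R) {p : ℝ} (hp : -1 < p) :
    IntegrableOn (fun r => r ^ p * u' r ^ 2) (Ioo 0 R) := by
  obtain ⟨B, hB⟩ := h.bdd_deriv
  exact integrableOn_rpow_mul (B := B ^ 2) hR hp (h.continuousOn.pow 2) fun r hr => by
    rw [abs_pow]; exact pow_le_pow_left₀ (abs_nonneg _) (hB r hr) 2

theorem integrableOn_mul (h : BddC1 R u u') (hR : 0 < R) {p : ℝ} (hp : -1 < p) :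
    IntegrableOn (fun r => r ^ p * (u r * u' r)) (Ioo 0 R) := by
  obtain ⟨B, hB⟩ := h.bdd
  obtain ⟨B', hB'⟩ := h.bdd_deriv
  exact integrableOn_rpow_mul (B := B * B') hR hp (h.continuousOn_left.mul h.continuousOn)
    fun r hr => by
      rw [abs_mul]
      exact mul_le_mul (hB r hr) (hB' r hr) (abs_nonneg _) ((abs_nonneg _).trans (hB r hr))

theorem tendsto_zero (h : BddC1 R u u') (hR : 0 < R) {σ : ℝ} (hσ : 0 < σ) :
    Tendsto (fun r => r ^ σ * u r ^ 2) (𝓝[>] 0) (𝓝 0) := by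
  obtain ⟨B, hB⟩ := h.bdd
  have h1 : Tendsto (fun r : ℝ => r ^ σ * B ^ 2) (𝓝[>] 0) (𝓝 0) := by
    have hc : ContinuousAt (fun r : ℝ => r ^ σ * B ^ 2) 0 :=
      (Real.continuousAt_rpow_const 0 σ (Or.inr hσ.le)).mul_const _
    have := hc.tendsto.mono_left (nhdsWithin_le_nhds (s := Ioi 0))
    simpa [Real.zero_rpow hσ.ne'] using this
  refine squeeze_zero' ?_ ?_ h1
  · filter_upwards [self_mem_nhdsWithin] with r hr
    exact mul_nonneg (Real.rpow_nonneg (le_of_lt hr) _) (sq_nonneg _)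
  · filter_upwards [Ioo_mem_nhdsGT hR] with r hr
    refine mul_le_mul_of_nonneg_left ?_ (Real.rpow_nonneg hr.1.le _)
    rw [← sq_abs]
    exact pow_le_pow_left₀ (abs_nonneg _) (hB r hr) 2

/-- Integrate the derivative of `(R - r) r^(q+1) u²`, which vanishes at both ends. The factor `R -
r` removes the boundary term at `R`, where `u` is arbitrary; the price is the term `u²` on the
right-hand side. -/
theorem hardy (h : BddC1 R u u') (hR : 0 < R) {q : ℝ} (hq : -1 < q) :
    ((q + 1) * R / 2) ^ 2 * ∫ r in Ioo 0 R, r ^ q * u r ^ 2 ≤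
      ((q + 2) ^ 2 / 2 + 2 * R ^ 2) * ∫ r in Ioo 0 R, r ^ (q + 2) * (u r ^ 2 + u' r ^ 2) := by
  -- Half the coefficient of `r^q u²` in `G'`. Hence `c² r^q u² - c G'` contains `-c² r^q u²`, which
  -- absorbs the two cross terms after completing squares.
  set c : ℝ := (q + 1) * R / 2 with hc
  have hc0 : 0 < c := by have : 0 < q + 1 := by linarith
                         positivity
  set G' : ℝ → ℝ := fun r => (q + 1) * R * (r ^ q * u r ^ 2) - (q + 2) * (r ^ (q + 1) * u r ^ 2) +
    2 * R * (r ^ (q + 1) * (u r * u' r)) - 2 * (r ^ (q + 2) * (u r * u' r)) with hG'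
  have hder : ∀ r ∈ Ioo 0 R, HasDerivAt (fun r => (R - r) * (r ^ (q + 1) * u r ^ 2)) (G' r) r := by
    intro r hr
    have h1 : HasDerivAt (fun r : ℝ => r ^ (q + 1)) ((q + 1) * r ^ q) r := by
      simpa using Real.hasDerivAt_rpow_const (p := q + 1) (Or.inl hr.1.ne')
    have h2 := ((hasDerivAt_id r).const_sub R).mul (h1.mul ((h.hasDerivAt r hr).pow 2))
    refine h2.congr_deriv ?_
    have e1 : r ^ (q + 1) = r ^ q * r := Real.rpow_add_one hr.1.ne' q
    have e2 : r ^ (q + 2) = r ^ q * r * r := by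
      rw [← e1, ← Real.rpow_add_one hr.1.ne']; ring_nf
    simp [hG', e1, e2]
    ring
  have i0 := h.integrableOn_sq hR hq
  have i1 := h.integrableOn_sq hR (p := q + 1) (by linarith)
  have i1' := h.integrableOn_mul hR (p := q + 1) (by linarith)
  have i2' := h.integrableOn_mul hR (p := q + 2) (by linarith)
  have hint : IntegrableOn G' (Ioo 0 R) :=
    (((i0.const_mul _).sub (i1.const_mul _)).add (i1'.const_mul _)).sub (i2'.const_mul _)
  have hzero : ∫ r in Ioo 0 R, G' r = 0 := by
    have h0 : Tendsto (fun r => (R - r) * (r ^ (q + 1) * u r ^ 2)) (𝓝[>] 0) (𝓝 0) := by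
      have hc : Tendsto (fun r : ℝ => R - r) (𝓝[>] 0) (𝓝 (R - 0)) :=
        ((continuous_const.sub continuous_id).tendsto 0).mono_left nhdsWithin_le_nhds
      simpa using hc.mul (h.tendsto_zero hR (σ := q + 1) (by linarith))
    have h1 : Tendsto (fun r => (R - r) * (r ^ (q + 1) * u r ^ 2)) (𝓝[<] R) (𝓝 0) := by
      obtain ⟨B, hB⟩ := h.bdd
      have hc : Tendsto (fun r : ℝ => (R - r) * (R ^ (q + 1) * B ^ 2)) (𝓝[<] R) (𝓝 0) := by
        have : Continuous fun r : ℝ => (R - r) * (R ^ (q + 1) * B ^ 2) := by fun_prop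
        simpa using (this.tendsto R).mono_left (nhdsWithin_le_nhds (s := Iio R))
      refine squeeze_zero' ?_ ?_ hc
      · filter_upwards [Ioo_mem_nhdsLT hR] with r hr
        exact mul_nonneg (sub_nonneg.2 hr.2.le)
          (mul_nonneg (Real.rpow_nonneg hr.1.le _) (sq_nonneg _))
      · filter_upwards [Ioo_mem_nhdsLT hR] with r hr
        refine mul_le_mul_of_nonneg_left (mul_le_mul (Real.rpow_le_rpow hr.1.le hr.2.le (by linarith))
          ?_ (sq_nonneg _) (Real.rpow_nonneg hR.le _)) (sub_nonneg.2 hr.2.le)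
        rw [← sq_abs]
        exact pow_le_pow_left₀ (abs_nonneg _) (hB r hr) 2
    have := intervalIntegral.integral_eq_sub_of_hasDerivAt_of_tendsto hR hder
      ((intervalIntegrable_iff_integrableOn_Ioo_of_le hR.le).2 hint) h0 h1
    rw [intervalIntegral.integral_of_le hR.le, integral_Ioc_eq_integral_Ioo] at this
    simpa using this
  have i2 := h.integrableOn_sq hR (p := q + 2) (by linarith)
  have i2d := h.integrableOn_deriv_sq hR (p := q + 2) (by linarith)
  have hsum : IntegrableOn (fun r => r ^ (q + 2) * (u r ^ 2 + u' r ^ 2)) (Ioo 0 R) :=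
    (i2.add i2d).congr (Eventually.of_forall fun r => by simp [mul_add])
  -- Since `G'` has integral zero, subtracting `c G'` does not change the left-hand side, and a
  -- pointwise inequality between the integrands is enough.
  have key : ∫ r in Ioo 0 R, (c * (c * (r ^ q * u r ^ 2)) - c * G' r) ≤
      ∫ r in Ioo 0 R, ((q + 2) ^ 2 / 2 + 2 * R ^ 2) * (r ^ (q + 2) * (u r ^ 2 + u' r ^ 2)) := by
    refine setIntegral_mono_on (((i0.const_mul c).const_mul c).sub (hint.const_mul c))
      (hsum.const_mul _) measurableSet_Ioo fun r hr => ?_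
    have e1 : r ^ (q + 1) = r ^ q * r := Real.rpow_add_one hr.1.ne' q
    have e2 : r ^ (q + 2) = r ^ q * r * r := by
      rw [← e1, ← Real.rpow_add_one hr.1.ne']; ring_nf
    have hrq : 0 ≤ r ^ q := Real.rpow_nonneg hr.1.le _
    have hkey : c * (-c * u r ^ 2 + (q + 2) * r * u r ^ 2 - 2 * r * (R - r) * (u r * u' r)) ≤
        ((q + 2) ^ 2 / 2 + 2 * R ^ 2) * (r ^ 2 * (u r ^ 2 + u' r ^ 2)) := by
      -- The squares `t1` and `t2` split the cross terms, each at the cost of `c² u² / 2`.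
      have t1 : 0 ≤ (c * u r - (q + 2) * (r * u r)) ^ 2 := sq_nonneg _
      have t2 : 0 ≤ (c * u r + 2 * r * (R - r) * u' r) ^ 2 := sq_nonneg _
      have t3 : (R - r) ^ 2 ≤ R ^ 2 := by
        have := hr.1; have := hr.2
        nlinarith
      have t4 : 2 * (r * u' r) ^ 2 * (R - r) ^ 2 ≤ 2 * (r * u' r) ^ 2 * R ^ 2 :=
        mul_le_mul_of_nonneg_left t3 (by positivity)
      have t5 : 0 ≤ (q + 2) ^ 2 * (r * u' r) ^ 2 := by positivity
      have t6 : 0 ≤ R ^ 2 * (r * u r) ^ 2 := by positivity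
      nlinarith
    have := mul_le_mul_of_nonneg_left hkey hrq
    have eL : c * (c * (r ^ q * u r ^ 2)) - c * G' r =
        r ^ q * (c * (-c * u r ^ 2 + (q + 2) * r * u r ^ 2 - 2 * r * (R - r) * (u r * u' r))) := by
      simp only [hG', e1, e2, hc]; ring
    rw [eL, e2]
    refine this.trans (le_of_eq (by ring))
  rw [integral_sub ((i0.const_mul c).const_mul c) (hint.const_mul c), integral_const_mul,
    integral_const_mul, integral_const_mul, integral_const_mul, hzero] at key
  calc c ^ 2 * ∫ r in Ioo 0 R, r ^ q * u r ^ 2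
      = c * (c * ∫ r in Ioo 0 R, r ^ q * u r ^ 2) - c * 0 := by ring
    _ ≤ _ := key

/-- The fundamental theorem of calculus for `r^σ u²` on `(0, ρ)`: positivity of `σ` removes the
boundary term at zero, and `2 r |u u'| ≤ u² + r² u'²` splits the mixed term. -/
theorem sup_bound (h : BddC1 R u u') {σ : ℝ} (hσ : 0 < σ) {ρ : ℝ} (hρ : ρ ∈ Ioo 0 R) :
    ρ ^ σ * u ρ ^ 2 ≤
      (σ + 1) * ∫ r in Ioo 0 R, (r ^ (σ - 1) * u r ^ 2 + r ^ (σ + 1) * u' r ^ 2) := by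
  have hR : 0 < R := hρ.1.trans hρ.2
  have hsub : Ioo 0 ρ ⊆ Ioo 0 R := Ioo_subset_Ioo_right hρ.2.le
  set G' : ℝ → ℝ := fun r => σ * (r ^ (σ - 1) * u r ^ 2) + 2 * (r ^ σ * (u r * u' r)) with hG'
  have hder : ∀ r ∈ Ioo 0 R, HasDerivAt (fun r => r ^ σ * u r ^ 2) (G' r) r := by
    intro r hr
    have h1 : HasDerivAt (fun r : ℝ => r ^ σ) (σ * r ^ (σ - 1)) r :=
      Real.hasDerivAt_rpow_const (Or.inl hr.1.ne')
    refine (h1.mul ((h.hasDerivAt r hr).pow 2)).congr_deriv ?_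
    simp [hG']
    ring
  have i0 := h.integrableOn_sq hR (p := σ - 1) (by linarith)
  have i1 := h.integrableOn_mul hR (p := σ) (by linarith)
  have i2 := h.integrableOn_deriv_sq hR (p := σ + 1) (by linarith)
  have hint : IntegrableOn G' (Ioo 0 R) := (i0.const_mul _).add (i1.const_mul _)
  have hftc := intervalIntegral.integral_eq_sub_of_hasDerivAt_of_tendsto hρ.1
    (fun r hr => hder r (hsub hr))
    ((intervalIntegrable_iff_integrableOn_Ioo_of_le hρ.1.le).2 (hint.mono_set hsub))
    (h.tendsto_zero hR hσ) ((hder ρ hρ).continuousAt.tendsto.mono_left nhdsWithin_le_nhds)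
  rw [intervalIntegral.integral_of_le hρ.1.le, integral_Ioc_eq_integral_Ioo, sub_zero] at hftc
  rw [← hftc, ← integral_const_mul]
  have hbig : IntegrableOn
      (fun r => (σ + 1) * (r ^ (σ - 1) * u r ^ 2 + r ^ (σ + 1) * u' r ^ 2)) (Ioo 0 R) :=
    (i0.add i2).const_mul _
  refine (setIntegral_mono_on (hint.mono_set hsub) (hbig.mono_set hsub) measurableSet_Ioo
    fun r hr => ?_).trans (setIntegral_mono_set hbig ?_ hsub.eventuallyLE)
  · have e1 : r ^ σ = r ^ (σ - 1) * r := by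
      rw [← Real.rpow_add_one hr.1.ne']; ring_nf
    have e2 : r ^ (σ + 1) = r ^ (σ - 1) * r * r := by
      rw [← e1, ← Real.rpow_add_one hr.1.ne']
    have hrq : 0 ≤ r ^ (σ - 1) := Real.rpow_nonneg hr.1.le _
    have hk : 2 * (r * (u r * u' r)) ≤ u r ^ 2 + r * r * u' r ^ 2 := by
      nlinarith [sq_nonneg (u r - r * u' r)]
    have hk2 : 0 ≤ σ * (r * r * u' r ^ 2) :=
      mul_nonneg hσ.le (mul_nonneg (mul_self_nonneg r) (sq_nonneg _))
    have := mul_le_mul_of_nonneg_left (a := r ^ (σ - 1))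
      (show σ * u r ^ 2 + 2 * (r * (u r * u' r)) ≤ (σ + 1) * (u r ^ 2 + r * r * u' r ^ 2) by
        linarith) hrq
    simp only [hG', e1, e2]
    linarith
  · refine (ae_restrict_iff' measurableSet_Ioo).2 (Eventually.of_forall fun r hr => ?_)
    have h1 : 0 ≤ r ^ (σ - 1) := Real.rpow_nonneg hr.1.le _
    have h2 : 0 ≤ r ^ (σ + 1) := Real.rpow_nonneg hr.1.le _
    simp only [Pi.zero_apply]
    positivity

end BddC1

end OneDim

end BlowupStability

namespace BlowupStability

/-! ## Weighted Sobolev inequalities for radial functions -/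

section Radial

open Set Filter Topology

variable {d : ℕ} {R : ℝ}

theorem exists_linearIsometryEquiv_apply_eq {x y : E d} (h : ‖x‖ = ‖y‖) :
    ∃ U : E d ≃ₗᵢ[ℝ] E d, U x = y :=
  ⟨(ℝ ∙ (x - y))ᗮ.reflection, Submodule.reflection_sub h⟩

/-- A reflection carries `x` to `y`, leaves `f` invariant and preserves operator norms. This is what
reduces all estimates to a single ray. -/
theorem norm_iteratedFDeriv_eq_of_norm_eq {f : E d → ℝ} (hf : ∀ x y : E d, ‖x‖ = ‖y‖ → f x = f y)
    (j : ℕ) {x y : E d} (h : ‖x‖ = ‖y‖) :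
    ‖iteratedFDeriv ℝ j f x‖ = ‖iteratedFDeriv ℝ j f y‖ := by
  obtain ⟨U, rfl⟩ := exists_linearIsometryEquiv_apply_eq h
  rw [← U.norm_iteratedFDeriv_comp_right]
  congr 2
  funext z
  exact hf _ _ (by simp)

/-- The norm of the iterated derivative along the ray through `e`. -/
noncomputable def rayNorm (e : E d) (j : ℕ) (f : E d → ℝ) (r : ℝ) : ℝ :=
  ‖iteratedFDeriv ℝ j f (r • e)‖

/-- The weighted `L²` norm squared of the `j`-th derivative along the ray through `e`. -/
noncomputable def rayInt (R : ℝ) (e : E d) (j : ℕ) (q : ℝ) (f : E d → ℝ) : ℝ :=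
  ∫ r in Ioo 0 R, r ^ q * rayNorm e j f r ^ 2

variable {e : E d}

theorem smul_mem_Ball (he : ‖e‖ = 1) {r : ℝ} (hr : r ∈ Ioo 0 R) : r • e ∈ Ball d R := by
  rw [mem_Ball, norm_smul, he, mul_one, Real.norm_eq_abs, abs_of_pos hr.1]
  exact hr.2

theorem continuousOn_iteratedFDeriv_ray (he : ‖e‖ = 1) (f : SmoothRad d R) (j : ℕ) :
    ContinuousOn (fun r : ℝ => iteratedFDeriv ℝ j (f : E d → ℝ) (r • e)) (Ioo 0 R) := by
  have h1 := continuousOn_iteratedFDeriv (SmoothRad.bddSmooth f).1 j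
  have h2 : ContinuousOn (fun r : ℝ => r • e) (Ioo 0 R) := by fun_prop
  have h3 : MapsTo (fun r : ℝ => r • e) (Ioo 0 R) (Ball d R) := fun r hr => smul_mem_Ball he hr
  exact h1.comp h2 h3

theorem continuousOn_rayNorm (he : ‖e‖ = 1) (f : SmoothRad d R) (j : ℕ) :
    ContinuousOn (rayNorm e j (f : E d → ℝ)) (Ioo 0 R) :=
  (continuousOn_iteratedFDeriv_ray he f j).norm

theorem integrableOn_rayNorm (hR : 0 < R) (he : ‖e‖ = 1) (f : SmoothRad d R) (j : ℕ) {q : ℝ}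
    (hq : -1 < q) :
    IntegrableOn (fun r => r ^ q * rayNorm e j (f : E d → ℝ) r ^ 2) (Ioo 0 R) := by
  obtain ⟨B, hB⟩ := (SmoothRad.bddSmooth f).2 j
  exact integrableOn_rpow_mul (B := B ^ 2) hR hq ((continuousOn_rayNorm he f j).pow 2)
    fun r hr => by
      rw [abs_pow]
      refine pow_le_pow_left₀ (abs_nonneg _) ?_ 2
      rw [rayNorm, abs_of_nonneg (norm_nonneg _)]
      exact hB _ (smul_mem_Ball he hr)

theorem abs_iteratedFDeriv_apply_le {f : E d → ℝ} {j : ℕ} {x : E d} {m : Fin j → E d}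
    (hm : ∀ i, ‖m i‖ ≤ 1) : |iteratedFDeriv ℝ j f x m| ≤ ‖iteratedFDeriv ℝ j f x‖ := by
  rw [← Real.norm_eq_abs]
  exact ContinuousMultilinearMap.unit_le_opNorm _
    ((pi_norm_le_iff_of_nonneg zero_le_one).2 hm)

theorem norm_cons_le (he : ‖e‖ = 1) {j : ℕ} {m : Fin j → E d} (hm : ∀ i, ‖m i‖ ≤ 1)
    (i : Fin (j + 1)) : ‖(Fin.cons e m : Fin (j + 1) → E d) i‖ ≤ 1 := by
  refine Fin.cases ?_ (fun i => ?_) i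
  · simp [he]
  · simpa using hm i

theorem bddC1_iteratedFDeriv_apply (he : ‖e‖ = 1) (f : SmoothRad d R) (j : ℕ) (m : Fin j → E d)
    (hm : ∀ i, ‖m i‖ ≤ 1) :
    BddC1 R (fun r => iteratedFDeriv ℝ j (f : E d → ℝ) (r • e) m)
      (fun r => iteratedFDeriv ℝ (j + 1) (f : E d → ℝ) (r • e) (Fin.cons e m)) where
  hasDerivAt r hr := by
    have h1 := (differentiableAt_iteratedFDeriv (SmoothRad.bddSmooth f).1 j
      (smul_mem_Ball he hr)).hasFDerivAt
    have h2 : HasDerivAt (fun r : ℝ => r • e) e r := by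
      simpa using (hasDerivAt_id r).smul_const e
    have h3 := h1.comp_hasDerivAt r h2
    have h4 := (ContinuousMultilinearMap.apply ℝ (fun _ : Fin j => E d) ℝ
      m).hasFDerivAt.comp_hasDerivAt r h3
    refine h4.congr_deriv ?_
    rw [ContinuousMultilinearMap.apply_apply, iteratedFDeriv_succ_apply_left]
    simp only [Fin.cons_zero, Fin.tail_cons]
  continuousOn := by
    exact (ContinuousMultilinearMap.apply ℝ (fun _ : Fin (j + 1) => E d) ℝ
      (Fin.cons e m)).continuous.comp_continuousOn (continuousOn_iteratedFDeriv_ray he f (j + 1))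
  bdd := by
    obtain ⟨B, hB⟩ := (SmoothRad.bddSmooth f).2 j
    exact ⟨B, fun r hr => (abs_iteratedFDeriv_apply_le hm).trans (hB _ (smul_mem_Ball he hr))⟩
  bdd_deriv := by
    obtain ⟨B, hB⟩ := (SmoothRad.bddSmooth f).2 (j + 1)
    exact ⟨B, fun r hr => (abs_iteratedFDeriv_apply_le (norm_cons_le he hm)).trans
      (hB _ (smul_mem_Ball he hr))⟩

/-- The components of the `j`-th derivative along the ray through `e`. -/
noncomputable def rayComp (e : E d) {j : ℕ} (I : Fin j → Fin d) (f : E d → ℝ) (r : ℝ) : ℝ :=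
  iteratedFDeriv ℝ j f (r • e) fun i => EuclideanSpace.single (I i) 1

theorem sq_rayNorm_le (e : E d) (j : ℕ) (f : E d → ℝ) (r : ℝ) :
    rayNorm e j f r ^ 2 ≤
      (Fintype.card (Fin j → Fin d) : ℝ) * ∑ I : Fin j → Fin d, rayComp e I f r ^ 2 := by
  refine (pow_le_pow_left₀ (norm_nonneg _) (norm_continuousMultilinearMap_le_sum _) 2).trans ?_
  have h := sq_sum_le_card_mul_sum_sq (s := (Finset.univ : Finset (Fin j → Fin d)))
    (f := fun I => |rayComp e I f r|)
  simp only [sq_abs, Finset.card_univ] at h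
  exact h

/-- The norm along the ray need not be differentiable, so the one-dimensional inequalities are
applied to components. The derivative of a component along the ray is the next derivative of `f`
with `e` as first argument, hence bounded by its norm. -/
theorem exists_bddC1_rayComp (he : ‖e‖ = 1) (f : SmoothRad d R) {j : ℕ} (I : Fin j → Fin d) :
    ∃ u' : ℝ → ℝ, BddC1 R (rayComp e I (f : E d → ℝ)) u' ∧
      (∀ r, rayComp e I (f : E d → ℝ) r ^ 2 ≤ rayNorm e j (f : E d → ℝ) r ^ 2) ∧
      ∀ r, u' r ^ 2 ≤ rayNorm e (j + 1) (f : E d → ℝ) r ^ 2 := by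
  have hm : ∀ i, ‖(EuclideanSpace.single (I i) 1 : E d)‖ ≤ 1 := fun i => by simp
  refine ⟨_, bddC1_iteratedFDeriv_apply he f j _ hm, fun r => ?_, fun r => ?_⟩
  · rw [← sq_abs]
    exact pow_le_pow_left₀ (abs_nonneg _) (abs_iteratedFDeriv_apply_le hm) 2
  · rw [← sq_abs]
    exact pow_le_pow_left₀ (abs_nonneg _) (abs_iteratedFDeriv_apply_le (norm_cons_le he hm)) 2

/-- Hardy's inequality for each component, summed: two powers of the weight are traded for one
derivative. -/
theorem exists_rayInt_le_add (hR : 0 < R) (he : ‖e‖ = 1) (j : ℕ) {q : ℝ} (hq : -1 < q) :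
    ∃ C : ℝ, 0 ≤ C ∧ ∀ f : SmoothRad d R, rayInt R e j q (f : E d → ℝ) ≤
      C * (rayInt R e j (q + 2) (f : E d → ℝ) + rayInt R e (j + 1) (q + 2) (f : E d → ℝ)) := by
  set c : ℝ := ((q + 1) * R / 2) ^ 2 with hc
  have hc0 : 0 < c := by
    have : 0 < q + 1 := by linarith
    positivity
  set K : ℝ := (q + 2) ^ 2 / 2 + 2 * R ^ 2 with hK
  have hK0 : 0 ≤ K := by positivity
  set n : ℝ := (Fintype.card (Fin j → Fin d) : ℝ) with hn
  refine ⟨n * (n * (K / c)), by positivity, fun f => ?_⟩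
  set S := rayInt R e j (q + 2) (f : E d → ℝ) + rayInt R e (j + 1) (q + 2) (f : E d → ℝ) with hS
  have hcomp : ∀ I : Fin j → Fin d, IntegrableOn
      (fun r => r ^ q * rayComp e I (f : E d → ℝ) r ^ 2) (Ioo 0 R) ∧
      ∫ r in Ioo 0 R, r ^ q * rayComp e I (f : E d → ℝ) r ^ 2 ≤ K / c * S := by
    intro I
    obtain ⟨u', hu, h1, h2⟩ := exists_bddC1_rayComp he f I
    refine ⟨hu.integrableOn_sq hR hq, ?_⟩
    have i1 := integrableOn_rayNorm hR he f j (q := q + 2) (by linarith)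
    have i2 := integrableOn_rayNorm hR he f (j + 1) (q := q + 2) (by linarith)
    have j1 := hu.integrableOn_sq hR (p := q + 2) (by linarith)
    have j2 := hu.integrableOn_deriv_sq hR (p := q + 2) (by linarith)
    have hle : ∫ r in Ioo 0 R, r ^ (q + 2) * (rayComp e I (f : E d → ℝ) r ^ 2 + u' r ^ 2) ≤ S := by
      rw [hS, rayInt, rayInt, ← integral_add i1 i2]
      refine setIntegral_mono_on ((j1.add j2).congr (Eventually.of_forall fun r => by
        simp [mul_add])) (i1.add i2) measurableSet_Ioo fun r hr => ?_
      have hrq : 0 ≤ r ^ (q + 2) := Real.rpow_nonneg hr.1.le _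
      rw [← mul_add]
      exact mul_le_mul_of_nonneg_left (add_le_add (h1 r) (h2 r)) hrq
    have hh := (hu.hardy hR hq).trans (mul_le_mul_of_nonneg_left hle hK0)
    rw [div_mul_eq_mul_div, le_div_iff₀ hc0, mul_comm]
    exact hh
  calc rayInt R e j q (f : E d → ℝ)
      ≤ ∫ r in Ioo 0 R, n * ∑ I : Fin j → Fin d, r ^ q * rayComp e I (f : E d → ℝ) r ^ 2 := by
        refine setIntegral_mono_on (integrableOn_rayNorm hR he f j hq)
          ((integrable_finsetSum _ fun I _ => (hcomp I).1).const_mul _) measurableSet_Ioo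
          fun r hr => ?_
        rw [← Finset.mul_sum, mul_left_comm]
        exact mul_le_mul_of_nonneg_left (sq_rayNorm_le e j _ r) (Real.rpow_nonneg hr.1.le _)
    _ = n * ∑ I : Fin j → Fin d, ∫ r in Ioo 0 R, r ^ q * rayComp e I (f : E d → ℝ) r ^ 2 := by
        rw [integral_const_mul, integral_finsetSum _ fun I _ => (hcomp I).1]
    _ ≤ n * ∑ I : Fin j → Fin d, K / c * S := by
        gcongr with I
        exact (hcomp I).2
    _ = n * (n * (K / c)) * S := by
        rw [Finset.sum_const, nsmul_eq_mul, Finset.card_univ]; ring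

theorem rpow_mul_sq_rayNorm_le (hR : 0 < R) (he : ‖e‖ = 1) (j : ℕ) {σ : ℝ} (hσ : 0 < σ)
    (f : SmoothRad d R) {ρ : ℝ} (hρ : ρ ∈ Ioo 0 R) :
    ρ ^ σ * rayNorm e j (f : E d → ℝ) ρ ^ 2 ≤
      (Fintype.card (Fin j → Fin d) : ℝ) ^ 2 * (σ + 1) *
        (rayInt R e j (σ - 1) (f : E d → ℝ) + rayInt R e (j + 1) (σ + 1) (f : E d → ℝ)) := by
  set n : ℝ := (Fintype.card (Fin j → Fin d) : ℝ) with hn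
  set S := rayInt R e j (σ - 1) (f : E d → ℝ) + rayInt R e (j + 1) (σ + 1) (f : E d → ℝ) with hS
  have hρσ : 0 ≤ ρ ^ σ := Real.rpow_nonneg hρ.1.le _
  have hcomp : ∀ I : Fin j → Fin d, ρ ^ σ * rayComp e I (f : E d → ℝ) ρ ^ 2 ≤ (σ + 1) * S := by
    intro I
    obtain ⟨u', hu, h1, h2⟩ := exists_bddC1_rayComp he f I
    refine (hu.sup_bound hσ hρ).trans (mul_le_mul_of_nonneg_left ?_ (by linarith))
    have i1 := integrableOn_rayNorm hR he f j (q := σ - 1) (by linarith)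
    have i2 := integrableOn_rayNorm hR he f (j + 1) (q := σ + 1) (by linarith)
    rw [hS, rayInt, rayInt, ← integral_add i1 i2]
    refine setIntegral_mono_on ((hu.integrableOn_sq hR (by linarith)).add
      (hu.integrableOn_deriv_sq hR (by linarith))) (i1.add i2) measurableSet_Ioo fun r hr => ?_
    exact add_le_add (mul_le_mul_of_nonneg_left (h1 r) (Real.rpow_nonneg hr.1.le _))
      (mul_le_mul_of_nonneg_left (h2 r) (Real.rpow_nonneg hr.1.le _))
  calc ρ ^ σ * rayNorm e j (f : E d → ℝ) ρ ^ 2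
      ≤ ρ ^ σ * (n * ∑ I : Fin j → Fin d, rayComp e I (f : E d → ℝ) ρ ^ 2) :=
        mul_le_mul_of_nonneg_left (sq_rayNorm_le e j _ ρ) hρσ
    _ = n * ∑ I : Fin j → Fin d, ρ ^ σ * rayComp e I (f : E d → ℝ) ρ ^ 2 := by
        rw [← Finset.mul_sum, mul_left_comm]
    _ ≤ n * ∑ I : Fin j → Fin d, (σ + 1) * S := by
        exact mul_le_mul_of_nonneg_left (Finset.sum_le_sum fun I _ => hcomp I) (Nat.cast_nonneg _)
    _ = n ^ 2 * (σ + 1) * S := by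
        rw [Finset.sum_const, nsmul_eq_mul, Finset.card_univ]; ring

/-- Polar coordinates; the norm of the derivative is a radial function even though the derivative
itself is not. -/
theorem integral_sq_iteratedFDeriv_eq (he : ‖e‖ = 1) (f : SmoothRad d R) (j : ℕ) :
    ∫ x in Ball d R, ‖iteratedFDeriv ℝ j (f : E d → ℝ) x‖ ^ 2 =
      d * (volume : Measure (E d)).real (Metric.ball 0 1) *
        rayInt R e j ((d : ℝ) - 1) (f : E d → ℝ) := by
  have hd : 0 < d := by
    rcases Nat.eq_zero_or_pos d with rfl | h
    · rw [Subsingleton.elim e 0] at he; simp at he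
    · exact h
  have : Nontrivial (E d) := ⟨e, 0, fun h => by simp [h] at he⟩
  set F : ℝ → ℝ := (Iio R).indicator fun r => rayNorm e j (f : E d → ℝ) r ^ 2 with hF
  have h1 : ∫ x in Ball d R, ‖iteratedFDeriv ℝ j (f : E d → ℝ) x‖ ^ 2 = ∫ x : E d, F ‖x‖ := by
    rw [← integral_indicator (isOpen_Ball d R).measurableSet]
    refine integral_congr_ae (Eventually.of_forall fun x => ?_)
    simp only [hF, indicator, mem_Iio, mem_Ball]
    split_ifs
    · rw [rayNorm, norm_iteratedFDeriv_eq_of_norm_eq (fun x y h => SmoothRad.radial f h) j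
        (y := ‖x‖ • e) (by rw [norm_smul, he, norm_norm, mul_one])]
    · rfl
  rw [h1, integral_fun_norm_addHaar]
  simp only [finrank_euclideanSpace, Fintype.card_fin, nsmul_eq_mul, smul_eq_mul]
  rw [mul_assoc]
  congr 2
  have hset : Ioo 0 R = Ioi 0 ∩ Iio R := rfl
  rw [rayInt, hset, ← setIntegral_indicator measurableSet_Iio]
  refine setIntegral_congr_fun measurableSet_Ioi fun r hr => ?_
  simp only [hF, indicator]
  split_ifs
  · rw [← Real.rpow_natCast r (d - 1), Nat.cast_sub hd, Nat.cast_one]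
  · simp

/-- Induction on the number `m` of uses of Hardy's inequality. For `m = 0` the weight `r^q` is at
most a constant times the natural weight `r^(d-1)`; each further step lowers the admissible exponent
by two and uses up one derivative. -/
theorem exists_rayInt_le (hR : 0 < R) (he : ‖e‖ = 1) (k m : ℕ) :
    ∀ j : ℕ, j + m ≤ k → ∀ q : ℝ, -1 < q → (d : ℝ) - 1 - 2 * m ≤ q →
      ∃ C : ℝ, 0 ≤ C ∧ ∀ f : SmoothRad d R,
        rayInt R e j q (f : E d → ℝ) ≤ C * ‖toSobolev k f‖ ^ 2 := by
  have hd : 0 < d := by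
    rcases Nat.eq_zero_or_pos d with rfl | h
    · rw [Subsingleton.elim e 0] at he; simp at he
    · exact h
  have hd1 : (1 : ℝ) ≤ d := by exact_mod_cast hd
  induction m with
  | zero =>
    intro j hj q hq hdq
    set c : ℝ := d * (volume : Measure (E d)).real (Metric.ball 0 1) with hc
    have hc0 : 0 < c := mul_pos (by exact_mod_cast hd)
      (ENNReal.toReal_pos (Metric.measure_ball_pos _ _ one_pos).ne' measure_ball_lt_top.ne)
    refine ⟨R ^ (q - (d - 1)) * ((Fintype.card (Fin j → Fin d) : ℝ) ^ 2 / c), by positivity,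
      fun f => ?_⟩
    have h1 : rayInt R e j q (f : E d → ℝ) ≤
        R ^ (q - (d - 1)) * rayInt R e j ((d : ℝ) - 1) (f : E d → ℝ) := by
      rw [rayInt, rayInt, ← integral_const_mul]
      refine setIntegral_mono_on (integrableOn_rayNorm hR he f j hq)
        ((integrableOn_rayNorm hR he f j (by linarith)).const_mul _) measurableSet_Ioo
        fun r hr => ?_
      rw [← mul_assoc]
      refine mul_le_mul_of_nonneg_right ?_ (sq_nonneg _)
      have e1 : r ^ q = r ^ (q - (d - 1)) * r ^ ((d : ℝ) - 1) := by
        rw [← Real.rpow_add hr.1]; ring_nf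
      rw [e1]
      refine mul_le_mul_of_nonneg_right (Real.rpow_le_rpow hr.1.le hr.2.le ?_)
        (Real.rpow_nonneg hr.1.le _)
      simp only [Nat.cast_zero] at hdq
      linarith
    have h2 := integral_sq_iteratedFDeriv_le k j hj f
    rw [integral_sq_iteratedFDeriv_eq he] at h2
    refine h1.trans ?_
    rw [mul_assoc]
    refine mul_le_mul_of_nonneg_left ?_ (Real.rpow_nonneg hR.le _)
    rw [div_mul_eq_mul_div, le_div_iff₀ hc0, mul_comm]
    exact h2
  | succ m ih =>
    intro j hj q hq hdq
    push_cast at hdq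
    obtain ⟨C, hC0, hC⟩ := exists_rayInt_le_add hR he j hq
    obtain ⟨C1, hC10, hC1⟩ := ih j (by omega) (q + 2) (by linarith) (by linarith)
    obtain ⟨C2, hC20, hC2⟩ := ih (j + 1) (by omega) (q + 2) (by linarith) (by linarith)
    refine ⟨C * (C1 + C2), by positivity, fun f => (hC f).trans ?_⟩
    rw [mul_assoc, add_mul]
    exact mul_le_mul_of_nonneg_left (add_le_add (hC1 f) (hC2 f)) hC0

theorem exists_rayInt_le_of_le (hR : 0 < R) (he : ‖e‖ = 1) {k j : ℕ} (hj : j ≤ k) {q : ℝ}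
    (hq : -1 < q) (hdq : (d : ℝ) - 1 - 2 * (k - j) ≤ q) :
    ∃ C : ℝ, 0 ≤ C ∧ ∀ f : SmoothRad d R,
      rayInt R e j q (f : E d → ℝ) ≤ C * ‖toSobolev k f‖ ^ 2 :=
  exists_rayInt_le hR he k (k - j) j (by omega) q hq (by rw [Nat.cast_sub hj]; exact hdq)

/-- The supremum bound with `σ = 2s` needs the weights `2s - 1` at order `j` and `2s + 1` at order
`j + 1`. Both are admissible exactly when `s ≥ d/2 - (k - j)`. -/
theorem exists_norm_iteratedFDeriv_le (hR : 0 < R) (he : ‖e‖ = 1) {k j : ℕ} (hj : j + 1 ≤ k)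
    {s : ℝ} (hs : 0 < s) (hds : (d : ℝ) / 2 - (k - j) ≤ s) :
    ∃ C : ℝ, 0 ≤ C ∧ ∀ f : SmoothRad d R, ∀ x ∈ Ball d R, x ≠ 0 →
      ‖iteratedFDeriv ℝ j (f : E d → ℝ) x‖ ≤ C * ‖toSobolev k f‖ * (‖x‖ / R) ^ (-s) := by
  obtain ⟨C1, hC10, hC1⟩ := exists_rayInt_le_of_le (d := d) hR he (k := k) (j := j) (q := 2 * s - 1)
    (by omega) (by linarith) (by linarith)
  obtain ⟨C2, hC20, hC2⟩ := exists_rayInt_le_of_le (d := d) hR he (k := k) (j := j + 1)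
    (q := 2 * s + 1) hj (by linarith) (by push_cast; linarith)
  set n : ℝ := (Fintype.card (Fin j → Fin d) : ℝ) ^ 2 * (2 * s + 1) with hn
  have hn0 : 0 ≤ n := by positivity
  refine ⟨√(n * (C1 + C2)) * R ^ (-s), by positivity, fun f x hx hx0 => ?_⟩
  have hxpos : 0 < ‖x‖ := norm_pos_iff.2 hx0
  have hρ : ‖x‖ ∈ Ioo 0 R := ⟨hxpos, mem_Ball.1 hx⟩
  have h := rpow_mul_sq_rayNorm_le hR he j (σ := 2 * s) (by linarith) f hρ
  have h' := h.trans (mul_le_mul_of_nonneg_left (add_le_add (hC1 f) (hC2 f)) hn0)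
  have hray : rayNorm e j (f : E d → ℝ) ‖x‖ = ‖iteratedFDeriv ℝ j (f : E d → ℝ) x‖ := by
    rw [rayNorm]
    exact norm_iteratedFDeriv_eq_of_norm_eq (fun x y h => SmoothRad.radial f h) j
      (by rw [norm_smul, he, norm_norm, mul_one])
  rw [hray] at h'
  have e1 : ‖x‖ ^ (2 * s) = (‖x‖ ^ s) ^ 2 := by
    rw [mul_comm, Real.rpow_mul hxpos.le]; norm_num
  rw [e1, ← mul_pow, ← add_mul, ← mul_assoc] at h'
  have h2 : ‖x‖ ^ s * ‖iteratedFDeriv ℝ j (f : E d → ℝ) x‖ ≤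
      √(n * (C1 + C2)) * ‖toSobolev k f‖ := by
    refine (sq_le_sq₀ (by positivity) (by positivity)).1 ?_
    rw [mul_pow _ ‖toSobolev k f‖, Real.sq_sqrt (by positivity)]
    exact h'
  have e2 : R ^ (-s) * (‖x‖ / R) ^ (-s) = (‖x‖ ^ s)⁻¹ := by
    rw [← Real.mul_rpow hR.le (by positivity), mul_div_cancel₀ _ hR.ne', Real.rpow_neg hxpos.le]
  have hxs : 0 < ‖x‖ ^ s := Real.rpow_pos_of_pos hxpos _
  calc ‖iteratedFDeriv ℝ j (f : E d → ℝ) x‖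
      ≤ √(n * (C1 + C2)) * ‖toSobolev k f‖ * (‖x‖ ^ s)⁻¹ := by
        rw [← div_eq_mul_inv, le_div_iff₀ hxs, mul_comm]; exact h2
    _ = √(n * (C1 + C2)) * R ^ (-s) * ‖toSobolev k f‖ * (‖x‖ / R) ^ (-s) := by
        rw [← e2]; ring

end Radial

end BlowupStability

namespace BlowupStability

/-! ## Weighted pointwise bounds -/

section Weights

open Set

/-- A small positive number whose multiples by `j ≤ k + 1` are at most `1 / 2`. -/
noncomputable def wtDelta (k : ℕ) : ℝ := 1 / (2 * (k + 1))

/-- The exponent of the weight in the pointwise bound of the `j`-th derivative of a function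
in `H^k`. -/
noncomputable def sobWt (d k j : ℕ) : ℝ := max (j - (k - (d : ℝ) / 2)) (wtDelta k)

/-- The exponent of the weight in the pointwise bound of the `j`-th derivative of a smooth function
of `x f(x)` with `f` in `H^k`. -/
noncomputable def compWt (d k j : ℕ) : ℝ :=
  max (j - 1 - (k - (d : ℝ) / 2)) (j * wtDelta k)

theorem wtDelta_pos (k : ℕ) : 0 < wtDelta k := by unfold wtDelta; positivity

theorem mul_wtDelta (k : ℕ) : ((k : ℝ) + 1) * wtDelta k = 1 / 2 := by
  unfold wtDelta
  have : (k : ℝ) + 1 ≠ 0 := by positivity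
  field_simp

theorem natCast_mul_wtDelta_le {j k : ℕ} (h : j ≤ k + 1) : j * wtDelta k ≤ 1 / 2 := by
  rw [← mul_wtDelta k]
  exact mul_le_mul_of_nonneg_right (by exact_mod_cast h) (wtDelta_pos k).le

theorem wtDelta_le_half (k : ℕ) : wtDelta k ≤ 1 / 2 := by
  have := natCast_mul_wtDelta_le (j := 1) (k := k) (by omega)
  simpa using this

theorem sobWt_pos (d k j : ℕ) : 0 < sobWt d k j := (wtDelta_pos k).trans_le (le_max_right _ _)

theorem compWt_nonneg (d k j : ℕ) : 0 ≤ compWt d k j :=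
  (mul_nonneg (Nat.cast_nonneg _) (wtDelta_pos k).le).trans (le_max_right _ _)

/-- Superadditivity makes weighted bounds stable under products. It holds since `1 + κ ≥ 0` for `κ =
k - d/2`, and because the lower cutoff `j * wtDelta k` is linear in `j` rather than constant. -/
theorem compWt_add_le {d k : ℕ} (hk : d ≤ 2 * k + 1) (i j : ℕ) :
    compWt d k i + compWt d k j ≤ compWt d k (i + j) := by
  have hk' : (d : ℝ) ≤ 2 * k + 1 := by exact_mod_cast hk
  have h1 : (i : ℝ) * wtDelta k ≤ i := mul_le_of_le_one_right (Nat.cast_nonneg _)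
    ((wtDelta_le_half k).trans (by norm_num))
  have h2 : (j : ℝ) * wtDelta k ≤ j := mul_le_of_le_one_right (Nat.cast_nonneg _)
    ((wtDelta_le_half k).trans (by norm_num))
  have a1 := le_max_left (((i + j : ℕ) : ℝ) - 1 - (k - (d : ℝ) / 2)) (((i + j : ℕ) : ℝ) * wtDelta k)
  have a2 := le_max_right (((i + j : ℕ) : ℝ) - 1 - (k - (d : ℝ) / 2)) (((i + j : ℕ) : ℝ) * wtDelta k)
  unfold compWt
  push_cast at a1 a2 ⊢
  rw [add_mul] at a1 a2 ⊢
  rcases max_cases ((i : ℝ) - 1 - (k - (d : ℝ) / 2)) (i * wtDelta k) with ⟨h, -⟩ | ⟨h, -⟩ <;>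
  rcases max_cases ((j : ℝ) - 1 - (k - (d : ℝ) / 2)) (j * wtDelta k) with ⟨h', -⟩ | ⟨h', -⟩ <;>
  rw [h, h'] <;> linarith

theorem compWt_zero {d k : ℕ} (hk : d ≤ 2 * k + 1) : compWt d k 0 = 0 := by
  have h := compWt_add_le hk 0 0
  have h' := compWt_nonneg d k 0
  simp only [add_zero] at h
  linarith

theorem sobWt_zero_le {d k : ℕ} (hk : d ≤ 2 * k + 1) : sobWt d k 0 ≤ 1 := by
  have hk' : (d : ℝ) ≤ 2 * k + 1 := by exact_mod_cast hk
  have := wtDelta_le_half k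
  exact max_le (by push_cast; linarith) (by linarith)

/-- This is the exponent condition of the chain rule: a derivative of order `i + 1` of `z(x) x` has
weight `sobWt d k i`, and it must not exceed the fraction `(i + 1) / e` of `compWt d k e`. With `κ =
k - d/2`, it holds because `(e - 1 - κ) / e` increases with `e`, as `1 + κ > 0`. -/
theorem sobWt_mul_le {d k : ℕ} (hk : d ≤ 2 * k + 1) {i e : ℕ} (hie : i + 1 ≤ e) :
    sobWt d k i * e ≤ (i + 1 : ℕ) * compWt d k e := by
  have hk' : (d : ℝ) ≤ 2 * k + 1 := by exact_mod_cast hk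
  have hie' : (i : ℝ) + 1 ≤ e := by exact_mod_cast hie
  have a1 := le_max_left ((e : ℝ) - 1 - (k - (d : ℝ) / 2)) (e * wtDelta k)
  have a2 := le_max_right ((e : ℝ) - 1 - (k - (d : ℝ) / 2)) (e * wtDelta k)
  have hi : (0 : ℝ) ≤ (i : ℝ) + 1 := by positivity
  have b1 := mul_le_mul_of_nonneg_left a1 hi
  have b2 := mul_le_mul_of_nonneg_left a2 hi
  have hd := wtDelta_pos k
  unfold compWt sobWt
  push_cast
  rcases max_cases ((i : ℝ) - (k - (d : ℝ) / 2)) (wtDelta k) with ⟨h, -⟩ | ⟨h, -⟩ <;> rw [h]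
  · refine le_trans ?_ b1
    nlinarith [mul_nonneg (sub_nonneg.2 hie')
      (show (0 : ℝ) ≤ 1 + (k - (d : ℝ) / 2) by linarith)]
  · refine le_trans ?_ b2
    nlinarith [mul_nonneg (mul_nonneg (Nat.cast_nonneg (α := ℝ) i) (Nat.cast_nonneg (α := ℝ) e))
      hd.le]

/-- One more derivative costs at most one power of `|x|`, so a factor `|x|` compensates for it. -/
theorem one_sub_sobWt_ge (d k i : ℕ) : -sobWt d k i ≤ 1 - sobWt d k (i + 1) := by
  have a1 := le_max_left ((i : ℝ) - (k - (d : ℝ) / 2)) (wtDelta k)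
  have a2 := le_max_right ((i : ℝ) - (k - (d : ℝ) / 2)) (wtDelta k)
  have hd := wtDelta_pos k
  have hd' := wtDelta_le_half k
  unfold sobWt
  push_cast
  rcases max_cases ((i : ℝ) + 1 - (k - (d : ℝ) / 2)) (wtDelta k) with ⟨h, -⟩ | ⟨h, -⟩ <;> rw [h] <;>
  linarith

/-- The two conditions under which Hardy's inequality controls the factor of order `a`: at most `k -
a` powers of the weight are available, and the weight must stay integrable at the origin. The spare
derivative, the `1` in `habce`, pays for the up to `1/2` lost by each of the factors of orders `b`
and `c`. -/
theorem sobWt_add_le {d k : ℕ} (hd : 5 ≤ d) (hk : d ≤ 2 * k + 1) {a b c e : ℕ}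
    (habce : a + b + c + e + 1 ≤ k) (hb : b ≤ a) (hc : c ≤ a) :
    sobWt d k b + sobWt d k c + compWt d k e ≤ k - a ∧
      sobWt d k b + sobWt d k c + compWt d k e < (d : ℝ) / 2 := by
  have hd' : (5 : ℝ) ≤ d := by exact_mod_cast hd
  have hs : (a : ℝ) + b + c + e + 1 ≤ k := by exact_mod_cast habce
  have hb' : (b : ℝ) ≤ a := by exact_mod_cast hb
  have hc' : (c : ℝ) ≤ a := by exact_mod_cast hc
  have ha0 : (0 : ℝ) ≤ a := Nat.cast_nonneg _
  have hb0 : (0 : ℝ) ≤ b := Nat.cast_nonneg _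
  have hc0 : (0 : ℝ) ≤ c := Nat.cast_nonneg _
  have he0 : (0 : ℝ) ≤ e := Nat.cast_nonneg _
  have hδ := wtDelta_pos k
  have hδ' := wtDelta_le_half k
  have he1 : (e : ℝ) * wtDelta k ≤ e := mul_le_of_le_one_right he0 (by linarith)
  -- If all three weights sit at their lower cutoffs, their sum is still at most `1/2`; this is what
  -- the size of `wtDelta k` is chosen for.
  have he2 : (e : ℝ) * wtDelta k + 2 * wtDelta k ≤ 1 / 2 := by
    have := natCast_mul_wtDelta_le (j := e + 2) (k := k) (by omega)
    push_cast at this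
    linarith
  have hed : (0 : ℝ) ≤ e * wtDelta k := mul_nonneg he0 hδ.le
  have hk' : (d : ℝ) = 2 * k + 1 ∨ (d : ℝ) ≤ 2 * k := by
    rcases hk.eq_or_lt with h | h
    · left; exact_mod_cast h
    · right; exact_mod_cast Nat.lt_succ_iff.1 h
  unfold sobWt compWt
  rcases max_cases ((b : ℝ) - (k - (d : ℝ) / 2)) (wtDelta k) with ⟨h, g⟩ | ⟨h, g⟩ <;>
  rcases max_cases ((c : ℝ) - (k - (d : ℝ) / 2)) (wtDelta k) with ⟨h', g'⟩ | ⟨h', g'⟩ <;>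
  rcases max_cases ((e : ℝ) - 1 - (k - (d : ℝ) / 2)) (e * wtDelta k) with ⟨h'', g''⟩ | ⟨h'', g''⟩ <;>
  rw [h, h', h''] <;> rcases hk' with hk' | hk' <;> constructor <;> linarith

variable {d : ℕ} {R : ℝ}

theorem weight_le_weight {x : E d} (hx : x ∈ Ball d R) (hx0 : x ≠ 0) {s t : ℝ} (hst : s ≤ t) :
    (‖x‖ / R) ^ (-s) ≤ (‖x‖ / R) ^ (-t) := by
  have hxpos : 0 < ‖x‖ := norm_pos_iff.2 hx0
  have hxR := mem_Ball.1 hx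
  have hR : 0 < R := hxpos.trans hxR
  exact Real.rpow_le_rpow_of_exponent_ge (by positivity) ((div_le_one hR).2 hxR.le) (neg_le_neg hst)

theorem weight_pos {x : E d} (hx : x ∈ Ball d R) (hx0 : x ≠ 0) (s : ℝ) : 0 < (‖x‖ / R) ^ s := by
  have hxpos : 0 < ‖x‖ := norm_pos_iff.2 hx0
  have hR : 0 < R := hxpos.trans (mem_Ball.1 hx)
  exact Real.rpow_pos_of_pos (by positivity) _

theorem weight_add {x : E d} (hx : x ∈ Ball d R) (hx0 : x ≠ 0) (s t : ℝ) :
    (‖x‖ / R) ^ (-s) * (‖x‖ / R) ^ (-t) = (‖x‖ / R) ^ (-(s + t)) := by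
  have hxpos : 0 < ‖x‖ := norm_pos_iff.2 hx0
  have hR : 0 < R := hxpos.trans (mem_Ball.1 hx)
  rw [← Real.rpow_add (by positivity), neg_add]

theorem exists_norm_iteratedFDeriv_le_sobWt (hR : 0 < R) (hd : 0 < d) (k : ℕ) :
    ∃ C : ℝ, 0 ≤ C ∧ ∀ f : SmoothRad d R, ∀ j, j + 1 ≤ k → ∀ x ∈ Ball d R, x ≠ 0 →
      ‖iteratedFDeriv ℝ j (f : E d → ℝ) x‖ ≤
        C * ‖toSobolev k f‖ * (‖x‖ / R) ^ (-sobWt d k j) := by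
  have he : ‖(EuclideanSpace.single ⟨0, hd⟩ 1 : E d)‖ = 1 := by simp
  have h : ∀ j : ℕ, ∃ C : ℝ, 0 ≤ C ∧ (j + 1 ≤ k → ∀ f : SmoothRad d R, ∀ x ∈ Ball d R, x ≠ 0 →
      ‖iteratedFDeriv ℝ j (f : E d → ℝ) x‖ ≤
        C * ‖toSobolev k f‖ * (‖x‖ / R) ^ (-sobWt d k j)) := by
    intro j
    by_cases hj : j + 1 ≤ k
    · obtain ⟨C, hC0, hC⟩ := exists_norm_iteratedFDeriv_le hR he hj (sobWt_pos d k j)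
        (by have := le_max_left ((j : ℝ) - (k - (d : ℝ) / 2)) (wtDelta k)
            unfold sobWt; linarith)
      exact ⟨C, hC0, fun _ => hC⟩
    · exact ⟨0, le_rfl, fun h => absurd h hj⟩
  choose C hC0 hC using h
  refine ⟨∑ j ∈ Finset.range k, C j, Finset.sum_nonneg fun j _ => hC0 j,
    fun f j hj x hx hx0 => (hC j hj f x hx hx0).trans ?_⟩
  have := Finset.single_le_sum (f := C) (fun j _ => hC0 j) (Finset.mem_range.2 hj)
  have hw := (weight_pos hx hx0 (-sobWt d k j)).le
  gcongr

/-- The bounds on the derivatives that smooth functions of `x f(x)` with `f` in `H^k` satisfy. -/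
def WeightBdd (R : ℝ) {d : ℕ} (k : ℕ) (K : ℝ) (Θ : E d → ℝ) : Prop :=
  ∀ j, j + 1 ≤ k → ∀ x ∈ Ball d R, x ≠ 0 →
    ‖iteratedFDeriv ℝ j Θ x‖ ≤ K * (‖x‖ / R) ^ (-compWt d k j)

theorem BddSmooth.exists_weightBdd {Θ : E d → ℝ} (hΘ : BddSmooth R Θ) (k : ℕ) :
    ∃ K : ℝ, 0 ≤ K ∧ WeightBdd R k K Θ := by
  obtain ⟨B, hB0, hB⟩ := hΘ.exists_bound k
  refine ⟨B, hB0, fun j hj x hx hx0 => (hB j (by omega) x hx).trans ?_⟩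
  have h := weight_le_weight hx hx0 (compWt_nonneg d k j)
  rw [neg_zero, Real.rpow_zero] at h
  exact le_mul_of_one_le_right hB0 h

theorem WeightBdd.mul {k : ℕ} (hk : d ≤ 2 * k + 1) {K L : ℝ} (hK : 0 ≤ K)
    {Θ Ψ : E d → ℝ} (hΘ : WeightBdd R k K Θ) (hΨ : WeightBdd R k L Ψ)
    (hΘs : ContDiffOn ℝ ∞ Θ (Ball d R)) (hΨs : ContDiffOn ℝ ∞ Ψ (Ball d R)) (hL : 0 ≤ L) :
    WeightBdd R k (2 ^ k * (K * L)) (fun x => Θ x * Ψ x) := by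
  intro j hj x hx hx0
  refine (norm_iteratedFDeriv_mul_le_of_Ball hΘs hΨs hx j).trans ?_
  have hw := (weight_pos hx hx0 (-compWt d k j)).le
  calc ∑ i ∈ Finset.range (j + 1), (j.choose i : ℝ) * ‖iteratedFDeriv ℝ i Θ x‖ *
        ‖iteratedFDeriv ℝ (j - i) Ψ x‖
      ≤ ∑ i ∈ Finset.range (j + 1), (j.choose i : ℝ) * (K * L * (‖x‖ / R) ^ (-compWt d k j)) := by
        refine Finset.sum_le_sum fun i hi => ?_
        have hij : i ≤ j := Nat.lt_succ_iff.1 (Finset.mem_range.1 hi)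
        rw [mul_assoc]
        refine mul_le_mul_of_nonneg_left ?_ (Nat.cast_nonneg _)
        refine (mul_le_mul (hΘ i (by omega) x hx hx0) (hΨ (j - i) (by omega) x hx hx0)
          (norm_nonneg _) (mul_nonneg hK (weight_pos hx hx0 _).le)).trans ?_
        rw [mul_mul_mul_comm, weight_add hx hx0]
        refine mul_le_mul_of_nonneg_left (weight_le_weight hx hx0 ?_) (by positivity)
        have := compWt_add_le hk i (j - i)
        rwa [Nat.add_sub_cancel' hij] at this
    _ = 2 ^ j * (K * L * (‖x‖ / R) ^ (-compWt d k j)) := by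
        rw [← Finset.sum_mul]
        congr 1
        exact_mod_cast Nat.sum_range_choose j
    _ ≤ 2 ^ k * (K * L) * (‖x‖ / R) ^ (-compWt d k j) := by
        rw [mul_assoc (2 ^ k)]
        refine mul_le_mul_of_nonneg_right ?_ (by positivity)
        exact pow_le_pow_right₀ (by norm_num) (by omega)

theorem norm_iteratedFDeriv_id_le (x : E d) (j : ℕ) :
    ‖iteratedFDeriv ℝ j (fun y : E d => y) x‖ ≤ if j = 0 then ‖x‖ else if j = 1 then 1 else 0 := by
  match j with
  | 0 => simp
  | j + 1 =>
    have hid : fderiv ℝ (fun y : E d => y) = fun _ => ContinuousLinearMap.id ℝ (E d) := by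
      funext y; exact fderiv_fun_id
    rw [← norm_iteratedFDeriv_fderiv, hid]
    match j with
    | 0 => simpa using ContinuousLinearMap.norm_id_le
    | j + 1 => simp [iteratedFDeriv_succ_const]

/-- Derivatives of the identity of order above one vanish, so only `D^j z` and `x D^(j+1) z`
survive. The factor `x` makes up for the extra derivative in the second term, and the weight is that
of `z` at one order less. -/
theorem exists_norm_iteratedFDeriv_smul_id_le (hR : 0 < R) (hd : 0 < d) (k : ℕ) :
    ∃ C : ℝ, 0 ≤ C ∧ ∀ z : SmoothRad d R, ∀ j, j + 2 ≤ k → ∀ x ∈ Ball d R, x ≠ 0 →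
      ‖iteratedFDeriv ℝ (j + 1) (fun y => (z : E d → ℝ) y • y) x‖ ≤
        C * ‖toSobolev k z‖ * (‖x‖ / R) ^ (-sobWt d k j) := by
  obtain ⟨C, hC0, hC⟩ := exists_norm_iteratedFDeriv_le_sobWt (d := d) hR hd k
  -- The binomial coefficients sum to `2 ^ (j + 1) ≤ 2 ^ k`; the summand `R` comes from `|x| ≤ R`,
  -- the summand `1` from the derivative of the identity.
  refine ⟨2 ^ k * (C * (R + 1)), by positivity, fun z j hj x hx hx0 => ?_⟩
  set A := ‖toSobolev k z‖ with hA
  set W := (‖x‖ / R) ^ (-sobWt d k j) with hW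
  have hW0 : 0 < W := weight_pos hx hx0 _
  have hA0 : 0 ≤ A := norm_nonneg _
  refine (norm_iteratedFDeriv_smul_le_of_Ball (SmoothRad.bddSmooth z).1 contDiffOn_id hx
    (j + 1)).trans ?_
  calc ∑ i ∈ Finset.range (j + 1 + 1), ((j + 1).choose i : ℝ) *
        ‖iteratedFDeriv ℝ i (z : E d → ℝ) x‖ * ‖iteratedFDeriv ℝ (j + 1 - i) (fun y : E d => y) x‖
      ≤ ∑ i ∈ Finset.range (j + 1 + 1), ((j + 1).choose i : ℝ) * (C * (R + 1) * A * W) := by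
        refine Finset.sum_le_sum fun i hi => ?_
        have hij : i ≤ j + 1 := Nat.lt_succ_iff.1 (Finset.mem_range.1 hi)
        rw [mul_assoc]
        refine mul_le_mul_of_nonneg_left ?_ (Nat.cast_nonneg _)
        refine (mul_le_mul_of_nonneg_left (norm_iteratedFDeriv_id_le x (j + 1 - i))
          (norm_nonneg _)).trans ?_
        rcases Nat.lt_trichotomy i j with h | h | h
        · rw [if_neg (by omega), if_neg (by omega), mul_zero]
          positivity
        · rw [if_neg (by omega), if_pos (by omega), mul_one, h]
          refine (hC z j (by omega) x hx hx0).trans ?_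
          have : 0 ≤ C * A * W := by positivity
          nlinarith
        · have hi' : i = j + 1 := by omega
          rw [if_pos (by omega), hi']
          have h1 := hC z (j + 1) (by omega) x hx hx0
          refine (mul_le_mul_of_nonneg_right h1 (norm_nonneg x)).trans ?_
          have h2 : ‖x‖ = R * (‖x‖ / R) ^ (-(-1 : ℝ)) := by
            rw [neg_neg, Real.rpow_one, mul_div_cancel₀ _ hR.ne']
          have h3 : (‖x‖ / R) ^ (-sobWt d k (j + 1)) * (‖x‖ / R) ^ (-(-1 : ℝ)) ≤ W := by
            rw [weight_add hx hx0]
            refine weight_le_weight hx hx0 ?_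
            have := one_sub_sobWt_ge d k j
            linarith
          calc C * A * (‖x‖ / R) ^ (-sobWt d k (j + 1)) * ‖x‖
              = C * A * R * ((‖x‖ / R) ^ (-sobWt d k (j + 1)) * (‖x‖ / R) ^ (-(-1 : ℝ))) := by
                nth_rewrite 2 [h2]; ring
            _ ≤ C * A * R * W := by gcongr
            _ ≤ _ := by
                have : 0 ≤ C * A * W := by positivity
                nlinarith
    _ = 2 ^ (j + 1) * (C * (R + 1) * A * W) := by
        rw [← Finset.sum_mul]
        congr 1
        exact_mod_cast Nat.sum_range_choose (j + 1)
    _ ≤ 2 ^ k * (C * (R + 1)) * A * W := by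
        rw [mul_assoc (2 ^ k), mul_assoc (2 ^ k)]
        refine mul_le_mul_of_nonneg_right ?_ (by positivity)
        exact pow_le_pow_right₀ (by norm_num) (by omega)

/-- Since `z = O(|x|^(-1))`, the field `z(x) x` stays in a fixed ball, on which the derivatives of
`Φ` are bounded. The chain rule then distributes the weight `compWt d k e` over the inner
derivatives in proportion to their orders. -/
theorem exists_weightBdd_comp (hR : 0 < R) (hd : 0 < d) {k : ℕ} (hk : d ≤ 2 * k + 1) (hk1 : 1 ≤ k)
    {Φ : E d → ℝ} (hΦ : ContDiff ℝ ∞ Φ) {M : ℝ} (hM : 0 ≤ M) :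
    ∃ K : ℝ, 0 ≤ K ∧ ∀ z : SmoothRad d R, ‖toSobolev k z‖ ≤ M →
      WeightBdd R k K (fun x => Φ ((z : E d → ℝ) x • x)) := by
  obtain ⟨C, hC0, hC⟩ := exists_norm_iteratedFDeriv_smul_id_le (d := d) hR hd k
  obtain ⟨C', hC0', hC'⟩ := exists_norm_iteratedFDeriv_le_sobWt (d := d) hR hd k
  have hc : ∀ i : ℕ, ∃ B : ℝ, ∀ y ∈ Metric.closedBall (0 : E d) (C' * M * R),
      ‖iteratedFDeriv ℝ i Φ y‖ ≤ B :=
    fun i => (isCompact_closedBall (0 : E d) _).exists_bound_of_continuousOn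
      (hΦ.continuous_iteratedFDeriv (by exact_mod_cast le_top)).continuousOn
  choose B hB using hc
  set B' := ∑ i ∈ Finset.range (k + 1), |B i| with hB'
  have hB'0 : 0 ≤ B' := Finset.sum_nonneg fun _ _ => abs_nonneg _
  set L := max (C * M) 1 with hL
  have hL1 : 1 ≤ L := le_max_right _ _
  refine ⟨k.factorial * B' * L ^ k, by positivity, fun z hz e he x hx hx0 => ?_⟩
  have hxpos : 0 < ‖x‖ := norm_pos_iff.2 hx0
  have hρ0 : 0 < ‖x‖ / R := by positivity
  have hρ1 : ‖x‖ / R ≤ 1 := (div_le_one hR).2 (mem_Ball.1 hx).le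
  -- The weight is an `e`-th root, so that `D ^ e` has exactly the exponent `-compWt d k e`.
  set D := L * (‖x‖ / R) ^ (-(compWt d k e / e)) with hD
  have hu : ContDiffOn ℝ ∞ (fun y => (z : E d → ℝ) y • y) (Ball d R) :=
    (SmoothRad.bddSmooth z).1.smul contDiffOn_id
  have hmain := norm_iteratedFDeriv_comp_le_of_Ball (n := e) (C := B') (D := D) hΦ hu hx
    (fun i hi => ?_) (fun i h1 hi => ?_)
  · refine hmain.trans ?_
    have hDe : D ^ e ≤ L ^ k * (‖x‖ / R) ^ (-compWt d k e) := by
      rw [hD, mul_pow, ← Real.rpow_mul_natCast hρ0.le]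
      -- For `e = 0` the quotient is zero by convention, which agrees with `compWt d k 0 = 0`.
      have hexp : -(compWt d k e / e) * e = -compWt d k e := by
        rcases Nat.eq_zero_or_pos e with rfl | h
        · rw [compWt_zero hk]; simp
        · have : (e : ℝ) ≠ 0 := by positivity
          field_simp
      rw [hexp]
      exact mul_le_mul_of_nonneg_right (pow_le_pow_right₀ hL1 (by omega)) (weight_pos hx hx0 _).le
    have hfac : (e.factorial : ℝ) ≤ k.factorial := by
      exact_mod_cast Nat.factorial_le (by omega)
    have hDn : 0 ≤ D ^ e := by positivity
    calc (e.factorial : ℝ) * B' * D ^ e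
        ≤ k.factorial * B' * (L ^ k * (‖x‖ / R) ^ (-compWt d k e)) := by gcongr
      _ = _ := by ring
  · have hmem : (z : E d → ℝ) x • x ∈ Metric.closedBall (0 : E d) (C' * M * R) := by
      rw [mem_closedBall_zero_iff, norm_smul]
      have h0 := hC' z 0 (by omega) x hx hx0
      rw [norm_iteratedFDeriv_zero] at h0
      -- Here `κ = k - d/2 ≥ -1/2` enters: the singularity of `z` at the origin is no worse than
      -- `|x|^(-1)`.
      have h1 : (‖x‖ / R) ^ (-sobWt d k 0) ≤ (‖x‖ / R) ^ (-1 : ℝ) :=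
        weight_le_weight hx hx0 (sobWt_zero_le hk)
      calc ‖(z : E d → ℝ) x‖ * ‖x‖ ≤ C' * M * (‖x‖ / R) ^ (-1 : ℝ) * ‖x‖ := by
            refine mul_le_mul_of_nonneg_right (h0.trans ?_) (norm_nonneg _)
            have := (weight_pos hx hx0 (-sobWt d k 0)).le
            gcongr
        _ = C' * M * R := by
            rw [Real.rpow_neg_one]; field_simp
    exact ((hB i _ hmem).trans (le_abs_self _)).trans (Finset.single_le_sum
      (f := fun j => |B j|) (fun _ _ => abs_nonneg _) (Finset.mem_range.2 (by omega)))
  · obtain ⟨i, rfl⟩ : ∃ l, i = l + 1 := ⟨i - 1, by omega⟩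
    refine (hC z i (by omega) x hx hx0).trans ?_
    rw [hD, mul_pow, ← Real.rpow_mul_natCast hρ0.le]
    have he0 : (0 : ℝ) < e := by exact_mod_cast (by omega : 0 < e)
    have hexp : (‖x‖ / R) ^ (-sobWt d k i) ≤ (‖x‖ / R) ^ (-(compWt d k e / e) * (i + 1 : ℕ)) := by
      rw [neg_mul]
      refine weight_le_weight hx hx0 ?_
      rw [div_mul_eq_mul_div, le_div_iff₀ he0, mul_comm (compWt d k e)]
      exact sobWt_mul_le hk hi
    have hLi : C * ‖toSobolev k z‖ ≤ L ^ (i + 1) :=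
      ((mul_le_mul_of_nonneg_left hz hC0).trans (le_max_left _ 1)).trans
        (le_self_pow₀ hL1 (by omega))
    exact mul_le_mul hLi hexp (weight_pos hx hx0 _).le (by positivity)

end Weights

end BlowupStability

namespace BlowupStability

/-! ## The trilinear estimate -/

section Trilinear

open Set

/-- The function `t` on `(0, R)` is dominated in the radial `L²` norm by the constant `B`. -/
def RayDom (d : ℕ) (R : ℝ) (t : ℝ → ℝ) (B : ℝ) : Prop :=
  0 ≤ B ∧ ∃ M : ℝ → ℝ, IntegrableOn M (Ioo 0 R) ∧
    (∀ r ∈ Ioo 0 R, r ^ ((d : ℝ) - 1) * t r ^ 2 ≤ M r) ∧ ∫ r in Ioo 0 R, M r ≤ B ^ 2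

variable {d : ℕ} {R : ℝ}

theorem RayDom.const_mul {t : ℝ → ℝ} {B c : ℝ} (h : RayDom d R t B) (hc : 0 ≤ c) :
    RayDom d R (fun r => c * t r) (c * B) := by
  obtain ⟨hB, M, hM, hle, hint⟩ := h
  refine ⟨mul_nonneg hc hB, fun r => c ^ 2 * M r, hM.const_mul _, fun r hr => ?_, ?_⟩
  · have := mul_le_mul_of_nonneg_left (hle r hr) (sq_nonneg c)
    calc r ^ ((d : ℝ) - 1) * (c * t r) ^ 2 = c ^ 2 * (r ^ ((d : ℝ) - 1) * t r ^ 2) := by ring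
      _ ≤ _ := this
  · rw [integral_const_mul, mul_pow]
    exact mul_le_mul_of_nonneg_left hint (sq_nonneg c)

/-- Cauchy-Schwarz for the finite sum costs the number of summands, which is then bounded by its
square. -/
theorem RayDom.sum {ι : Type*} (s : Finset ι) {t : ι → ℝ → ℝ} {B : ι → ℝ}
    (h : ∀ i ∈ s, RayDom d R (t i) (B i)) :
    RayDom d R (fun r => ∑ i ∈ s, t i r) (s.card * ∑ i ∈ s, B i) := by
  choose! hB M hM hle hint using h
  refine ⟨mul_nonneg (Nat.cast_nonneg _) (Finset.sum_nonneg hB),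
    fun r => s.card * ∑ i ∈ s, M i r, (integrable_finsetSum s hM).const_mul _, fun r hr => ?_, ?_⟩
  · have h1 := sq_sum_le_card_mul_sum_sq (s := s) (f := fun i => t i r)
    have hr' : 0 ≤ r ^ ((d : ℝ) - 1) := Real.rpow_nonneg hr.1.le _
    calc r ^ ((d : ℝ) - 1) * (∑ i ∈ s, t i r) ^ 2
        ≤ r ^ ((d : ℝ) - 1) * (s.card * ∑ i ∈ s, t i r ^ 2) := mul_le_mul_of_nonneg_left h1 hr'
      _ = s.card * ∑ i ∈ s, r ^ ((d : ℝ) - 1) * t i r ^ 2 := by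
          rw [mul_left_comm, Finset.mul_sum]
      _ ≤ s.card * ∑ i ∈ s, M i r := mul_le_mul_of_nonneg_left
          (Finset.sum_le_sum fun i hi => hle i hi r hr) (Nat.cast_nonneg _)
  · rw [integral_const_mul, integral_finsetSum s hM, mul_pow]
    have h2 : ∑ i ∈ s, ∫ r in Ioo 0 R, M i r ≤ (∑ i ∈ s, B i) ^ 2 :=
      (Finset.sum_le_sum hint).trans (Finset.sum_sq_le_sq_sum_of_nonneg hB)
    have h3 : (s.card : ℝ) ≤ (s.card : ℝ) ^ 2 := by
      exact_mod_cast Nat.le_self_pow two_ne_zero s.card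
    exact mul_le_mul h3 h2 (Finset.sum_nonneg fun i hi => setIntegral_nonneg measurableSet_Ioo
      fun r hr => (mul_nonneg (Real.rpow_nonneg hr.1.le _) (sq_nonneg _)).trans (hle i hi r hr))
      (by positivity)

theorem RayDom.mono {t t' : ℝ → ℝ} {B B' : ℝ} (h : RayDom d R t B)
    (h0 : ∀ r ∈ Ioo 0 R, 0 ≤ t' r) (ht : ∀ r ∈ Ioo 0 R, t' r ≤ t r) (hB' : B ≤ B') :
    RayDom d R t' B' := by
  obtain ⟨hB, M, hM, hle, hint⟩ := h
  refine ⟨hB.trans hB', M, hM, fun r hr => le_trans ?_ (hle r hr),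
    hint.trans (pow_le_pow_left₀ hB hB' 2)⟩
  exact mul_le_mul_of_nonneg_left (pow_le_pow_left₀ (h0 r hr) (ht r hr) 2)
    (Real.rpow_nonneg hr.1.le _)

variable {e : E d}

/-- The factors of orders `b`, `c` and `n` are bounded pointwise by powers of `r` with total
exponent `-s`. The factor of order `a` is then estimated in `L²` with weight `r^(d-1-2s)` by
iterated Hardy inequalities. -/
theorem exists_rayDom_of_le (hR : 0 < R) (hd : 5 ≤ d) {k : ℕ} (hk : d ≤ 2 * k + 1)
    (he : ‖e‖ = 1) {a b c n : ℕ} (habc : a + b + c + n + 1 ≤ k) (hb : b ≤ a) (hc : c ≤ a) :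
    ∃ C : ℝ, 0 ≤ C ∧ ∀ (f g h : SmoothRad d R) (Θ : E d → ℝ) (K : ℝ), 0 ≤ K →
      WeightBdd R k K Θ →
      RayDom d R (fun r => rayNorm e a (f : E d → ℝ) r * rayNorm e b (g : E d → ℝ) r *
        rayNorm e c (h : E d → ℝ) r * rayNorm e n Θ r)
        (C * (K * (‖toSobolev k f‖ * ‖toSobolev k g‖ * ‖toSobolev k h‖))) := by
  obtain ⟨C, hC0, hC⟩ := exists_norm_iteratedFDeriv_le_sobWt (d := d) hR (by omega) k
  set s := sobWt d k b + sobWt d k c + compWt d k n with hs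
  obtain ⟨hs1, hs2⟩ := sobWt_add_le hd hk habc hb hc
  obtain ⟨D, hD0, hD⟩ := exists_rayInt_le_of_le (d := d) hR he (k := k) (j := a)
    (q := (d : ℝ) - 1 - 2 * s) (by omega) (by linarith) (by linarith)
  refine ⟨C ^ 2 * (R ^ s * √D), by positivity, fun f g h Θ K hK hΘ => ⟨by positivity, ?_⟩⟩
  set A := C ^ 2 * R ^ s * (K * (‖toSobolev k g‖ * ‖toSobolev k h‖)) with hA
  refine ⟨fun r => A ^ 2 * (r ^ ((d : ℝ) - 1 - 2 * s) * rayNorm e a (f : E d → ℝ) r ^ 2),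
    (integrableOn_rayNorm hR he f a (by linarith)).const_mul _, fun r hr => ?_, ?_⟩
  · have hx : r • e ∈ Ball d R := smul_mem_Ball he hr
    have hnorm : ‖r • e‖ = r := by
      rw [norm_smul, he, mul_one, Real.norm_eq_abs, abs_of_pos hr.1]
    have hx0 : r • e ≠ 0 := by
      rw [← norm_pos_iff, hnorm]; exact hr.1
    have h1 := hC g b (by omega) _ hx hx0
    have h2 := hC h c (by omega) _ hx hx0
    have h3 := hΘ n (by omega) _ hx hx0
    have hprod : rayNorm e b (g : E d → ℝ) r * rayNorm e c (h : E d → ℝ) r * rayNorm e n Θ r ≤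
        A * r ^ (-s) := by
      have hw := fun t => (weight_pos hx hx0 t).le
      refine (mul_le_mul (mul_le_mul h1 h2 (norm_nonneg _)
        (mul_nonneg (by positivity) (hw _))) h3 (norm_nonneg _)
        (mul_nonneg (mul_nonneg (by positivity) (hw _)) (mul_nonneg (by positivity) (hw _)))).trans
        (le_of_eq ?_)
      have e1 : R ^ s * r ^ (-s) = (‖r • e‖ / R) ^ (-s) := by
        rw [hnorm, Real.div_rpow hr.1.le hR.le, Real.rpow_neg hR.le, div_inv_eq_mul, mul_comm]
      have e2 : (‖r • e‖ / R) ^ (-s) = (‖r • e‖ / R) ^ (-sobWt d k b) *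
          (‖r • e‖ / R) ^ (-sobWt d k c) * (‖r • e‖ / R) ^ (-compWt d k n) := by
        rw [weight_add hx hx0, weight_add hx hx0]
      calc _ = C ^ 2 * (K * (‖toSobolev k g‖ * ‖toSobolev k h‖)) * (‖r • e‖ / R) ^ (-s) := by
            rw [e2]; ring
        _ = A * r ^ (-s) := by rw [← e1, hA]; ring
    have hn : 0 ≤ rayNorm e b (g : E d → ℝ) r * rayNorm e c (h : E d → ℝ) r * rayNorm e n Θ r :=
      mul_nonneg (mul_nonneg (norm_nonneg _) (norm_nonneg _)) (norm_nonneg _)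
    have hsq := pow_le_pow_left₀ hn hprod 2
    have e3 : r ^ ((d : ℝ) - 1 - 2 * s) = r ^ ((d : ℝ) - 1) * (r ^ (-s)) ^ 2 := by
      rw [← Real.rpow_mul_natCast hr.1.le, ← Real.rpow_add hr.1]
      push_cast; ring_nf
    have hp : 0 ≤ r ^ ((d : ℝ) - 1) * rayNorm e a (f : E d → ℝ) r ^ 2 :=
      mul_nonneg (Real.rpow_nonneg hr.1.le _) (sq_nonneg _)
    have := mul_le_mul_of_nonneg_left hsq hp
    simp only [e3]
    calc _ = r ^ ((d : ℝ) - 1) * rayNorm e a (f : E d → ℝ) r ^ 2 *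
          (rayNorm e b (g : E d → ℝ) r * rayNorm e c (h : E d → ℝ) r * rayNorm e n Θ r) ^ 2 := by
            ring
      _ ≤ _ := this
      _ = _ := by ring
  · rw [integral_const_mul]
    refine (mul_le_mul_of_nonneg_left (hD f) (sq_nonneg A)).trans (le_of_eq ?_)
    have hsq := Real.sq_sqrt hD0
    calc A ^ 2 * (D * ‖toSobolev k f‖ ^ 2)
        = A ^ 2 * ((√D) ^ 2 * ‖toSobolev k f‖ ^ 2) := by rw [hsq]
      _ = _ := by rw [hA]; ring

/-- The roles of `f`, `g`, `h` are permuted so that the highest of the three orders falls on the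
`L²` factor. -/
theorem exists_rayDom (hR : 0 < R) (hd : 5 ≤ d) {k : ℕ} (hk : d ≤ 2 * k + 1)
    (he : ‖e‖ = 1) {a b c n : ℕ} (habc : a + b + c + n + 1 ≤ k) :
    ∃ C : ℝ, 0 ≤ C ∧ ∀ (f g h : SmoothRad d R) (Θ : E d → ℝ) (K : ℝ), 0 ≤ K →
      WeightBdd R k K Θ →
      RayDom d R (fun r => rayNorm e a (f : E d → ℝ) r * rayNorm e b (g : E d → ℝ) r *
        rayNorm e c (h : E d → ℝ) r * rayNorm e n Θ r)
        (C * (K * (‖toSobolev k f‖ * ‖toSobolev k g‖ * ‖toSobolev k h‖))) := by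
  have hcases : (b ≤ a ∧ c ≤ a) ∨ (a ≤ b ∧ c ≤ b) ∨ (a ≤ c ∧ b ≤ c) := by omega
  rcases hcases with ⟨h1, h2⟩ | ⟨h1, h2⟩ | ⟨h1, h2⟩
  · exact exists_rayDom_of_le hR hd hk he habc h1 h2
  · obtain ⟨C, hC0, hC⟩ := exists_rayDom_of_le (e := e) (a := b) (b := a) (c := c) (n := n)
      hR hd hk he (by omega) h1 h2
    refine ⟨C, hC0, fun f g h Θ K hK hΘ => ?_⟩
    convert hC g f h Θ K hK hΘ using 1
    · funext r; ring
    · ring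
  · obtain ⟨C, hC0, hC⟩ := exists_rayDom_of_le (e := e) (a := c) (b := a) (c := b) (n := n)
      hR hd hk he (by omega) h1 h2
    refine ⟨C, hC0, fun f g h Θ K hK hΘ => ?_⟩
    convert hC h f g Θ K hK hΘ using 1
    · funext r; ring
    · ring

theorem rayNorm_mul_le (he : ‖e‖ = 1) {f g : E d → ℝ} (hf : ContDiffOn ℝ ∞ f (Ball d R))
    (hg : ContDiffOn ℝ ∞ g (Ball d R)) (j : ℕ) {r : ℝ} (hr : r ∈ Ioo 0 R) :
    rayNorm e j (fun x => f x * g x) r ≤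
      ∑ i ∈ Finset.range (j + 1), (j.choose i : ℝ) * rayNorm e i f r * rayNorm e (j - i) g r :=
  norm_iteratedFDeriv_mul_le_of_Ball hf hg (smul_mem_Ball he hr) j

/-- The Leibniz rule applied three times; the constant mirrors the nested sums over the orders on
`f`, `g` and `h`. -/
theorem exists_rayDom_mul (hR : 0 < R) (hd : 5 ≤ d) {k : ℕ} (hk : d ≤ 2 * k + 1)
    (he : ‖e‖ = 1) {j : ℕ} (hj : j + 1 ≤ k) :
    ∃ C : ℝ, 0 ≤ C ∧ ∀ (f g h : SmoothRad d R) (Θ : E d → ℝ) (K : ℝ), 0 ≤ K →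
      WeightBdd R k K Θ → ContDiffOn ℝ ∞ Θ (Ball d R) →
      RayDom d R (rayNorm e j
        fun x => (f : E d → ℝ) x * ((g : E d → ℝ) x * ((h : E d → ℝ) x * Θ x)))
        (C * (K * (‖toSobolev k f‖ * ‖toSobolev k g‖ * ‖toSobolev k h‖))) := by
  have hex : ∀ a b c n : ℕ, ∃ C : ℝ, 0 ≤ C ∧ (a + b + c + n + 1 ≤ k →
      ∀ (f g h : SmoothRad d R) (Θ : E d → ℝ) (K : ℝ), 0 ≤ K → WeightBdd R k K Θ →
      RayDom d R (fun r => rayNorm e a (f : E d → ℝ) r * rayNorm e b (g : E d → ℝ) r *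
        rayNorm e c (h : E d → ℝ) r * rayNorm e n Θ r)
        (C * (K * (‖toSobolev k f‖ * ‖toSobolev k g‖ * ‖toSobolev k h‖)))) := by
    intro a b c n
    by_cases habc : a + b + c + n + 1 ≤ k
    · obtain ⟨C, hC0, hC⟩ := exists_rayDom hR hd hk he habc
      exact ⟨C, hC0, fun _ => hC⟩
    · exact ⟨0, le_rfl, fun h => absurd h habc⟩
  choose C hC0 hC using hex
  refine ⟨(Finset.range (j + 1)).card * ∑ a ∈ Finset.range (j + 1),
    (Finset.range (j - a + 1)).card * ∑ b ∈ Finset.range (j - a + 1),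
    (Finset.range (j - a - b + 1)).card * ∑ c ∈ Finset.range (j - a - b + 1),
      (j.choose a : ℝ) * (j - a).choose b * (j - a - b).choose c * C a b c (j - a - b - c),
    ?_, fun f g h Θ K hK hΘ hΘs => ?_⟩
  · refine mul_nonneg (Nat.cast_nonneg _) (Finset.sum_nonneg fun a _ => mul_nonneg (Nat.cast_nonneg _)
      (Finset.sum_nonneg fun b _ => mul_nonneg (Nat.cast_nonneg _) (Finset.sum_nonneg fun c _ => ?_)))
    have := hC0 a b c (j - a - b - c)
    positivity
  set A := K * (‖toSobolev k f‖ * ‖toSobolev k g‖ * ‖toSobolev k h‖) with hA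
  have hdom : RayDom d R (fun r => ∑ a ∈ Finset.range (j + 1), ∑ b ∈ Finset.range (j - a + 1),
      ∑ c ∈ Finset.range (j - a - b + 1),
      (j.choose a : ℝ) * (j - a).choose b * (j - a - b).choose c *
      (rayNorm e a (f : E d → ℝ) r * rayNorm e b (g : E d → ℝ) r *
        rayNorm e c (h : E d → ℝ) r * rayNorm e (j - a - b - c) Θ r)) _ :=
    RayDom.sum _ fun a ha => RayDom.sum _ fun b hb => RayDom.sum _ fun c hc => by
      rw [Finset.mem_range] at ha hb hc
      exact (hC a b c (j - a - b - c) (by omega) f g h Θ K hK hΘ).const_mul (by positivity)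
  refine hdom.mono (fun r _ => norm_nonneg _) (fun r hr => ?_) (le_of_eq ?_)
  · have hfs := (SmoothRad.bddSmooth f).1
    have hgs := (SmoothRad.bddSmooth g).1
    have hhs := (SmoothRad.bddSmooth h).1
    refine (rayNorm_mul_le he hfs (hgs.mul (hhs.mul hΘs)) j hr).trans
      (Finset.sum_le_sum fun a _ => ?_)
    refine (mul_le_mul_of_nonneg_left ((rayNorm_mul_le he hgs (hhs.mul hΘs) (j - a) hr).trans
      (Finset.sum_le_sum fun b _ => mul_le_mul_of_nonneg_left
        (rayNorm_mul_le he hhs hΘs (j - a - b) hr)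
        (mul_nonneg (Nat.cast_nonneg _) (norm_nonneg _))))
      (mul_nonneg (Nat.cast_nonneg _) (norm_nonneg _))).trans (le_of_eq ?_)
    simp only [Finset.mul_sum, rayNorm]
    exact Finset.sum_congr rfl fun b _ => Finset.sum_congr rfl fun c _ => by ring
  · simp only [Finset.mul_sum, Finset.sum_mul]
    exact Finset.sum_congr rfl fun a _ => Finset.sum_congr rfl fun b _ =>
      Finset.sum_congr rfl fun c _ => by ring

/-- The product of three functions in `H^k` and a function with bounded derivatives in the
weighted sense lies in `H^(k-1)`. -/
theorem exists_norm_toSobolev_mul_le (hR : 0 < R) (hd : 5 ≤ d) {k : ℕ} (hk : d ≤ 2 * k + 1) :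
    ∃ C : ℝ, 0 ≤ C ∧ ∀ (f g h F : SmoothRad d R) (Θ : E d → ℝ) (K : ℝ), 0 ≤ K →
      WeightBdd R k K Θ → ContDiffOn ℝ ∞ Θ (Ball d R) →
      (∀ x ∈ Ball d R, (F : E d → ℝ) x =
        (f : E d → ℝ) x * ((g : E d → ℝ) x * ((h : E d → ℝ) x * Θ x))) →
      ‖toSobolev (k - 1) F‖ ≤
        C * K * (‖toSobolev k f‖ * ‖toSobolev k g‖ * ‖toSobolev k h‖) := by
  have he : ‖(EuclideanSpace.single ⟨0, by omega⟩ 1 : E d)‖ = 1 := by simp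
  set e : E d := EuclideanSpace.single ⟨0, by omega⟩ 1
  have hex : ∀ j : ℕ, ∃ C : ℝ, 0 ≤ C ∧ (j + 1 ≤ k →
      ∀ (f g h : SmoothRad d R) (Θ : E d → ℝ) (K : ℝ), 0 ≤ K →
      WeightBdd R k K Θ → ContDiffOn ℝ ∞ Θ (Ball d R) →
      RayDom d R (rayNorm e j
        fun x => (f : E d → ℝ) x * ((g : E d → ℝ) x * ((h : E d → ℝ) x * Θ x)))
        (C * (K * (‖toSobolev k f‖ * ‖toSobolev k g‖ * ‖toSobolev k h‖)))) := by
    intro j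
    by_cases hj : j + 1 ≤ k
    · obtain ⟨C, hC0, hC⟩ := exists_rayDom_mul hR hd hk he hj
      exact ⟨C, hC0, fun _ => hC⟩
    · exact ⟨0, le_rfl, fun h => absurd h hj⟩
  choose C hC0 hC using hex
  set C' := ∑ j ∈ Finset.range k, C j with hC'
  have hC'0 : 0 ≤ C' := Finset.sum_nonneg fun j _ => hC0 j
  set v : ℝ := d * (volume : Measure (E d)).real (Metric.ball 0 1) with hv
  have hv0 : 0 ≤ v := by positivity
  set N : ℝ := (Fintype.card (MultiIndex d (k - 1)) : ℝ) with hN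
  refine ⟨√(N * v) * C', by positivity, fun f g h F Θ K hK hΘ hΘs hF => ?_⟩
  set A := K * (‖toSobolev k f‖ * ‖toSobolev k g‖ * ‖toSobolev k h‖) with hA
  have hA0 : 0 ≤ A := by positivity
  -- Each derivative of order `j ≤ k - 1` is reduced to the ray by polar coordinates, where the
  -- majorant of the product bounds it.
  have hmain := sq_norm_toSobolev_le (k - 1) F (A := v * (C' * A) ^ 2) fun j hj => by
    have hjk : j + 1 ≤ k := by omega
    obtain ⟨-, M, hM, hle, hint⟩ := hC j hjk f g h Θ K hK hΘ hΘs
    rw [integral_sq_iteratedFDeriv_eq he]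
    refine mul_le_mul_of_nonneg_left ?_ hv0
    have h1 : rayInt R e j ((d : ℝ) - 1) (F : E d → ℝ) ≤ (C j * A) ^ 2 := by
      refine (setIntegral_mono_on (integrableOn_rayNorm hR he F j (by
        have : (5 : ℝ) ≤ d := by exact_mod_cast hd
        linarith)) hM measurableSet_Ioo fun r hr => ?_).trans hint
      have : rayNorm e j (F : E d → ℝ) r = rayNorm e j
          (fun x => (f : E d → ℝ) x * ((g : E d → ℝ) x * ((h : E d → ℝ) x * Θ x))) r := by
        unfold rayNorm
        rw [iteratedFDeriv_congr_Ball hF j (smul_mem_Ball he hr)]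
      rw [this]
      exact hle r hr
    refine h1.trans (pow_le_pow_left₀ (mul_nonneg (hC0 j) hA0) ?_ 2)
    exact mul_le_mul_of_nonneg_right
      (Finset.single_le_sum (fun j _ => hC0 j) (Finset.mem_range.2 hjk)) hA0
  have hsq : ‖toSobolev (k - 1) F‖ ^ 2 ≤ (√(N * v) * C' * A) ^ 2 := by
    have hs := Real.sq_sqrt (show 0 ≤ N * v by positivity)
    refine hmain.trans (le_of_eq ?_)
    calc N * (v * (C' * A) ^ 2) = (N * v) * (C' * A) ^ 2 := by ring
      _ = √(N * v) ^ 2 * (C' * A) ^ 2 := by rw [hs]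
      _ = (√(N * v) * C' * A) ^ 2 := by ring
  have := (sq_le_sq₀ (norm_nonneg _) (by positivity)).1 hsq
  calc ‖toSobolev (k - 1) F‖ ≤ √(N * v) * C' * A := this
    _ = _ := by rw [hA]; ring

end Trilinear

end BlowupStability

namespace BlowupStability

/-! ## Entire functions of the square -/

section Series

open Filter Topology FormalMultilinearSeries

/-- The coefficients `(-1)^n / (2n + j)!`. -/
noncomputable def evenCoeff (j n : ℕ) : ℝ := (-1) ^ n / (2 * n + j).factorial

/-- The entire function `v ↦ ∑ (-1)^n v^n / (2n + j)!`. -/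
noncomputable def evenSeries (j : ℕ) (v : ℝ) : ℝ := ∑' n, evenCoeff j n * v ^ n

theorem norm_evenCoeff (j n : ℕ) : ‖evenCoeff j n‖ = 1 / (2 * n + j).factorial := by
  simp [evenCoeff]

/-- Ratio test: consecutive coefficients have a quotient bounded by `1 / (n + 1)`. -/
theorem radius_evenCoeff (j : ℕ) : (ofScalars ℝ (evenCoeff j)).radius = ⊤ := by
  refine ofScalars_radius_eq_top_of_tendsto ℝ _ (Eventually.of_forall fun n => ?_) ?_
  · rw [← norm_ne_zero_iff, norm_evenCoeff]
    positivity
  · refine squeeze_zero (fun n => by positivity) (fun n => ?_) tendsto_one_div_add_atTop_nhds_zero_nat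
    rw [norm_evenCoeff, norm_evenCoeff]
    have h1 : (2 * n.succ + j).factorial = (2 * n + j + 2) * ((2 * n + j + 1) * (2 * n + j).factorial) := by
      rw [← Nat.factorial_succ, ← Nat.factorial_succ]
      congr 1
      omega
    have hf : (0 : ℝ) < (2 * n + j).factorial := by positivity
    rw [h1]
    push_cast
    rw [div_div_eq_mul_div, div_one, one_div, inv_mul_eq_div, div_le_div_iff₀ (by positivity) (by positivity)]
    have : (0 : ℝ) ≤ j := Nat.cast_nonneg _
    have : (0 : ℝ) ≤ n := Nat.cast_nonneg _
    have h2 : (n : ℝ) + 1 ≤ (2 * n + j + 2) * (2 * n + j + 1) := by nlinarith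
    nlinarith

theorem contDiff_evenSeries (j : ℕ) : ContDiff ℝ ∞ (evenSeries j) := by
  have h := (ofScalars ℝ (evenCoeff j)).hasFPowerSeriesOnBall (by rw [radius_evenCoeff]; exact ENNReal.zero_lt_top)
  have h2 := h.analyticOnNhd
  rw [radius_evenCoeff, Metric.eball_top] at h2
  have h3 : evenSeries j = (ofScalars ℝ (evenCoeff j)).sum := by
    change _ = ofScalarsSum (evenCoeff j)
    funext v
    rw [ofScalars_sum_eq]
    rfl
  rw [h3]
  exact h2.contDiff

theorem cos_eq_evenSeries (s : ℝ) : Real.cos s = evenSeries 0 (s ^ 2) := by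
  rw [evenSeries, ← (Real.hasSum_cos s).tsum_eq]
  refine tsum_congr fun n => ?_
  rw [evenCoeff, ← pow_mul, add_zero]
  ring

theorem sin_eq_evenSeries (s : ℝ) : Real.sin s = s * evenSeries 1 (s ^ 2) := by
  rw [evenSeries, ← (Real.hasSum_sin s).tsum_eq, ← tsum_mul_left]
  refine tsum_congr fun n => ?_
  rw [evenCoeff, ← pow_mul]
  ring

/-- Dropping the first term of the sine series leaves a cubic factor times a function of the square.
Functions of the square are what is needed, as `|x|²` is smooth at the origin while `|x|` is not. -/
theorem sub_sin_eq_evenSeries (s : ℝ) : s - Real.sin s = s ^ 3 * evenSeries 3 (s ^ 2) := by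
  have h := ((hasSum_nat_add_iff' 1).2 (Real.hasSum_sin s)).neg
  simp only [Finset.range_one, Finset.sum_singleton] at h
  have h2 := h.tsum_eq
  rw [evenSeries, ← tsum_mul_left]
  have h3 : -(Real.sin s - (-1) ^ 0 * s ^ (2 * 0 + 1) / ((2 * 0 + 1).factorial : ℝ)) =
      s - Real.sin s := by simp
  rw [← h3, ← h2]
  refine tsum_congr fun n => ?_
  rw [evenCoeff, ← pow_mul, show 2 * (n + 1) + 1 = 2 * n + 3 by ring]
  ring

theorem evenSeries_zero (j : ℕ) : evenSeries j 0 = 1 / j.factorial := by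
  rw [evenSeries, tsum_eq_single 0]
  · simp [evenCoeff]
  · intro n hn
    simp [hn]

/-- The coefficients `(-1)^n / (2n + 1)` of `arctan √v / √v`. -/
noncomputable def arctanCoeff (n : ℕ) : ℝ := (-1) ^ n / (2 * n + 1 : ℕ)

/-- The function `arctan √v / √v` near `v = 0`. -/
noncomputable def arctanSeries (v : ℝ) : ℝ := ∑' n, arctanCoeff n * v ^ n

/-- The coefficients are bounded by one in absolute value, so the radius of convergence is at least
one. -/
theorem contDiffAt_arctanSeries : ContDiffAt ℝ ∞ arctanSeries 0 := by
  have hr : (1 : NNReal) ≤ (ofScalars ℝ arctanCoeff).radius := by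
    refine le_radius_of_bound _ 1 fun n => ?_
    rw [ofScalars_norm, arctanCoeff, norm_div, norm_pow, norm_neg, norm_one, one_pow, NNReal.coe_one,
      one_pow, mul_one, Real.norm_natCast]
    exact (div_le_one (by positivity)).2 (by exact_mod_cast (by omega : 1 ≤ 2 * n + 1))
  have h := (ofScalars ℝ arctanCoeff).hasFPowerSeriesOnBall
    (lt_of_lt_of_le (by simp) hr)
  have h3 : arctanSeries = (ofScalars ℝ arctanCoeff).sum := by
    change _ = ofScalarsSum arctanCoeff
    funext v
    rw [ofScalars_sum_eq]
    rfl
  rw [h3]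
  exact h.analyticAt.contDiffAt

theorem arctan_eq_arctanSeries {s : ℝ} (hs : |s| < 1) :
    Real.arctan s = s * arctanSeries (s ^ 2) := by
  rw [arctanSeries, ← (Real.hasSum_arctan (x := s) hs).tsum_eq, ← tsum_mul_left]
  refine tsum_congr fun n => ?_
  rw [arctanCoeff, ← pow_mul]
  ring

theorem arctanSeries_zero : arctanSeries 0 = 1 := by
  rw [arctanSeries, tsum_eq_single 0]
  · simp [arctanCoeff]
  · intro n hn
    simp [hn]

end Series

/-! ## The coefficients -/

section Coefficients

variable {d : ℕ} {h : E d → ℝ}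

theorem inner_gradient_eq (h : E d → ℝ) (ξ v : E d) :
    inner ℝ v (gradient h ξ) = fderiv ℝ h ξ v := by
  rw [real_inner_comm, gradient, InnerProductSpace.toDual_symm_apply]

theorem norm_gradient_eq (h : E d → ℝ) (ξ : E d) : ‖gradient h ξ‖ = ‖fderiv ℝ h ξ‖ := by
  simp [gradient]

theorem sq_norm_gradient_eq (h : E d → ℝ) (ξ : E d) :
    ‖gradient h ξ‖ ^ 2 = ∑ i, partialDeriv i h ξ ^ 2 := by
  rw [EuclideanSpace.norm_sq_eq]
  refine Finset.sum_congr rfl fun i _ => ?_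
  have hi : inner ℝ (EuclideanSpace.single i 1) (gradient h ξ) = (gradient h ξ) i := by
    rw [EuclideanSpace.inner_single_left, map_one, one_mul]
  rw [partialDeriv, ← inner_gradient_eq, hi, Real.norm_eq_abs, sq_abs]

theorem contDiff_fderiv_apply (hh : ContDiff ℝ ∞ h) {v : E d → E d} (hv : ContDiff ℝ ∞ v) :
    ContDiff ℝ ∞ fun ξ => fderiv ℝ h ξ (v ξ) :=
  (hh.fderiv_right (m := ∞) (by simp)).clm_apply hv

theorem IsHeight.contDiff_coeff (hh : IsHeight h) :
    ContDiff ℝ ∞ fun ξ => coeffC h ξ / coeffW h ξ := by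
  have h1 : ContDiff ℝ ∞ (coeffC h) := by
    have : coeffC h = fun ξ => fderiv ℝ h ξ ξ - h ξ := by
      funext ξ; rw [coeffC, inner_gradient_eq]
    rw [this]
    exact (contDiff_fderiv_apply hh.smooth contDiff_id).sub hh.smooth
  have h2 : ContDiff ℝ ∞ (coeffW h) := by
    have : coeffW h = fun ξ => 1 - ∑ i, partialDeriv i h ξ ^ 2 := by
      funext ξ; rw [coeffW, sq_norm_gradient_eq]
    rw [this]
    exact contDiff_const.sub (ContDiff.sum fun i _ =>
      (contDiff_fderiv_apply hh.smooth contDiff_const).pow 2)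
  refine h1.div h2 fun ξ => ?_
  have := hh.gradient_lt ξ
  have h0 := norm_nonneg (gradient h ξ)
  unfold coeffW
  nlinarith

/-- The term `ξ · ∇h` is the derivative at `t = 1` of `h (t ξ)`, which depends on `|ξ|` only. -/
theorem IsHeight.coeff_radial (hh : IsHeight h) {x y : E d} (hxy : ‖x‖ = ‖y‖) :
    coeffC h x / coeffW h x = coeffC h y / coeffW h y := by
  have h1 : ∀ x : E d, fderiv ℝ h x x = deriv (fun t : ℝ => h (t • x)) 1 := by
    intro x
    have hd : HasFDerivAt h (fderiv ℝ h x) ((1 : ℝ) • x) := by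
      rw [one_smul]
      exact (hh.smooth.differentiable (by simp) x).hasFDerivAt
    have h2 : HasDerivAt (fun t : ℝ => t • x) x 1 := by
      simpa using (hasDerivAt_id (1 : ℝ)).smul_const x
    exact (hd.comp_hasDerivAt 1 h2).deriv.symm
  have hfun : (fun t : ℝ => h (t • x)) = fun t : ℝ => h (t • y) := by
    funext t
    exact hh.radial _ _ (by rw [norm_smul, norm_smul, hxy])
  have hn : ‖gradient h x‖ = ‖gradient h y‖ := by
    rw [norm_gradient_eq, norm_gradient_eq, ← norm_iteratedFDeriv_one, ← norm_iteratedFDeriv_one]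
    exact norm_iteratedFDeriv_eq_of_norm_eq hh.radial 1 hxy
  rw [coeffC, coeffC, coeffW, coeffW, hn, inner_gradient_eq, inner_gradient_eq, h1, h1, hfun,
    hh.radial x y hxy]

/-! ## The profile -/

theorem ymAlpha_pos {n : ℝ} (hn : 4 < n) : 0 < ymAlpha n := by
  have h1 : 0 < n - 2 := by linarith
  have h2 : 0 < n - 4 := by linarith
  have h3 : 0 < n - 1 := by linarith
  have h4 : 0 < n + 2 := by linarith
  unfold ymAlpha
  positivity

theorem ymBeta_pos {n : ℝ} (hn : 4 < n) : 0 < ymBeta n := by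
  have h3 : 0 < n - 1 := by linarith
  have h5 : √(3 * (n - 2) * (n - 4)) < 3 * (n - 2) := by
    rw [Real.sqrt_lt' (by linarith)]
    nlinarith
  unfold ymBeta
  have : 0 < 3 * (n - 2) - √(3 * (n - 2) * (n - 4)) := by linarith
  positivity

theorem profile_radial (m : Model) (hh : IsHeight h) {x y : E d} (hxy : ‖x‖ = ‖y‖) :
    profile m (-h x) x = profile m (-h y) y := by
  have h0 : x = 0 ↔ y = 0 := by rw [← norm_eq_zero, hxy, norm_eq_zero]
  cases m <;> simp only [profile, hxy, hh.radial x y hxy, h0]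

theorem contDiff_profile_yangMills (hd : 6 < d) (hh : IsHeight h) :
    ContDiff ℝ ∞ fun ξ => profile .yangMills (-h ξ) ξ := by
  have hd' : (4 : ℝ) < (d : ℝ) - 2 := by
    have : (6 : ℝ) < d := by exact_mod_cast hd
    linarith
  have ha := ymAlpha_pos hd'
  have hb := ymBeta_pos hd'
  simp only [profile]
  refine contDiff_const.div ((contDiff_const.mul (hh.smooth.neg.pow 2)).add
    (contDiff_const.mul (contDiff_norm_sq ℝ))) fun ξ => ?_
  by_cases hξ : ξ = 0
  · have := hh.neg_zero
    rw [hξ]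
    have h1 : 0 < (-h 0) ^ 2 := by nlinarith
    have : 0 < ymAlpha ((d : ℝ) - 2) * (-h 0) ^ 2 := mul_pos ha h1
    simp only [norm_zero]
    nlinarith
  · have h1 : 0 < ‖ξ‖ := norm_pos_iff.2 hξ
    have h2 : 0 < ymBeta ((d : ℝ) - 2) * ‖ξ‖ ^ 2 := by positivity
    have h3 : 0 ≤ ymAlpha ((d : ℝ) - 2) * (-h ξ) ^ 2 := by positivity
    linarith

/-- The denominator in the argument of the arctangent of the wave maps profile. -/
noncomputable def waveDenom (h : E d → ℝ) (ξ : E d) : ℝ :=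
  √((d : ℝ) - 4) * (-h ξ) + √(((d : ℝ) - 4) * (-h ξ) ^ 2 + ‖ξ‖ ^ 2)

theorem waveDenom_inner_pos (hd : 4 < d) (hh : IsHeight h) (ξ : E d) :
    0 < ((d : ℝ) - 4) * (-h ξ) ^ 2 + ‖ξ‖ ^ 2 := by
  have hd' : (0 : ℝ) < (d : ℝ) - 4 := by
    have : (4 : ℝ) < d := by exact_mod_cast hd
    linarith
  by_cases hξ : ξ = 0
  · have := hh.neg_zero
    rw [hξ]
    have h1 : 0 < (-h 0) ^ 2 := by nlinarith
    have : 0 < ((d : ℝ) - 4) * (-h 0) ^ 2 := mul_pos hd' h1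
    simp only [norm_zero]
    nlinarith
  · have h1 : 0 < ‖ξ‖ := norm_pos_iff.2 hξ
    positivity

/-- The height may become nonnegative away from the origin. There `|ξ|² > 0` makes the square root
strictly larger than `√(d - 4) h`; at the origin `h < 0` suffices. -/
theorem waveDenom_pos (hd : 4 < d) (hh : IsHeight h) (ξ : E d) : 0 < waveDenom h ξ := by
  have hd' : (0 : ℝ) < (d : ℝ) - 4 := by
    have : (4 : ℝ) < d := by exact_mod_cast hd
    linarith
  have hs : 0 < √((d : ℝ) - 4) := Real.sqrt_pos.2 hd'
  by_cases hξ : 0 < -h ξ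
  · exact add_pos_of_pos_of_nonneg (mul_pos hs hξ) (Real.sqrt_nonneg _)
  · have hξ0 : ξ ≠ 0 := by
      rintro rfl
      exact hξ (by have := hh.neg_zero; linarith)
    have h1 : 0 < ‖ξ‖ := norm_pos_iff.2 hξ0
    have h2 : √((d : ℝ) - 4) * h ξ < √(((d : ℝ) - 4) * (-h ξ) ^ 2 + ‖ξ‖ ^ 2) := by
      refine Real.lt_sqrt_of_sq_lt ?_
      rw [mul_pow, Real.sq_sqrt hd'.le]
      have : 0 < ‖ξ‖ ^ 2 := by positivity
      nlinarith
    unfold waveDenom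
    linarith

theorem contDiff_waveDenom (hd : 4 < d) (hh : IsHeight h) : ContDiff ℝ ∞ (waveDenom h) :=
  (contDiff_const.mul hh.smooth.neg).add (((contDiff_const.mul (hh.smooth.neg.pow 2)).add
    (contDiff_norm_sq ℝ)).sqrt fun ξ => (waveDenom_inner_pos hd hh ξ).ne')

/-- Away from the origin the norm is smooth. Near it, the quotient of `|y|` by the denominator is
below one, so the arctangent series turns the profile into a smooth function of `|y|²` and the
denominator. -/
theorem contDiff_profile_waveMaps (hd : 4 < d) (hh : IsHeight h) :
    ContDiff ℝ ∞ fun ξ => profile .waveMaps (-h ξ) ξ := by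
  have hd' : (0 : ℝ) < (d : ℝ) - 4 := by
    have : (4 : ℝ) < d := by exact_mod_cast hd
    linarith
  have hD := contDiff_waveDenom hd hh
  have hDpos := waveDenom_pos hd hh
  refine contDiff_iff_contDiffAt.2 fun x => ?_
  by_cases hx : x = 0
  · subst hx
    have hsmall : ∀ᶠ y in nhds (0 : E d), ‖y‖ / waveDenom h y < 1 := by
      have hc : Continuous fun y : E d => ‖y‖ / waveDenom h y :=
        continuous_norm.div hD.continuous fun y => (hDpos y).ne'
      exact hc.continuousAt.eventually_lt continuousAt_const (by simp)
    have heq : (fun ξ => profile .waveMaps (-h ξ) ξ) =ᶠ[nhds 0]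
        fun y => 4 / waveDenom h y * arctanSeries (‖y‖ ^ 2 / waveDenom h y ^ 2) := by
      filter_upwards [hsmall] with y hy
      by_cases hy0 : y = 0
      · subst hy0
        -- The condition `h 0 < 0` lets the square root be resolved as `√(d - 4) (-h 0)`, so the
        -- series agrees with the value prescribed at the origin.
        have h0 : waveDenom h (0 : E d) = 2 * (√((d : ℝ) - 4) * (-h 0)) := by
          have hneg : 0 ≤ -h 0 := by have := hh.neg_zero; linarith
          rw [waveDenom, norm_zero, zero_pow two_ne_zero, add_zero, Real.sqrt_mul hd'.le,
            Real.sqrt_sq hneg]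
          ring
        have hne := (hDpos (0 : E d)).ne'
        rw [h0] at hne ⊢
        simp only [profile, if_true, norm_zero, zero_pow two_ne_zero, zero_div, arctanSeries_zero,
          mul_one]
        have : √((d : ℝ) - 4) * (-h 0) ≠ 0 := right_ne_zero_of_mul hne
        field_simp
        norm_num
      · have hn : ‖y‖ ≠ 0 := norm_ne_zero_iff.2 hy0
        have hne := (hDpos y).ne'
        simp only [profile, if_neg hy0]
        change 4 / ‖y‖ * Real.arctan (‖y‖ / waveDenom h y) = _
        rw [arctan_eq_arctanSeries (by
          rwa [abs_of_nonneg (div_nonneg (norm_nonneg _) (hDpos y).le)]), div_pow]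
        field_simp
    refine ContDiffAt.congr_of_eventuallyEq ?_ heq
    have h1 : ContDiffAt ℝ ∞ (fun y : E d => ‖y‖ ^ 2 / waveDenom h y ^ 2) 0 :=
      (contDiff_norm_sq ℝ).contDiffAt.div (hD.contDiffAt.pow 2) (pow_ne_zero 2 (hDpos 0).ne')
    have h2 : ContDiffAt ℝ ∞ arctanSeries ((fun y : E d => ‖y‖ ^ 2 / waveDenom h y ^ 2) 0) := by
      simpa using contDiffAt_arctanSeries
    have h3 := h2.comp (0 : E d) h1
    exact (contDiffAt_const.div hD.contDiffAt (hDpos 0).ne').mul h3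
  · have hn : ‖x‖ ≠ 0 := norm_ne_zero_iff.2 hx
    have heq : (fun ξ => profile .waveMaps (-h ξ) ξ) =ᶠ[nhds x]
        fun y => 4 / ‖y‖ * Real.arctan (‖y‖ / waveDenom h y) := by
      filter_upwards [isOpen_ne.mem_nhds hx] with y hy
      simp only [profile, if_neg hy]
      rfl
    refine ContDiffAt.congr_of_eventuallyEq ?_ heq
    have hnorm : ContDiffAt ℝ ∞ (fun y : E d => ‖y‖) x := contDiffAt_norm ℝ hx
    exact (contDiffAt_const.div hnorm hn).mul (Real.contDiff_arctan.contDiffAt.comp x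
      (hnorm.div hD.contDiffAt (hDpos x).ne'))

end Coefficients

end BlowupStability

namespace BlowupStability

/-! ## The nonlinearity on smooth functions -/

section Nonlinearity

open Set

variable {d : ℕ} {R : ℝ}

/-- The product `f g h Θ` of three smooth radial functions and a coefficient. -/
noncomputable def tripleMul (f g h : SmoothRad d R) (Θ : E d → ℝ) (hΘ : BddSmooth R Θ)
    (hr : ∀ x y : E d, ‖x‖ = ‖y‖ → Θ x = Θ y) : SmoothRad d R :=
  ⟨_, (((SmoothRad.bddSmooth f).mul ((SmoothRad.bddSmooth g).mul
    ((SmoothRad.bddSmooth h).mul hΘ)))).indicator_mem_SmoothRad fun x y hxy => by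
      rw [SmoothRad.radial f hxy, SmoothRad.radial g hxy, SmoothRad.radial h hxy, hr x y hxy]⟩

theorem tripleMul_apply (f g h : SmoothRad d R) {Θ : E d → ℝ} (hΘ : BddSmooth R Θ)
    (hr : ∀ x y : E d, ‖x‖ = ‖y‖ → Θ x = Θ y) {x : E d} (hx : x ∈ Ball d R) :
    (tripleMul f g h Θ hΘ hr : E d → ℝ) x =
      (f : E d → ℝ) x * ((g : E d → ℝ) x * ((h : E d → ℝ) x * Θ x)) := if_pos hx

theorem SmoothRad.apply_of_notMem (f : SmoothRad d R) {x : E d} (hx : x ∉ Ball d R) :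
    (f : E d → ℝ) x = 0 := f.2.1 x hx

open Classical in
/-- The restriction of a smooth radial function to the ball, extended by zero. -/
noncomputable def restrictBall (R : ℝ) (f : E d → ℝ) (hf : ContDiff ℝ ∞ f)
    (hr : ∀ x y : E d, ‖x‖ = ‖y‖ → f x = f y) : SmoothRad d R :=
  ⟨fun x => if x ∈ Ball d R then f x else 0,
    (bddSmooth_of_contDiff hf).indicator_mem_SmoothRad hr⟩

theorem restrictBall_apply {f : E d → ℝ} (hf : ContDiff ℝ ∞ f)
    (hr : ∀ x y : E d, ‖x‖ = ‖y‖ → f x = f y) {x : E d} (hx : x ∈ Ball d R) :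
    (restrictBall R f hf hr : E d → ℝ) x = f x := if_pos hx

theorem secondComponent_of_mem (m : Model) (h f : E d → ℝ) {x : E d} (hx : x ∈ Ball d R) :
    secondComponent m h R f x = coeffC h x / coeffW h x * remainder m h f x := if_pos hx

theorem secondComponent_of_notMem (m : Model) (h f : E d → ℝ) {x : E d} (hx : x ∉ Ball d R) :
    secondComponent m h R f x = 0 := if_neg hx

/-- The local Lipschitz estimate for the nonlinearity on smooth functions. -/
def LipschitzOnBounded (m : Model) (h : E d → ℝ) (k : ℕ) (R : ℝ) : Prop :=
  ∀ M : ℝ, 0 ≤ M → ∃ C : ℝ, 0 ≤ C ∧ ∀ f g : SmoothRad d R,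
    ‖toSobolev k f‖ ≤ M → ‖toSobolev k g‖ ≤ M → ∃ F : SmoothRad d R,
      (∀ x, (F : E d → ℝ) x = secondComponent m h R f x - secondComponent m h R g x) ∧
      ‖toSobolev (k - 1) F‖ ≤
        C * (‖toSobolev k f‖ + ‖toSobolev k g‖) * ‖toSobolev k (f - g)‖

/-! ### Wave maps -/

theorem nonlinF'_waveMaps_zero (z : ℝ) :
    nonlinF' .waveMaps (0 : E d) z = 2 * ((d : ℝ) - 3) * z ^ 2 := by
  simp only [nonlinF', nonlinF, if_true]
  have h : HasDerivAt (fun y : ℝ => 2 / 3 * ((d : ℝ) - 3) * y ^ 3)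
      (2 / 3 * ((d : ℝ) - 3) * (3 * z ^ 2)) z := by
    simpa using (hasDerivAt_pow 3 z).const_mul (2 / 3 * ((d : ℝ) - 3))
  rw [h.deriv]
  ring

theorem nonlinF'_waveMaps {x : E d} (hx : x ≠ 0) (z : ℝ) :
    nonlinF' .waveMaps x z =
      -(((d : ℝ) - 3) / 2) * ((Real.cos (2 * ‖x‖ * z) * (2 * ‖x‖) - 2 * ‖x‖) / ‖x‖ ^ 3) := by
  simp only [nonlinF', nonlinF, if_neg hx]
  have h1 : HasDerivAt (fun y : ℝ => 2 * ‖x‖ * y) (2 * ‖x‖) z := by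
    simpa using (hasDerivAt_id z).const_mul (2 * ‖x‖)
  exact (((h1.sin.sub h1).div_const (‖x‖ ^ 3)).const_mul (-(((d : ℝ) - 3) / 2))).deriv

/-- With `A = r (2P + f + g)` and `B = r (f - g)`, the difference of the sines is `2 cos A sin B`,
and the left-hand side equals `c / r³` times `cos A (B - sin B) + B (cos (2rP) - cos A)`. The first
summand is cubic in `B`. The second is a product of two sines with `B`. Each thus supplies the
factor `r³`. -/
theorem waveMaps_difference_identity {r : ℝ} (hr : r ≠ 0) (c P f g : ℝ) :
    (-(c / 2) * ((Real.sin (2 * r * (P + f)) - 2 * r * (P + f)) / r ^ 3) -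
      -(c / 2) * ((Real.cos (2 * r * P) * (2 * r) - 2 * r) / r ^ 3) * f) -
    (-(c / 2) * ((Real.sin (2 * r * (P + g)) - 2 * r * (P + g)) / r ^ 3) -
      -(c / 2) * ((Real.cos (2 * r * P) * (2 * r) - 2 * r) / r ^ 3) * g) =
    c * ((f - g) ^ 3 * evenSeries 3 ((r * (f - g)) ^ 2) *
        evenSeries 0 ((r * (2 * P + (f + g))) ^ 2) +
      (f - g) * (f + g) * (2 * P + 1 / 2 * (f + g)) *
        evenSeries 1 ((r * (1 / 2 * (f + g))) ^ 2) *
        evenSeries 1 ((r * (2 * P + 1 / 2 * (f + g))) ^ 2)) := by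
  have h3 := sub_sin_eq_evenSeries (r * (f - g))
  have h0 := cos_eq_evenSeries (r * (2 * P + (f + g)))
  have ha := sin_eq_evenSeries (r * (1 / 2 * (f + g)))
  have hb := sin_eq_evenSeries (r * (2 * P + 1 / 2 * (f + g)))
  have hA : Real.sin (2 * r * (P + f)) = Real.sin (r * (2 * P + (f + g)) + r * (f - g)) := by
    ring_nf
  have hB : Real.sin (2 * r * (P + g)) = Real.sin (r * (2 * P + (f + g)) - r * (f - g)) := by
    ring_nf
  have hC : Real.cos (2 * r * P) =
      Real.cos (r * (2 * P + 1 / 2 * (f + g)) - r * (1 / 2 * (f + g))) := by ring_nf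
  have hD : Real.cos (r * (2 * P + (f + g))) =
      Real.cos (r * (2 * P + 1 / 2 * (f + g)) + r * (1 / 2 * (f + g))) := by ring_nf
  have key : r ^ 3 * ((f - g) ^ 3 * evenSeries 3 ((r * (f - g)) ^ 2) *
        evenSeries 0 ((r * (2 * P + (f + g))) ^ 2) +
      (f - g) * (f + g) * (2 * P + 1 / 2 * (f + g)) *
        evenSeries 1 ((r * (1 / 2 * (f + g))) ^ 2) *
        evenSeries 1 ((r * (2 * P + 1 / 2 * (f + g))) ^ 2)) =
      r * (f - g) * Real.cos (2 * r * P) -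
        Real.cos (r * (2 * P + (f + g))) * Real.sin (r * (f - g)) := by
    have e1 : Real.cos (2 * r * P) - Real.cos (r * (2 * P + (f + g))) =
        2 * (Real.sin (r * (2 * P + 1 / 2 * (f + g))) * Real.sin (r * (1 / 2 * (f + g)))) := by
      rw [hC, hD, Real.cos_sub, Real.cos_add]; ring
    rw [ha, hb] at e1
    rw [← h0]
    linear_combination (-Real.cos (r * (2 * P + (f + g)))) * h3 - (r * (f - g)) * e1
  have hr3 : r ^ 3 ≠ 0 := pow_ne_zero 3 hr
  refine mul_left_cancel₀ hr3 ?_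
  rw [mul_left_comm (r ^ 3) c, key, hA, hB, Real.sin_add, Real.sin_sub]
  field_simp
  ring

/-- At the origin the values `1/6`, `1`, `1` of the even series at zero reproduce the cubic limit of
the nonlinearity. -/
theorem remainder_waveMaps_sub (h : E d → ℝ) (f g : E d → ℝ) (x : E d) (P : ℝ)
    (hP : profile .waveMaps (-h x) x = P) :
    remainder .waveMaps h f x - remainder .waveMaps h g x =
      ((d : ℝ) - 3) * ((f x - g x) ^ 3 * evenSeries 3 ((‖x‖ * (f x - g x)) ^ 2) *
        evenSeries 0 ((‖x‖ * (2 * P + (f x + g x))) ^ 2) +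
      (f x - g x) * (f x + g x) * (2 * P + 1 / 2 * (f x + g x)) *
        evenSeries 1 ((‖x‖ * (1 / 2 * (f x + g x))) ^ 2) *
        evenSeries 1 ((‖x‖ * (2 * P + 1 / 2 * (f x + g x))) ^ 2)) := by
  by_cases hx : x = 0
  · subst hx
    simp only [remainder, hP, nonlinF'_waveMaps_zero, nonlinF, if_true, norm_zero, zero_mul,
      zero_pow two_ne_zero, evenSeries_zero]
    norm_num [Nat.factorial]
    ring
  · rw [← waveMaps_difference_identity (norm_ne_zero_iff.2 hx)]
    simp only [remainder, hP, nonlinF'_waveMaps hx, nonlinF, if_neg hx]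
    ring

/-- The smooth function `evenSeries j (|y|²)`. -/
noncomputable def evenRadial (j : ℕ) (y : E d) : ℝ := evenSeries j (‖y‖ ^ 2)

theorem contDiff_evenRadial (j : ℕ) : ContDiff ℝ ∞ (evenRadial (d := d) j) :=
  (contDiff_evenSeries j).comp (contDiff_norm_sq ℝ)

theorem evenRadial_smul (j : ℕ) (a : ℝ) (x : E d) :
    evenRadial j (a • x) = evenSeries j ((‖x‖ * a) ^ 2) := by
  rw [evenRadial, norm_smul, Real.norm_eq_abs, mul_pow, sq_abs, mul_pow, mul_comm]

theorem bddSmooth_comp_smul {Φ : E d → ℝ} (hΦ : ContDiff ℝ ∞ Φ) (z : SmoothRad d R) :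
    BddSmooth R fun x => Φ ((z : E d → ℝ) x • x) :=
  BddSmooth.comp hΦ ((SmoothRad.bddSmooth z).smul (bddSmooth_of_contDiff contDiff_id))

theorem evenRadial_smul_radial (j : ℕ) (z : SmoothRad d R) {x y : E d} (hxy : ‖x‖ = ‖y‖) :
    evenRadial j ((z : E d → ℝ) x • x) = evenRadial j ((z : E d → ℝ) y • y) := by
  rw [evenRadial_smul, evenRadial_smul, hxy, SmoothRad.radial z hxy]

theorem norm_toSobolev_add_le (k : ℕ) (f g : SmoothRad d R) :
    ‖toSobolev k (f + g)‖ ≤ ‖toSobolev k f‖ + ‖toSobolev k g‖ :=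
  norm_add_le (toSobolev k f) (toSobolev k g)

theorem norm_toSobolev_sub_le (k : ℕ) (f g : SmoothRad d R) :
    ‖toSobolev k (f - g)‖ ≤ ‖toSobolev k f‖ + ‖toSobolev k g‖ :=
  norm_sub_le (toSobolev k f) (toSobolev k g)

theorem norm_toSobolev_smul (k : ℕ) (a : ℝ) (f : SmoothRad d R) :
    ‖toSobolev k (a • f)‖ = |a| * ‖toSobolev k f‖ :=
  norm_smul a (toSobolev k f)

theorem exists_weightBdd_evenRadial_mul (hR : 0 < R) (hd : 0 < d) {k : ℕ} (hk : d ≤ 2 * k + 1)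
    (hk1 : 1 ≤ k) {χ : E d → ℝ} (hχ : ContDiff ℝ ∞ χ) (i j : ℕ) {M : ℝ} (hM : 0 ≤ M) :
    ∃ K : ℝ, 0 ≤ K ∧ ∀ y z : SmoothRad d R, ‖toSobolev k y‖ ≤ M → ‖toSobolev k z‖ ≤ M →
      WeightBdd R k K fun x => χ x * (evenRadial i ((y : E d → ℝ) x • x) *
        evenRadial j ((z : E d → ℝ) x • x)) := by
  obtain ⟨K0, hK0, h0⟩ := (bddSmooth_of_contDiff (R := R) hχ).exists_weightBdd k
  obtain ⟨K1, hK1, h1⟩ := exists_weightBdd_comp hR hd hk hk1 (contDiff_evenRadial i) hM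
  obtain ⟨K2, hK2, h2⟩ := exists_weightBdd_comp hR hd hk hk1 (contDiff_evenRadial j) hM
  refine ⟨_, ?_, fun y z hy hz => h0.mul hk hK0 ((h1 y hy).mul hk hK1 (h2 z hz)
    (bddSmooth_comp_smul (contDiff_evenRadial i) y).1
    (bddSmooth_comp_smul (contDiff_evenRadial j) z).1 hK2) hχ.contDiffOn
    ((bddSmooth_comp_smul (contDiff_evenRadial i) y).mul
      (bddSmooth_comp_smul (contDiff_evenRadial j) z)).1 (by positivity)⟩
  positivity

theorem lipschitzOnBounded_waveMaps (hR : 0 < R) (hd : 5 ≤ d) {k : ℕ} (hk : d ≤ 2 * k + 1)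
    {h : E d → ℝ} (hh : IsHeight h) : LipschitzOnBounded .waveMaps h k R := by
  intro M hM
  have hψs := contDiff_profile_waveMaps (by omega) hh
  set ψ : SmoothRad d R := restrictBall R (fun ξ => profile .waveMaps (-h ξ) ξ) hψs
    (fun x y hxy => profile_radial _ hh hxy) with hψ
  set χ : E d → ℝ := fun x => ((d : ℝ) - 3) * (coeffC h x / coeffW h x) with hχ
  have hχs : ContDiff ℝ ∞ χ := contDiff_const.mul hh.contDiff_coeff
  have hχr : ∀ x y : E d, ‖x‖ = ‖y‖ → χ x = χ y := fun x y hxy => by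
    simp only [hχ, hh.coeff_radial hxy]
  -- A common bound for the norms of `p`, `q`, `a` and `b`; the profile, restricted to the ball, is
  -- itself treated as an element of the space.
  set M' := 2 * ‖toSobolev k ψ‖ + 2 * M with hM'
  have hM'0 : 0 ≤ M' := by positivity
  obtain ⟨K1, hK1, h1⟩ := exists_weightBdd_evenRadial_mul (d := d) hR (by omega) hk (by omega) hχs
    3 0 hM'0
  obtain ⟨K2, hK2, h2⟩ := exists_weightBdd_evenRadial_mul (d := d) hR (by omega) hk (by omega) hχs
    1 1 hM'0
  obtain ⟨C, hC0, hC⟩ := exists_norm_toSobolev_mul_le (d := d) hR hd hk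
  refine ⟨C * K1 * M' + C * K2 * M', by positivity, fun f g hf hg => ?_⟩
  set p := f - g with hp
  set s := f + g with hs
  set a := (1 / 2 : ℝ) • s with ha
  set b := (2 : ℝ) • ψ + a with hb
  set q := (2 : ℝ) • ψ + s with hq
  have nψ := norm_nonneg (toSobolev k ψ)
  have np0 := norm_nonneg (toSobolev k p)
  have np := norm_toSobolev_sub_le k f g
  have ns : ‖toSobolev k s‖ ≤ ‖toSobolev k f‖ + ‖toSobolev k g‖ := norm_toSobolev_add_le k f g
  have na : ‖toSobolev k a‖ = 1 / 2 * ‖toSobolev k s‖ := by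
    rw [ha, norm_toSobolev_smul]; norm_num
  have n2 : ‖toSobolev k ((2 : ℝ) • ψ)‖ = 2 * ‖toSobolev k ψ‖ := by
    rw [norm_toSobolev_smul]; norm_num
  have nb : ‖toSobolev k b‖ ≤ 2 * ‖toSobolev k ψ‖ + ‖toSobolev k a‖ :=
    n2 ▸ norm_toSobolev_add_le k _ _
  have nq : ‖toSobolev k q‖ ≤ 2 * ‖toSobolev k ψ‖ + ‖toSobolev k s‖ :=
    n2 ▸ norm_toSobolev_add_le k _ _
  have bdd := fun (i : ℕ) (z : SmoothRad d R) => bddSmooth_comp_smul (contDiff_evenRadial i) z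
  have hΘ1 : BddSmooth R fun x => χ x * (evenRadial 3 ((p : E d → ℝ) x • x) *
      evenRadial 0 ((q : E d → ℝ) x • x)) :=
    (bddSmooth_of_contDiff hχs).mul ((bdd 3 p).mul (bdd 0 q))
  have hΘ2 : BddSmooth R fun x => χ x * (evenRadial 1 ((a : E d → ℝ) x • x) *
      evenRadial 1 ((b : E d → ℝ) x • x)) :=
    (bddSmooth_of_contDiff hχs).mul ((bdd 1 a).mul (bdd 1 b))
  set F1 := tripleMul p p p _ hΘ1 (fun x y hxy => by
    rw [hχr x y hxy, evenRadial_smul_radial 3 p hxy, evenRadial_smul_radial 0 q hxy]) with hF1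
  set F2 := tripleMul p s b _ hΘ2 (fun x y hxy => by
    rw [hχr x y hxy, evenRadial_smul_radial 1 a hxy, evenRadial_smul_radial 1 b hxy]) with hF2
  refine ⟨F1 + F2, fun x => ?_, ?_⟩
  · by_cases hx : x ∈ Ball d R
    · rw [secondComponent_of_mem _ _ _ hx, secondComponent_of_mem _ _ _ hx, ← mul_sub,
        remainder_waveMaps_sub h _ _ x ((ψ : E d → ℝ) x) (restrictBall_apply hψs _ hx).symm]
      change (F1 : E d → ℝ) x + (F2 : E d → ℝ) x = _
      rw [hF1, hF2, tripleMul_apply _ _ _ _ _ hx, tripleMul_apply _ _ _ _ _ hx]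
      simp only [evenRadial_smul, hχ]
      change ((f : E d → ℝ) x - (g : E d → ℝ) x) * (((f : E d → ℝ) x - (g : E d → ℝ) x) *
        (((f : E d → ℝ) x - (g : E d → ℝ) x) * (((d : ℝ) - 3) * (coeffC h x / coeffW h x) *
        (evenSeries 3 ((‖x‖ * ((f : E d → ℝ) x - (g : E d → ℝ) x)) ^ 2) * evenSeries 0
          ((‖x‖ * (2 * (ψ : E d → ℝ) x + ((f : E d → ℝ) x + (g : E d → ℝ) x))) ^ 2))))) +
        ((f : E d → ℝ) x - (g : E d → ℝ) x) * (((f : E d → ℝ) x + (g : E d → ℝ) x) *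
        ((2 * (ψ : E d → ℝ) x + 1 / 2 * ((f : E d → ℝ) x + (g : E d → ℝ) x)) *
        (((d : ℝ) - 3) * (coeffC h x / coeffW h x) *
        (evenSeries 1 ((‖x‖ * (1 / 2 * ((f : E d → ℝ) x + (g : E d → ℝ) x))) ^ 2) * evenSeries 1
          ((‖x‖ * (2 * (ψ : E d → ℝ) x + 1 / 2 * ((f : E d → ℝ) x + (g : E d → ℝ) x))) ^ 2))))) = _
      ring
    · rw [secondComponent_of_notMem _ _ _ hx, secondComponent_of_notMem _ _ _ hx, sub_zero]
      exact SmoothRad.apply_of_notMem _ hx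
  · have t1 := hC p p p F1 _ K1 hK1 (h1 p q (by linarith) (by linarith)) hΘ1.1
      (fun x hx => tripleMul_apply _ _ _ _ _ hx)
    have t2 := hC p s b F2 _ K2 hK2 (h2 a b (by linarith) (by linarith)) hΘ2.1
      (fun x hx => tripleMul_apply _ _ _ _ _ hx)
    set S := ‖toSobolev k f‖ + ‖toSobolev k g‖ with hS
    have hpM : ‖toSobolev k p‖ ≤ M' := by linarith
    have hbM : ‖toSobolev k b‖ ≤ M' := by linarith
    have hS0 : 0 ≤ S := by positivity
    -- Of the three factors `p`, one is kept, one is bounded by the sum of the norms of `f` and `g`,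
    -- and one by `M'`.
    have u1 : ‖toSobolev k p‖ * ‖toSobolev k p‖ * ‖toSobolev k p‖ ≤ ‖toSobolev k p‖ * S * M' := by
      gcongr
    have u2 : ‖toSobolev k p‖ * ‖toSobolev k s‖ * ‖toSobolev k b‖ ≤ ‖toSobolev k p‖ * S * M' := by
      gcongr
    calc ‖toSobolev (k - 1) (F1 + F2)‖ ≤ ‖toSobolev (k - 1) F1‖ + ‖toSobolev (k - 1) F2‖ :=
          norm_toSobolev_add_le _ _ _
      _ ≤ C * K1 * (‖toSobolev k p‖ * S * M') + C * K2 * (‖toSobolev k p‖ * S * M') :=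
          add_le_add (t1.trans (mul_le_mul_of_nonneg_left u1 (by positivity)))
            (t2.trans (mul_le_mul_of_nonneg_left u2 (by positivity)))
      _ = _ := by ring

/-! ### Yang-Mills -/

theorem remainder_yangMills_sub (h : E d → ℝ) (f g : E d → ℝ) (x : E d) (P : ℝ)
    (hP : profile .yangMills (-h x) x = P) :
    remainder .yangMills h f x - remainder .yangMills h g x =
      ((d : ℝ) - 4) * (f x - g x) * (3 * (f x + g x) -
        ‖x‖ ^ 2 * (3 * P * (f x + g x) + (f x + g x) * f x + g x * g x)) := by
  have hder : nonlinF' .yangMills x P = ((d : ℝ) - 4) * (3 * (2 * P) - ‖x‖ ^ 2 * (3 * P ^ 2)) := by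
    simp only [nonlinF', nonlinF]
    have h2 : HasDerivAt (fun y : ℝ => y ^ 2) (2 * P) P := by simpa using hasDerivAt_pow 2 P
    have h3 : HasDerivAt (fun y : ℝ => y ^ 3) (3 * P ^ 2) P := by simpa using hasDerivAt_pow 3 P
    exact (((h2.const_mul 3).sub (h3.const_mul (‖x‖ ^ 2))).const_mul ((d : ℝ) - 4)).deriv
  simp only [remainder, hP, hder, nonlinF]
  ring

theorem lipschitzOnBounded_yangMills (hR : 0 < R) (hd : 7 ≤ d) {k : ℕ} (hk : d ≤ 2 * k + 1)
    {h : E d → ℝ} (hh : IsHeight h) : LipschitzOnBounded .yangMills h k R := by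
  intro M hM
  have hψs := contDiff_profile_yangMills (by omega) hh
  set χ : E d → ℝ := fun x => ((d : ℝ) - 4) * (coeffC h x / coeffW h x) with hχ
  have hχs : ContDiff ℝ ∞ χ := contDiff_const.mul hh.contDiff_coeff
  have hχr : ∀ x y : E d, ‖x‖ = ‖y‖ → χ x = χ y := fun x y hxy => by
    simp only [hχ, hh.coeff_radial hxy]
  set Θ1 : E d → ℝ := fun x =>
    χ x * (3 - 3 * (‖x‖ ^ 2 * profile .yangMills (-h x) x)) with hΘ1
  set Θ2 : E d → ℝ := fun x => χ x * (-‖x‖ ^ 2) with hΘ2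
  have hΘ1s : BddSmooth R Θ1 := bddSmooth_of_contDiff
    (hχs.mul (contDiff_const.sub (contDiff_const.mul ((contDiff_norm_sq ℝ).mul hψs))))
  have hΘ2s : BddSmooth R Θ2 := bddSmooth_of_contDiff (hχs.mul (contDiff_norm_sq ℝ).neg)
  have hΘ1r : ∀ x y : E d, ‖x‖ = ‖y‖ → Θ1 x = Θ1 y := fun x y hxy => by
    simp only [hΘ1, hχr x y hxy, profile_radial _ hh hxy, hxy]
  have hΘ2r : ∀ x y : E d, ‖x‖ = ‖y‖ → Θ2 x = Θ2 y := fun x y hxy => by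
    simp only [hΘ2, hχr x y hxy, hxy]
  -- The quadratic term has only two small factors; the constant function serves as the third so
  -- that the trilinear estimate applies.
  set one : SmoothRad d R := restrictBall R (fun _ => 1) contDiff_const (fun _ _ _ => rfl)
  obtain ⟨K1, hK1, h1⟩ := hΘ1s.exists_weightBdd k
  obtain ⟨K2, hK2, h2⟩ := hΘ2s.exists_weightBdd k
  obtain ⟨C, hC0, hC⟩ := exists_norm_toSobolev_mul_le (d := d) hR (by omega : 5 ≤ d) hk
  refine ⟨C * K1 * ‖toSobolev k one‖ + C * K2 * M + C * K2 * M, by positivity,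
    fun f g hf hg => ?_⟩
  set p := f - g with hp
  set s := f + g with hs
  set F1 := tripleMul p s one Θ1 hΘ1s hΘ1r with hF1
  set F2 := tripleMul p s f Θ2 hΘ2s hΘ2r with hF2
  set F3 := tripleMul p g g Θ2 hΘ2s hΘ2r with hF3
  refine ⟨F1 + F2 + F3, fun x => ?_, ?_⟩
  · by_cases hx : x ∈ Ball d R
    · rw [secondComponent_of_mem _ _ _ hx, secondComponent_of_mem _ _ _ hx, ← mul_sub,
        remainder_yangMills_sub h _ _ x _ rfl]
      change (F1 : E d → ℝ) x + (F2 : E d → ℝ) x + (F3 : E d → ℝ) x = _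
      rw [hF1, hF2, hF3, tripleMul_apply _ _ _ _ _ hx, tripleMul_apply _ _ _ _ _ hx,
        tripleMul_apply _ _ _ _ _ hx, restrictBall_apply _ _ hx]
      simp only [hΘ1, hΘ2, hχ]
      change ((f : E d → ℝ) x - (g : E d → ℝ) x) * (((f : E d → ℝ) x + (g : E d → ℝ) x) * _) +
        ((f : E d → ℝ) x - (g : E d → ℝ) x) * (((f : E d → ℝ) x + (g : E d → ℝ) x) * _) +
        ((f : E d → ℝ) x - (g : E d → ℝ) x) * _ = _
      ring
    · rw [secondComponent_of_notMem _ _ _ hx, secondComponent_of_notMem _ _ _ hx, sub_zero]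
      exact SmoothRad.apply_of_notMem _ hx
  · have t1 := hC p s one F1 _ K1 hK1 h1 hΘ1s.1 (fun x hx => tripleMul_apply _ _ _ _ _ hx)
    have t2 := hC p s f F2 _ K2 hK2 h2 hΘ2s.1 (fun x hx => tripleMul_apply _ _ _ _ _ hx)
    have t3 := hC p g g F3 _ K2 hK2 h2 hΘ2s.1 (fun x hx => tripleMul_apply _ _ _ _ _ hx)
    have ns : ‖toSobolev k s‖ ≤ ‖toSobolev k f‖ + ‖toSobolev k g‖ := norm_toSobolev_add_le k f g
    set S := ‖toSobolev k f‖ + ‖toSobolev k g‖ with hS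
    have hS0 : 0 ≤ S := by positivity
    have hgS : ‖toSobolev k g‖ ≤ S := le_add_of_nonneg_left (norm_nonneg _)
    have u1 : ‖toSobolev k p‖ * ‖toSobolev k s‖ * ‖toSobolev k one‖ ≤
      ‖toSobolev k p‖ * S * ‖toSobolev k one‖ := by gcongr
    have u2 : ‖toSobolev k p‖ * ‖toSobolev k s‖ * ‖toSobolev k f‖ ≤
      ‖toSobolev k p‖ * S * M := by gcongr
    have u3 : ‖toSobolev k p‖ * ‖toSobolev k g‖ * ‖toSobolev k g‖ ≤
      ‖toSobolev k p‖ * S * M := by gcongr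
    calc ‖toSobolev (k - 1) (F1 + F2 + F3)‖
        ≤ ‖toSobolev (k - 1) F1‖ + ‖toSobolev (k - 1) F2‖ + ‖toSobolev (k - 1) F3‖ :=
          (norm_toSobolev_add_le _ _ _).trans
            (add_le_add_left (norm_toSobolev_add_le _ _ _) _)
      _ ≤ C * K1 * (‖toSobolev k p‖ * S * ‖toSobolev k one‖) +
          C * K2 * (‖toSobolev k p‖ * S * M) + C * K2 * (‖toSobolev k p‖ * S * M) :=
          add_le_add (add_le_add (t1.trans (mul_le_mul_of_nonneg_left u1 (by positivity)))
            (t2.trans (mul_le_mul_of_nonneg_left u2 (by positivity))))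
            (t3.trans (mul_le_mul_of_nonneg_left u3 (by positivity)))
      _ = _ := by ring

end Nonlinearity

end BlowupStability

namespace BlowupStability

/-! ## Extension to the completion -/

section Extension

open Filter Topology UniformSpace

/-- The estimate `‖T f - T g‖ ≤ C (‖f‖ + ‖g‖) ‖f - g‖` on bounded sets. -/
def QuadLipschitz {X Z : Type*} [SeminormedAddCommGroup X] [SeminormedAddCommGroup Z]
    (T : X → Z) : Prop :=
  ∀ M : ℝ, 0 < M → ∃ C : ℝ, 0 < C ∧ ∀ f g : X, ‖f‖ ≤ M → ‖g‖ ≤ M →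
    ‖T f - T g‖ ≤ C * (‖f‖ + ‖g‖) * ‖f - g‖

variable {X Z : Type*} [SeminormedAddCommGroup X] [NormedAddCommGroup Z]

theorem QuadLipschitz.continuous {T : X → Z} (hT : QuadLipschitz T) : Continuous T := by
  refine continuous_iff_continuousAt.2 fun f => tendsto_iff_norm_sub_tendsto_zero.2 ?_
  obtain ⟨C, -, hC⟩ := hT (‖f‖ + 1) (by positivity)
  have hlim : Tendsto (fun g => C * (‖g‖ + ‖f‖) * ‖g - f‖) (𝓝 f) (𝓝 0) := by
    have : Continuous fun g => C * (‖g‖ + ‖f‖) * ‖g - f‖ := by fun_prop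
    simpa using this.tendsto f
  refine squeeze_zero' (Eventually.of_forall fun _ => norm_nonneg _) ?_ hlim
  have hev : ∀ᶠ g in 𝓝 f, ‖g‖ < ‖f‖ + 1 :=
    continuous_norm.continuousAt.eventually_lt continuousAt_const (by simp)
  filter_upwards [hev] with g hg
  exact hC g f hg.le (by linarith)

/-- The map need not be uniformly continuous on the whole space, but near each point of the
completion the norms are bounded, so its values along the trace of the neighbourhood filter are
Cauchy. The estimate passes to the extension by continuity. -/
theorem QuadLipschitz.exists_extension [CompleteSpace Z] {T : X → Z} (hT : QuadLipschitz T) :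
    ∃ T' : Completion X → Z, (∀ f : X, T' f = T f) ∧ QuadLipschitz T' := by
  have di : IsDenseInducing ((↑) : X → Completion X) := Completion.isDenseInducing_coe
  have hcoe : ∀ b : Completion X, Tendsto ((↑) : X → Completion X) (comap (↑) (𝓝 b)) (𝓝 b) :=
    fun b => tendsto_comap
  have hbdd : ∀ (b : Completion X) (M : ℝ), ‖b‖ < M →
      ∀ᶠ f in comap ((↑) : X → Completion X) (𝓝 b), ‖f‖ ≤ M := by
    intro b M hM
    filter_upwards [(hcoe b).norm.eventually_lt_const hM] with f hf
    rw [Completion.norm_coe] at hf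
    exact hf.le
  have hlim : ∀ b : Completion X, ∃ c, Tendsto T (comap (↑) (𝓝 b)) (𝓝 c) := by
    intro b
    have := di.comap_nhds_neBot b
    refine cauchy_map_iff_exists_tendsto.1 (cauchy_map_iff'.2
      (tendsto_uniformity_iff_dist_tendsto_zero.2 ?_))
    obtain ⟨C, -, hC⟩ := hT (‖b‖ + 1) (by positivity)
    have h1 : Tendsto (fun p : X × X => (p.1 : Completion X))
        (comap (↑) (𝓝 b) ×ˢ comap (↑) (𝓝 b)) (𝓝 b) := (hcoe b).comp tendsto_fst
    have h2 : Tendsto (fun p : X × X => (p.2 : Completion X))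
        (comap (↑) (𝓝 b) ×ˢ comap (↑) (𝓝 b)) (𝓝 b) := (hcoe b).comp tendsto_snd
    have h3 : Tendsto (fun p : X × X => C * (‖(p.1 : Completion X)‖ + ‖(p.2 : Completion X)‖) *
        ‖(p.1 : Completion X) - p.2‖) (comap (↑) (𝓝 b) ×ˢ comap (↑) (𝓝 b)) (𝓝 0) := by
      simpa using ((h1.norm.add h2.norm).const_mul C).mul (h1.sub h2).norm
    refine squeeze_zero' (Eventually.of_forall fun _ => dist_nonneg) ?_ h3
    filter_upwards [tendsto_fst.eventually (hbdd b (‖b‖ + 1) (by linarith)),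
      tendsto_snd.eventually (hbdd b (‖b‖ + 1) (by linarith))] with p hp1 hp2
    rw [dist_eq_norm, ← Completion.coe_sub, Completion.norm_coe, Completion.norm_coe,
      Completion.norm_coe]
    exact hC p.1 p.2 hp1 hp2
  have hext : ∀ f : X, di.extend T f = T f := fun f => di.extend_eq' hlim f
  have hcont : Continuous (di.extend T) := di.continuous_extend hlim
  refine ⟨di.extend T, hext, fun M hM => ?_⟩
  -- Approximants of points of norm at most `M` may have slightly larger norm, hence the radius `M +
  -- 1`.
  obtain ⟨C, hC0, hC⟩ := hT (M + 1) (by linarith)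
  refine ⟨C, hC0, fun f g hf hg => ?_⟩
  have hf' := di.comap_nhds_neBot f
  have hg' := di.comap_nhds_neBot g
  have h1 : Tendsto (fun p : X × X => (p.1 : Completion X))
      (comap (↑) (𝓝 f) ×ˢ comap (↑) (𝓝 g)) (𝓝 f) := (hcoe f).comp tendsto_fst
  have h2 : Tendsto (fun p : X × X => (p.2 : Completion X))
      (comap (↑) (𝓝 f) ×ˢ comap (↑) (𝓝 g)) (𝓝 g) := (hcoe g).comp tendsto_snd
  have hL := (((hcont.tendsto f).comp h1).sub ((hcont.tendsto g).comp h2)).norm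
  have hR := ((h1.norm.add h2.norm).const_mul C).mul (h1.sub h2).norm
  refine le_of_tendsto_of_tendsto hL hR ?_
  filter_upwards [tendsto_fst.eventually (hbdd f (M + 1) (by linarith)),
    tendsto_snd.eventually (hbdd g (M + 1) (by linarith))] with p hp1 hp2
  simp only [Function.comp_apply, hext]
  rw [← Completion.coe_sub, Completion.norm_coe, Completion.norm_coe, Completion.norm_coe]
  exact hC p.1 p.2 hp1 hp2

end Extension

/-! ### Existence and uniqueness of the extended nonlinearity -/

section Main

open UniformSpace

variable {d : ℕ} {R : ℝ}

theorem secondComponent_zero (m : Model) (h : E d → ℝ) :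
    secondComponent m h R (0 : E d → ℝ) = 0 := by
  funext x
  simp [secondComponent, remainder]

/-- The Lipschitz estimate supplies a smooth radial representative of each difference; comparing
with `g = 0`, where the nonlinearity vanishes, gives membership. -/
theorem LipschitzOnBounded.secondComponent_mem {m : Model} {h : E d → ℝ} {k : ℕ}
    (hL : LipschitzOnBounded m h k R) (f : SmoothRad d R) :
    secondComponent m h R f ∈ SmoothRad d R := by
  obtain ⟨C, -, hC⟩ := hL ‖toSobolev k f‖ (norm_nonneg _)
  obtain ⟨F, hF, -⟩ := hC f 0 le_rfl
    ((norm_zero (E := SobolevSmoothRad d k R)).trans_le (norm_nonneg _))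
  have hfun : secondComponent m h R f = (F : E d → ℝ) := by
    funext x
    rw [hF x]
    change _ = _ - secondComponent m h R (0 : E d → ℝ) x
    rw [secondComponent_zero, Pi.zero_apply, sub_zero]
  rw [hfun]
  exact F.2

theorem denseRange_incl (k : ℕ) :
    DenseRange fun p : SmoothRad d R × SmoothRad d R => incl k p.1 p.2 := by
  have h1 : DenseRange ((↑) : SobolevSmoothRad d k R → HRad d k R) := Completion.denseRange_coe
  have h2 : DenseRange ((↑) : SobolevSmoothRad d (k - 1) R → HRad d (k - 1) R) :=
    Completion.denseRange_coe
  have h3 : DenseRange (WithLp.toLp 2 : HRad d k R × HRad d (k - 1) R → HPair d k R) :=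
    (WithLp.toLp_surjective 2).denseRange
  exact h3.comp (h1.prodMap h2) (WithLp.prod_continuous_toLp 2 _ _)

/-- Only the first component enters, so the extension is built on `H^k_rad` alone and composed with
the projection. Any competitor satisfying the estimate is continuous and agrees with it on the dense
set of smooth pairs. -/
theorem LipschitzOnBounded.existsUnique {m : Model} {h : E d → ℝ} {k : ℕ}
    (hL : LipschitzOnBounded m h k R) :
    ∃ hN : ∀ f : SmoothRad d R, secondComponent m h R f ∈ SmoothRad d R,
      ∃! N : HPair d k R → HPair d k R,
        (∀ f₁ f₂ : SmoothRad d R,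
          N (incl k f₁ f₂) = incl k 0 ⟨secondComponent m h R f₁, hN f₁⟩) ∧ QuadLipschitz N := by
  refine ⟨hL.secondComponent_mem, ?_⟩
  set T : SobolevSmoothRad d k R → HRad d (k - 1) R := fun f =>
    ((toSobolev (k - 1) (⟨_, hL.secondComponent_mem f⟩ : SmoothRad d R) :
      SobolevSmoothRad d (k - 1) R) : HRad d (k - 1) R) with hTdef
  have hT : QuadLipschitz T := by
    intro M hM
    obtain ⟨C, hC0, hC⟩ := hL M hM.le
    -- The constant `C` may be zero, whereas a positive one is required.
    refine ⟨C + 1, by linarith, fun f g hf hg => ?_⟩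
    obtain ⟨F, hF, hle⟩ := hC f g hf hg
    have hFeq : toSobolev (k - 1) (⟨_, hL.secondComponent_mem f⟩ : SmoothRad d R) -
        toSobolev (k - 1) (⟨_, hL.secondComponent_mem g⟩ : SmoothRad d R) = toSobolev (k - 1) F := by
      apply Subtype.ext
      funext x
      exact (hF x).symm
    rw [hTdef]
    simp only
    rw [← Completion.coe_sub, Completion.norm_coe, hFeq]
    refine hle.trans ?_
    change C * (‖f‖ + ‖g‖) * ‖f - g‖ ≤ _
    gcongr
    linarith
  obtain ⟨T', hT'e, hT'⟩ := hT.exists_extension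
  refine ⟨fun F => WithLp.toLp 2 (0, T' F.fst), ⟨fun f₁ f₂ => ?_, fun M hM => ?_⟩, ?_⟩
  · exact congrArg (WithLp.toLp 2) (Prod.ext Completion.coe_zero.symm (hT'e (toSobolev k f₁)))
  · obtain ⟨C, hC0, hC⟩ := hT' M hM
    refine ⟨C, hC0, fun f g hf hg => ?_⟩
    have hf1 := WithLp.norm_fst_le _ f
    have hg1 := WithLp.norm_fst_le _ g
    have hfg := WithLp.norm_fst_le _ (f - g)
    rw [← WithLp.toLp_sub, Prod.mk_sub_mk, sub_zero, WithLp.norm_toLp_snd]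
    refine (hC _ _ (hf1.trans hf) (hg1.trans hg)).trans ?_
    gcongr
    exact hfg
  · rintro N ⟨hNe, hNL⟩
    have hT'c := hT'.continuous
    have hcont : Continuous fun F : HPair d k R =>
        (WithLp.toLp 2 (0, T' F.fst) : HPair d k R) :=
      (WithLp.prod_continuous_toLp 2 _ _).comp (continuous_const.prodMk
        (hT'c.comp (continuous_fst.comp (WithLp.prod_continuous_ofLp 2 _ _))))
    refine (denseRange_incl k).equalizer hNL.continuous hcont ?_
    funext p
    refine (hNe p.1 p.2).trans ?_
    exact congrArg (WithLp.toLp 2) (Prod.ext Completion.coe_zero (hT'e (toSobolev k p.1)).symm)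

end Main

end BlowupStability

theorem lemma4p1 (m : BlowupStability.Model) (d k : ℕ) (R : ℝ) (hR : 0 < R)
    (hWM : m = BlowupStability.Model.waveMaps →
      (d : ℝ) / 2 ≤ (k : ℝ) ∧ 2 < (d : ℝ) / 2)
    (hYM : m = BlowupStability.Model.yangMills →
      ((d : ℝ) - 1) / 2 ≤ (k : ℝ) ∧ 5 / 2 < ((d : ℝ) - 1) / 2)
    (h : BlowupStability.E d → ℝ) (hh : BlowupStability.IsHeight h) :
    ∃ hN : ∀ f : BlowupStability.SmoothRad d R,
        BlowupStability.secondComponent m h R f ∈ BlowupStability.SmoothRad d R,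
      ∃! N : BlowupStability.HPair d k R → BlowupStability.HPair d k R,
        (∀ f₁ f₂ : BlowupStability.SmoothRad d R,
          N (BlowupStability.incl k f₁ f₂) =
            BlowupStability.incl k 0
              ⟨BlowupStability.secondComponent m h R f₁, hN f₁⟩) ∧
        ∀ M : ℝ, 0 < M → ∃ C : ℝ, 0 < C ∧
          ∀ f g : BlowupStability.HPair d k R, ‖f‖ ≤ M → ‖g‖ ≤ M →
            ‖N f - N g‖ ≤ C * (‖f‖ + ‖g‖) * ‖f - g‖ := by
  refine BlowupStability.LipschitzOnBounded.existsUnique ?_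
  cases m with
  | waveMaps =>
    obtain ⟨h1, h2⟩ := hWM rfl
    have hd : 4 < d := by
      have : (4 : ℝ) < d := by linarith
      exact_mod_cast this
    have hk : d ≤ 2 * k := by
      have : (d : ℝ) ≤ 2 * k := by linarith
      exact_mod_cast this
    exact BlowupStability.lipschitzOnBounded_waveMaps hR hd (by omega) hh
  | yangMills =>
    obtain ⟨h1, h2⟩ := hYM rfl
    have hd : 6 < d := by
      have : (6 : ℝ) < d := by linarith
      exact_mod_cast this
    have hk : d ≤ 2 * k + 1 := by
      have : (d : ℝ) ≤ 2 * k + 1 := by linarith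
      exact_mod_cast this
    exact BlowupStability.lipschitzOnBounded_yangMills hR hd hk hh
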